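/- **Setting.** Let $\mathcal H_{\mathbb R}$ be a real Hilbert space and $q\in\mathbb R$. Let $S_0(n)$ be the group of permutations of $\{0,1,\dots,n\}$ and $S(n)\subset S_0(n)$ the subgroup fixing $0$; products of permutations are compositions, right to left. For $\alpha\in S_0(n)$ let $\mathrm{cyc}(\alpha)$ be its number of cycles (fixed points included), $\mathrm{cyc}_0(\alpha)=\mathrm{cyc}(\alpha)-1$, $|\alpha|=n+1-\mathrm{cyc}(\alpha)$ and $\chi_q(\alpha)=q^{|\alpha|}$ (with $0^0=1$). $\mathcal H_{\mathbb R}^{\otimes n}$ is the algebraic tensor product with its inner product, and for $\sigma\in S(n)$, $U_\sigma(h_1\otimes\dots\otimes h_n)=h_{\sigma^{-1}(1)}\otimes\dots\otimes h_{\sigma^{-1}(n)}$. Let $V=\bigoplus_{n\ge0}\mathbb C[S_0(n)]\otimes\mathcal H_{\mathbb R}^{\otimes n}$, and let $\mathcal{TP}(\mathcal H_{\mathbb R})$ be the quotient of $V$ by the span of all $\sigma\alpha\sigma^{-1}\otimes U_\sigma F-\alpha\otimes F$, $\sigma\in S(n)$ (equivalently, the fixed points of these actions, via $\alpha\otimes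 F\mapsto\alpha\otimes_sF=\frac1{n!}\sum_{\sigma\in S(n)}\sigma\alpha\sigma^{-1}\otimes U_\sigma F$). The class of $\xi\in V$ is denoted $\mathrm I(\xi)$. For a partition $\pi$ of $\{1,\dots,n\}$ into $\ell$ pairs $\{v_i,w_i\}$ and singletons $u_1<\dots<u_{n-2\ell}$, regarded as an involution with support the union of its pairs, put $$C_\pi(h_1\otimes\dots\otimes h_n)=\prod_{i=1}^\ell\langle h_{v_i},h_{w_i}\rangle\; h_{u_1}\otimes\dots\otimes h_{u_{n-2\ell}},\qquad C_\pi(\alpha)=q^{\mathrm{cyc}_0(\alpha')-\mathrm{cyc}_0(\pi\alpha)+\ell}\,\alpha',$$ where $\alpha'\in S_0(n-2\ell)$ is obtained from $\pi\alpha$ by erasing the support of $\pi$ from its cycles and relabelling in an order-preserving way, and $C_\pi(\alpha\otimes F)=C_\pi(\alpha)\otimes C_\pi(F)$. For $\alpha\in S_0(n)$, $\beta\in S_0(k)$ let $\alpha\cup\beta\in S_0(n+k)$ be $\alpha$ followed by $\beta$ acting on $0,n+1,\dots,n+k$ in place of $0,1,\dots,k$. For $q\neq0$ let $\mathrm T(\alpha\otimes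 F)=\sum_\pi\mathrm I(C_\pi(\alpha\otimes F))$, the sum over all partitions of $\{1,\dots,n\}$ into pairs and singletons, and define a bilinear product and an anti-linear involution on $\mathcal{TP}(\mathcal H_{\mathbb R})$ by $$\mathrm T(\alpha\otimes F)\,\mathrm T(\beta\otimes G)=\mathrm T((\alpha\cup\beta)\otimes(F\otimes G)),\qquad \mathrm T(\alpha\otimes F)^*=\mathrm T(\alpha^{-1}\otimes F).$$ For $q=0$, where $\mathrm T$ is not defined, they are defined by $$\mathrm I(\alpha\otimes F)\,\mathrm I(\beta\otimes G)=\sum_\pi\mathrm I\big(C_\pi((\alpha\cup\beta)\otimes(F\otimes G))\big),\qquad \mathrm I(\alpha\otimes F)^*=\mathrm I(\alpha^{-1}\otimes F),$$ the sum over those $\pi$ whose pairs all have one element in $\{1,\dots,n\}$ and one in $\{n+1,\dots,n+k\}$; only nonnegative powers of $q$ occur here. The $q$-inner product on $\mathcal{TP}(\mathcal H_{\mathbb R})$ is the sesquilinear form (linear in the first variable) given by $$\langle\alpha\otimes F,\beta\otimes G\rangle_q=\delta_{n=k}\sum_{\sigma\in S(n)}\chi_q(\alpha\sigma\beta^{-1}\sigma^{-1})\,\langle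 F,U_\sigma G\rangle,\qquad\alpha\in S_0(n),\ \beta\in S_0(k).$$ Let $\mathcal Z=\{0\}\cup\{\pm\frac1N:N\in\mathbb N,\ N\ge1\}$ and, for $q\in\mathcal Z$, $\mathcal N_{vs,q}=\{\xi:\langle\xi,\xi\rangle_q=0\}$ and $\mathcal{TP}_q(\mathcal H_{\mathbb R})=\mathcal{TP}(\mathcal H_{\mathbb R})/\mathrm{Span}\{\mathrm I(\zeta):\zeta\in\mathcal N_{vs,q}\}$. **Theorem.** There is exactly one linear functional $\varphi$ on $\mathcal{TP}(\mathcal H_{\mathbb R})$ with $\varphi[\mathrm I(\alpha\otimes F)]=0$ for all $\alpha\in S_0(n)$, $F\in\mathcal H_{\mathbb R}^{\otimes n}$, $n\ge1$, and $\varphi[\mathrm I((0))]=1$ for $(0)\in S_0(0)$. It satisfies: 1. For all $\alpha,\beta,F,G$, $\varphi[\mathrm I(\beta\otimes G)^*\,\mathrm I(\alpha\otimes F)]=\langle\alpha\otimes F,\beta\otimes G\rangle_q$; more generally $\varphi[B^*A]=\langle A,B\rangle_q$ for all $A,B\in\mathcal{TP}(\mathcal H_{\mathbb R})$. In particular $*$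 is the adjoint for this inner product: $\langle AB,C\rangle_q=\langle B,A^*C\rangle_q$ and $\langle BA,C\rangle_q=\langle B,CA^*\rangle_q$. 2. $\varphi$ is tracial: $\varphi[AB]=\varphi[BA]$. 3. If $q\in\mathcal Z$, then $\varphi$ is positive: $\varphi[A^*A]\ge0$ for all $A$. 4. If $q\in\mathcal Z$, then $\{A:\varphi[A^*A]=0\}=\mathrm{Span}\{\mathrm I(\zeta):\zeta\in\mathcal N_{vs,q}\}$; the product, the involution and $\varphi$ are well defined on the quotient $\mathcal{TP}_q(\mathcal H_{\mathbb R})$, and $\varphi$ is faithful there ($\varphi[a^*a]=0$ implies $a=0$). 5. If $q\ne0$, then for $\alpha\in S_0(2n)$ and $F\in\mathcal H_{\mathbb R}^{\otimes 2n}$ $$\varphi[\mathrm T(\alpha\otimes F)]=\sum_{\pi}q^{\,n-\mathrm{cyc}_0(\pi\alpha)}\,C_\pi(F),$$ the sum over all pair partitions $\pi$ of $\{1,\dots,2n\}$, and $\varphi[\mathrm T(\alpha\otimes F)]=0$ for $\alpha\in S_0(2n+1)$. -/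

import Mathlib

open scoped TensorProduct DirectSum ComplexOrder

noncomputable section

namespace HermiteTrace

/-! ### Permutations of `{0, 1, …, n}` -/

/-- The symmetric group on `{0, 1, …, n}`; the symbol `0` is `none`, and the symbols `1, …, n` are
the elements `some i` with `i : Fin n`. -/
abbrev S0 (n : ℕ) : Type := Equiv.Perm (Option (Fin n))

/-- The inclusion of the permutations of `{1, …, n}` into those of `{0, 1, …, n}`. -/
def fixZero {n : ℕ} (σ : Equiv.Perm (Fin n)) : S0 n := Equiv.optionCongr σ

/-- The number of cycles of `α` (fixed points included). -/
def cyc {n : ℕ} (α : S0 n) : ℕ := Nat.card (Quotient (Equiv.Perm.SameCycle.setoid α))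

/-- The number of cycles of `α` not containing `0`. -/
def cyc0 {n : ℕ} (α : S0 n) : ℕ := cyc α - 1

/-- The length `|α| = (n + 1) - cyc α`. -/
def len {n : ℕ} (α : S0 n) : ℕ := (n + 1) - cyc α

/-- The function `χ_q(α) = q ^ |α|`. -/
def chi (q : ℝ) {n : ℕ} (α : S0 n) : ℝ := q ^ len α

/-- `α ∪ β`: first `α`, then `β` acting on the shifted symbols `0, n + 1, …, n + k`. -/
def cup {n k : ℕ} (α : S0 n) (β : S0 k) : S0 (n + k) :=
  β.viaEmbedding (Fin.natAddEmb n).optionMap * α.viaEmbedding (Fin.castAddEmb k).optionMap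

/-! ### Restriction of a permutation to a subset -/

section FirstReturn

variable {X Y : Type} [Finite X]

theorem exists_return (α : Equiv.Perm X) (f : Y ↪ X) (y : Y) :
    ∃ m : ℕ, 0 < m ∧ (α ^ m) (f y) ∈ Set.range f :=
  ⟨orderOf α, orderOf_pos α, y, by simp [pow_orderOf_eq_one]⟩

open Classical in
/-- The least `m > 0` such that `α ^ m` takes the point `f y` back to the range of `f`. -/
def returnTime (α : Equiv.Perm X) (f : Y ↪ X) (y : Y) : ℕ := Nat.find (exists_return α f y)

open Classical in
theorem returnTime_spec (α : Equiv.Perm X) (f : Y ↪ X) (y : Y) :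
    0 < returnTime α f y ∧ (α ^ returnTime α f y) (f y) ∈ Set.range f :=
  Nat.find_spec (exists_return α f y)

/-- The point of `Y` at which the orbit of `f y` under `α` first returns to `Y`. -/
def firstReturn (α : Equiv.Perm X) (f : Y ↪ X) (y : Y) : Y :=
  (returnTime_spec α f y).2.choose

theorem firstReturn_spec (α : Equiv.Perm X) (f : Y ↪ X) (y : Y) :
    f (firstReturn α f y) = (α ^ returnTime α f y) (f y) :=
  (returnTime_spec α f y).2.choose_spec

theorem firstReturn_injective (α : Equiv.Perm X) (f : Y ↪ X) :
    Function.Injective (firstReturn α f) := by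
  classical
  have key : ∀ y₁ y₂ : Y, firstReturn α f y₁ = firstReturn α f y₂ →
      returnTime α f y₁ ≤ returnTime α f y₂ → y₁ = y₂ := by
    intro y₁ y₂ h hle
    have e : (α ^ returnTime α f y₁) (f y₁) = (α ^ returnTime α f y₂) (f y₂) := by
      rw [← firstReturn_spec, ← firstReturn_spec, h]
    obtain ⟨d, hd⟩ := Nat.exists_eq_add_of_le hle
    rw [hd, pow_add, Equiv.Perm.mul_apply] at e
    have e' : f y₁ = (α ^ d) (f y₂) := (α ^ returnTime α f y₁).injective e
    rcases Nat.eq_zero_or_pos d with h0 | h0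
    · subst h0
      exact f.injective (by simpa using e')
    · exfalso
      have hlt : d < returnTime α f y₂ := by
        have := (returnTime_spec α f y₁).1
        omega
      exact Nat.find_min (exists_return α f y₂) hlt ⟨h0, y₁, e'⟩
  intro y₁ y₂ h
  rcases le_total (returnTime α f y₁) (returnTime α f y₂) with hle | hle
  · exact key y₁ y₂ h hle
  · exact (key y₂ y₁ h.symm hle).symm

/-- The restriction of the permutation `α` to the range of `f` (erase from the cycles of `α` all
symbols outside the range of `f`), transported to `Y` along `f`. -/
def restrict (α : Equiv.Perm X) (f : Y ↪ X) : Equiv.Perm Y :=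
  haveI : Finite Y := Finite.of_injective f f.injective
  Equiv.ofBijective (firstReturn α f)
    (Finite.injective_iff_bijective.mp (firstReturn_injective α f))

end FirstReturn

/-! ### Partitions into pairs and singletons, and contractions of permutations -/

/-- Partitions of `{1, …, n}` into pairs and singletons, as involutive permutations. -/
abbrev P12 (n : ℕ) : Type := {π : Equiv.Perm (Fin n) // π * π = 1}

/-- The singletons of `π`. -/
def sing {n : ℕ} (π : P12 n) : Finset (Fin n) := Finset.univ.filter fun i => π.1 i = i

/-- The smaller elements of the pairs of `π`. -/
def openers {n : ℕ} (π : P12 n) : Finset (Fin n) := Finset.univ.filter fun i => i < π.1 i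

/-- The number of pairs of `π`. -/
def numPairs {n : ℕ} (π : P12 n) : ℕ := (openers π).card

/-- The number of singletons of `π`, equal to `n - 2 * numPairs π`. -/
def numSing {n : ℕ} (π : P12 n) : ℕ := (sing π).card

/-- The order-preserving enumeration `u_1 < u_2 < …` of the singletons of `π`. -/
def singEmb {n : ℕ} (π : P12 n) : Fin (numSing π) ↪ Fin n :=
  ((sing π).orderEmbOfFin rfl).toEmbedding

/-- The permutation `(π α)` restricted to the complement of the support of `π`, relabelled by the
order-preserving bijection. -/
def contrPerm {n : ℕ} (π : P12 n) (α : S0 n) : S0 (numSing π) :=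
  restrict (fixZero π.1 * α) (singEmb π).optionMap

/-- The weight `q ^ (cyc₀((π α)|_{supp(π)ᶜ}) - cyc₀(π α) + ℓ)` with `ℓ` the number of pairs. -/
def contrWeight (q : ℝ) {n : ℕ} (π : P12 n) (α : S0 n) : ℝ :=
  q ^ ((cyc0 (contrPerm π α) : ℤ) - (cyc0 (fixZero π.1 * α) : ℤ) + (numPairs π : ℤ))

/-- The group algebra `ℂ[S₀(n)]`, as a vector space with basis `S₀(n)`. -/
abbrev GA (n : ℕ) : Type := S0 n →₀ ℂ

/-- The contraction `C_π` on the group algebra. -/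
def contrGA (q : ℝ) {n : ℕ} (π : P12 n) : GA n →ₗ[ℂ] GA (numSing π) :=
  Finsupp.linearCombination ℂ fun α =>
    Finsupp.single (contrPerm π α) ((contrWeight q π α : ℝ) : ℂ)

/-- The bilinear extension of `(α, β) ↦ α ∪ β`. -/
def cupGA (n k : ℕ) : GA n →ₗ[ℂ] GA k →ₗ[ℂ] GA (n + k) :=
  Finsupp.linearCombination ℂ fun α =>
    Finsupp.linearCombination ℂ fun β => Finsupp.single (cup α β) (1 : ℂ)

/-- The adjoint of the group algebra, the anti-linear extension of `α ↦ α⁻¹`. -/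
def starGA (n : ℕ) : GA n →ₗ[ℝ] GA n :=
  (Finsupp.lmapDomain ℂ ℝ fun α : S0 n => α⁻¹) ∘ₗ
    Finsupp.mapRange.linearMap (Complex.conjLIE.toLinearEquiv.toLinearMap : ℂ →ₗ[ℝ] ℂ)

/-- Conjugation by `σ ∈ S(n)` on `ℂ[S₀(n)]`. -/
def conjGA {n : ℕ} (σ : Equiv.Perm (Fin n)) : GA n →ₗ[ℂ] GA n :=
  Finsupp.lmapDomain ℂ ℂ fun α => fixZero σ * α * (fixZero σ)⁻¹

/-! ### Tensors -/

section Tensors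

variable (H : Type*) [NormedAddCommGroup H] [InnerProductSpace ℝ H]

/-- The inner product of `H^{⊗n}`:
`⟨f_1 ⊗ ⋯ ⊗ f_n, g_1 ⊗ ⋯ ⊗ g_n⟩ = ∏ ⟨f_i, g_i⟩`. -/
def tensorInner (n : ℕ) : (⨂[ℝ]^n H) →ₗ[ℝ] (⨂[ℝ]^n H) →ₗ[ℝ] ℝ :=
  PiTensorProduct.dualDistrib ∘ₗ PiTensorProduct.map fun _ => innerₗ H

theorem tensorInner_tprod {n : ℕ} (f g : Fin n → H) :
    tensorInner H n (PiTensorProduct.tprod ℝ f) (PiTensorProduct.tprod ℝ g) =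
      ∏ i, inner ℝ (f i) (g i) := by
  simp [tensorInner]

/-- `U_σ (h_1 ⊗ ⋯ ⊗ h_n) = h_{σ⁻¹(1)} ⊗ ⋯ ⊗ h_{σ⁻¹(n)}`. -/
def U {n : ℕ} (σ : Equiv.Perm (Fin n)) : (⨂[ℝ]^n H) →ₗ[ℝ] (⨂[ℝ]^n H) :=
  (PiTensorProduct.reindex ℝ (fun _ : Fin n => H) σ).toLinearMap

theorem U_tprod {n : ℕ} (σ : Equiv.Perm (Fin n)) (h : Fin n → H) :
    U H σ (PiTensorProduct.tprod ℝ h) = PiTensorProduct.tprod ℝ fun i => h (σ⁻¹ i) := by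
  simp [U]

/-- The concatenation `(F, G) ↦ F ⊗ G`. -/
def tensorMul (n k : ℕ) : (⨂[ℝ]^n H) →ₗ[ℝ] (⨂[ℝ]^k H) →ₗ[ℝ] (⨂[ℝ]^(n + k) H) :=
  TensorProduct.curry TensorPower.mulEquiv.toLinearMap

variable {H}

/-- The contraction
`(h_1, …, h_n) ↦ ∏_{pairs (v, w)} ⟨h_v, h_w⟩ h_{u_1} ⊗ ⋯ ⊗ h_{u_{n - 2ℓ}}`. -/
def contrFun {n : ℕ} (π : P12 n) (h : Fin n → H) : ⨂[ℝ]^(numSing π) H :=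
  (∏ i ∈ openers π, (inner ℝ (h i) (h (π.1 i)) : ℝ)) •
    PiTensorProduct.tprod ℝ fun j => h (singEmb π j)

theorem apply_apply {n : ℕ} (π : P12 n) (i : Fin n) : π.1 (π.1 i) = i := by
  have := congrArg (fun σ : Equiv.Perm (Fin n) => σ i) π.2
  simpa using this

theorem exists_singEmb {n : ℕ} (π : P12 n) {j : Fin n} (hj : π.1 j = j) :
    ∃ k, singEmb π k = j := by
  have h : j ∈ Set.range ((sing π).orderEmbOfFin rfl) := by
    rw [Finset.range_orderEmbOfFin]
    simp [sing, hj]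
  exact h

theorem apply_singEmb {n : ℕ} (π : P12 n) (k : Fin (numSing π)) :
    π.1 (singEmb π k) = singEmb π k := by
  have h : singEmb π k ∈ sing π := (sing π).orderEmbOfFin_mem rfl k
  simpa [sing] using h

theorem contrFun_update {n : ℕ} (π : P12 n) (h : Fin n → H) (j : Fin n) :
    ∃ g : H →ₗ[ℝ] (⨂[ℝ]^(numSing π) H),
      ∀ x, contrFun π (Function.update h j x) = g x := by
  by_cases hj : π.1 j = j
  · obtain ⟨k, hk⟩ := exists_singEmb π hj
    refine ⟨(∏ i ∈ openers π, (inner ℝ (h i) (h (π.1 i)) : ℝ)) •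
      (PiTensorProduct.tprod ℝ).toLinearMap (fun l => h (singEmb π l)) k, fun x => ?_⟩
    simp only [contrFun, LinearMap.smul_apply, MultilinearMap.toLinearMap_apply]
    congr 1
    · refine Finset.prod_congr rfl fun i hi => ?_
      have hi' : i < π.1 i := by simpa [openers] using hi
      have h1 : i ≠ j := by
        rintro rfl
        rw [hj] at hi'
        exact lt_irrefl _ hi'
      have h2 : π.1 i ≠ j := fun h2 => h1 (by rw [← apply_apply π i, h2, hj])
      rw [Function.update_of_ne h1, Function.update_of_ne h2]
    · congr 1
      funext l
      by_cases hl : l = k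
      · subst hl
        rw [hk]
        simp
      · have : singEmb π l ≠ j := fun e => hl ((singEmb π).injective (e.trans hk.symm))
        rw [Function.update_of_ne this, Function.update_of_ne hl]
  · have htp : ∀ x, (fun l => Function.update h j x (singEmb π l)) =
        fun l => h (singEmb π l) := fun x => by
      funext l
      refine Function.update_of_ne (fun e => hj ?_) _ _
      rw [← e]
      exact apply_singEmb π l
    -- the smaller element of the pair that contains `j`
    obtain ⟨o, ho, hoj⟩ : ∃ o ∈ openers π, o = j ∨ π.1 o = j := by
      rcases lt_or_gt_of_ne hj with hlt | hlt
      · exact ⟨π.1 j, by simpa [openers, apply_apply] using hlt, Or.inr (apply_apply π j)⟩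
      · exact ⟨j, by simpa [openers] using hlt, Or.inl rfl⟩
    have ho' : o < π.1 o := by simpa [openers] using ho
    have hrest : ∀ x, ∏ i ∈ (openers π).erase o,
        (inner ℝ (Function.update h j x i) (Function.update h j x (π.1 i)) : ℝ) =
          ∏ i ∈ (openers π).erase o, (inner ℝ (h i) (h (π.1 i)) : ℝ) := fun x => by
      refine Finset.prod_congr rfl fun i hi => ?_
      obtain ⟨hio, hi⟩ := Finset.mem_erase.mp hi
      have hi' : i < π.1 i := by simpa [openers] using hi
      have h3 : i ≠ π.1 o := by
        rintro rfl
        rw [apply_apply] at hi'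
        exact lt_asymm hi' ho'
      have h1 : i ≠ j := by
        rintro rfl
        rcases hoj with e | e
        · exact hio e.symm
        · exact h3 e.symm
      have h2 : π.1 i ≠ j := fun e => by
        rcases hoj with e' | e'
        · exact h3 (by rw [e', ← e, apply_apply])
        · exact hio (π.1.injective (e.trans e'.symm))
      rw [Function.update_of_ne h1, Function.update_of_ne h2]
    obtain ⟨f, hf⟩ : ∃ f : H →ₗ[ℝ] ℝ, ∀ x,
        (inner ℝ (Function.update h j x o) (Function.update h j x (π.1 o)) : ℝ) = f x := by
      rcases hoj with e | e
      · subst e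
        refine ⟨innerₗ H (h (π.1 o)), fun x => ?_⟩
        rw [Function.update_self, Function.update_of_ne ho'.ne', innerₗ_apply_apply,
          real_inner_comm]
      · subst e
        refine ⟨innerₗ H (h o), fun x => ?_⟩
        rw [Function.update_self, Function.update_of_ne ho'.ne, innerₗ_apply_apply]
    refine ⟨f.smulRight ((∏ i ∈ (openers π).erase o, (inner ℝ (h i) (h (π.1 i)) : ℝ)) •
      PiTensorProduct.tprod ℝ fun l => h (singEmb π l)), fun x => ?_⟩
    rw [contrFun, ← Finset.mul_prod_erase _ _ ho, hrest, hf, htp, LinearMap.smulRight_apply,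
      mul_smul]

variable (H)

/-- The contraction `C_π` on `H^{⊗n}`, the linear extension of `contrFun`. -/
def contrTensor {n : ℕ} (π : P12 n) : (⨂[ℝ]^n H) →ₗ[ℝ] (⨂[ℝ]^(numSing π) H) :=
  PiTensorProduct.lift
    { toFun := contrFun π
      map_update_add' := fun {inst} h j x y => by
        cases Subsingleton.elim inst (instDecidableEqFin n)
        obtain ⟨g, hg⟩ := contrFun_update π h j
        rw [hg, hg, hg, map_add]
      map_update_smul' := fun {inst} h j c x => by
        cases Subsingleton.elim inst (instDecidableEqFin n)
        obtain ⟨g, hg⟩ := contrFun_update π h j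
        rw [hg, hg, map_smul] }

theorem contrTensor_tprod {n : ℕ} (π : P12 n) (h : Fin n → H) :
    contrTensor H π (PiTensorProduct.tprod ℝ h) =
      (∏ i ∈ openers π, (inner ℝ (h i) (h (π.1 i)) : ℝ)) •
        PiTensorProduct.tprod ℝ fun j => h (singEmb π j) :=
  PiTensorProduct.lift.tprod _

/-- The identification of `H^{⊗0}` with the scalars, extended by `0` to `H^{⊗n}` with `n > 0`. -/
def scalarPart : (n : ℕ) → (⨂[ℝ]^n H) →ₗ[ℝ] ℝ
  | 0 => (PiTensorProduct.isEmptyEquiv (Fin 0)).toLinearMap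
  | _ + 1 => 0

end Tensors

/-! ### The graded space `⨁ ℂ[S₀(n)] ⊗ H^{⊗n}` -/

section Graded

variable (H : Type*) [NormedAddCommGroup H] [InnerProductSpace ℝ H]

/-- The component `ℂ[S₀(n)] ⊗ H^{⊗n}`, where `H` is a real space. -/
abbrev Comp (n : ℕ) : Type _ := GA n ⊗[ℝ] (⨂[ℝ]^n H)

/-- The graded space `⨁_n ℂ[S₀(n)] ⊗ H^{⊗n}`. -/
abbrev V : Type _ := ⨁ n : ℕ, Comp H n

instance instAddCommGroupV : AddCommGroup (V H) := Module.addCommMonoidToAddCommGroup ℂ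

variable {H}

/-- The element `α ⊗ F`. -/
def elt {n : ℕ} (α : S0 n) (F : ⨂[ℝ]^n H) : V H :=
  DirectSum.lof ℂ ℕ (Comp H) n (Finsupp.single α (1 : ℂ) ⊗ₜ[ℝ] F)

/-- Bilinear maps on the graded space from bilinear maps on the components. -/
def bilin {W : Type*} [AddCommGroup W] [Module ℂ W]
    (f : (n k : ℕ) → Comp H n →ₗ[ℂ] Comp H k →ₗ[ℂ] W) : V H →ₗ[ℂ] V H →ₗ[ℂ] W :=
  DirectSum.toModule ℂ ℕ _ fun n =>
    LinearMap.flip (DirectSum.toModule ℂ ℕ _ fun k => LinearMap.flip (f n k))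

variable (H)

/-- The action of `σ ∈ S(n)`: `α ⊗ F ↦ σ α σ⁻¹ ⊗ U_σ F`. -/
def act {n : ℕ} (σ : Equiv.Perm (Fin n)) : Comp H n →ₗ[ℂ] Comp H n :=
  TensorProduct.AlgebraTensorModule.map (conjGA σ) (U H σ)

/-- The symmetrizing projection `P = ⨁ P_n`, where `P_n` averages over the action of `S(n)`. -/
def symmProj : V H →ₗ[ℂ] V H :=
  DirectSum.toModule ℂ ℕ _ fun n =>
    ((n.factorial : ℂ)⁻¹) • ∑ σ : Equiv.Perm (Fin n), DirectSum.lof ℂ ℕ (Comp H) n ∘ₗ act H σ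

/-- The contraction `C_π (α ⊗ F) = C_π(α) ⊗ C_π(F)`. -/
def contr (q : ℝ) {n : ℕ} (π : P12 n) : Comp H n →ₗ[ℂ] V H :=
  DirectSum.lof ℂ ℕ (Comp H) (numSing π) ∘ₗ
    TensorProduct.AlgebraTensorModule.map (contrGA q π) (contrTensor H π)

/-- The exponential `e^{t 𝓛}` of the Laplacian `𝓛` (the sum of all contractions by
transpositions): on degree `n` it is `∑ t ^ ℓ(π) C_π` over all partitions `π` of `{1, …, n}` into
`ℓ(π)` pairs and some singletons. -/
def expL (q : ℝ) (t : ℂ) : V H →ₗ[ℂ] V H :=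
  DirectSum.toModule ℂ ℕ _ fun n => ∑ π : P12 n, t ^ numPairs π • contr H q π

/-- `(α ⊗ F) (β ⊗ G) ↦ (α ∪ β) ⊗ (F ⊗ G)` on components. -/
def cupComp (n k : ℕ) : Comp H n →ₗ[ℂ] Comp H k →ₗ[ℂ] Comp H (n + k) :=
  TensorProduct.AlgebraTensorModule.homTensorHomMap ℝ ℂ ℂ (GA k) (⨂[ℝ]^k H)
      (GA (n + k)) (⨂[ℝ]^(n + k) H) ∘ₗ
    TensorProduct.AlgebraTensorModule.map (cupGA n k) (tensorMul H n k)

/-- `(α ⊗ F) (β ⊗ G) ↦ (α ∪ β) ⊗ (F ⊗ G)` on the graded space. -/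
def cupV : V H →ₗ[ℂ] V H →ₗ[ℂ] V H :=
  bilin fun n k => (cupComp H n k).compr₂ (DirectSum.lof ℂ ℕ (Comp H) (n + k))

/-- Inhomogeneous partitions: every pair has one element in `{1, …, n}` and the other one in
`{n + 1, …, n + k}`. -/
def IsInhom {n k : ℕ} (π : P12 (n + k)) : Prop :=
  ∀ i : Fin (n + k), i < π.1 i → (i : ℕ) < n ∧ n ≤ (π.1 i : ℕ)

open Classical in
/-- `(α ⊗ F, β ⊗ G) ↦ ∑ C_π((α ∪ β) ⊗ (F ⊗ G))`, the sum over the inhomogeneous partitions. All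
exponents of `q` that occur in it are nonnegative, so that `q = 0` is allowed. -/
def hermiteProd (q : ℝ) : V H →ₗ[ℂ] V H →ₗ[ℂ] V H :=
  bilin fun n k => (cupComp H n k).compr₂
    (∑ π : P12 (n + k), if IsInhom π then contr H q π else 0)

/-- `α ⊗ F ↦ α⁻¹ ⊗ F`, anti-linear. -/
def starV : V H →ₗ[ℝ] V H :=
  DirectSum.toModule ℝ ℕ _ fun n =>
    DirectSum.lof ℝ ℕ (Comp H) n ∘ₗ TensorProduct.map (starGA n) LinearMap.id

/-- The bilinear form `(α, β) ↦ χ_q(α σ β σ⁻¹)` on the group algebra. -/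
def chiForm (q : ℝ) {n : ℕ} (σ : Equiv.Perm (Fin n)) : GA n →ₗ[ℂ] GA n →ₗ[ℂ] ℂ :=
  Finsupp.linearCombination ℂ fun α => Finsupp.linearCombination ℂ fun β =>
    ((chi q (α * fixZero σ * β * (fixZero σ)⁻¹) : ℝ) : ℂ)

/-- `(α ⊗ F, β ⊗ G) ↦ ∑_σ χ_q(α σ β σ⁻¹) ⟨F, U_σ G⟩`, bilinear. -/
def formComp (q : ℝ) (n : ℕ) : Comp H n →ₗ[ℂ] Comp H n →ₗ[ℂ] ℂ :=
  ∑ σ : Equiv.Perm (Fin n),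
    (TensorProduct.AlgebraTensorModule.homTensorHomMap ℝ ℂ ℂ (GA n) (⨂[ℝ]^n H) ℂ ℝ ∘ₗ
      TensorProduct.AlgebraTensorModule.map (chiForm q σ)
        ((tensorInner H n).compl₂ (U H σ))).compr₂
      (TensorProduct.AlgebraTensorModule.rid ℝ ℂ ℂ).toLinearMap

/-- The `q`-inner product, linear in the first and anti-linear in the second variable:
components of different degrees are orthogonal, and
`⟨α ⊗ F, β ⊗ G⟩_q = ∑_σ χ_q(α σ β⁻¹ σ⁻¹) ⟨F, U_σ G⟩` on degree `n`. -/
def innerV (q : ℝ) (x y : V H) : ℂ :=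
  (DirectSum.toModule ℂ ℕ (V H →ₗ[ℂ] ℂ) fun n =>
    (formComp H q n).compl₂ (DirectSum.component ℂ ℕ (Comp H) n)) x (starV H y)

/-- The coefficient of the unit: the linear extension of `α ⊗ F ↦ 0` in degree `n > 0` and
`(0) ↦ 1` in degree `0`. -/
def phiV : V H →ₗ[ℂ] ℂ :=
  DirectSum.toModule ℂ ℕ _ fun n =>
    (TensorProduct.AlgebraTensorModule.rid ℝ ℂ ℂ).toLinearMap ∘ₗ
      TensorProduct.AlgebraTensorModule.map
        (Finsupp.linearCombination ℂ fun _ : S0 n => (1 : ℂ)) (scalarPart H n)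

/-! ### The algebra of Hermite trace polynomials -/

/-- The span of the differences `σ α σ⁻¹ ⊗ U_σ F - α ⊗ F`. -/
def symmRel : Submodule ℂ (V H) :=
  Submodule.span ℂ {z | ∃ (n : ℕ) (σ : Equiv.Perm (Fin n)) (α : S0 n) (F : ⨂[ℝ]^n H),
    z = elt (fixZero σ * α * (fixZero σ)⁻¹) (U H σ F) - elt α F}

/-- The vector space `𝒯𝒫(H) = ⨁ ℂ[S₀(n)] ⊗_s H^{⊗n}`, the quotient of the graded space by the
actions of the groups `S(n)`. The class of `α ⊗ F` is written `I(α ⊗ F)`. -/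
abbrev TP : Type _ := V H ⧸ symmRel H

/-- The Hermite trace polynomial `I(ξ)`, extended linearly in `ξ`. -/
def I : V H →ₗ[ℂ] TP H := (symmRel H).mkQ

theorem fixZero_mul {n : ℕ} (σ τ : Equiv.Perm (Fin n)) :
    fixZero (σ * τ) = fixZero σ * fixZero τ := by
  ext x : 1
  cases x <;> rfl

theorem U_mul {n : ℕ} (σ τ : Equiv.Perm (Fin n)) (F : ⨂[ℝ]^n H) :
    U H σ (U H τ F) = U H (σ * τ) F := by
  have : U H σ ∘ₗ U H τ = U H (σ * τ) := by
    refine PiTensorProduct.ext (MultilinearMap.ext fun h => ?_)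
    simp [U_tprod]
  exact LinearMap.congr_fun this F

theorem symmProj_elt {n : ℕ} (α : S0 n) (F : ⨂[ℝ]^n H) :
    symmProj H (elt α F) = ((n.factorial : ℂ)⁻¹) • ∑ σ : Equiv.Perm (Fin n),
      elt (fixZero σ * α * (fixZero σ)⁻¹) (U H σ F) := by
  simp [symmProj, elt, act, conjGA]

theorem symmRel_le : symmRel H ≤ LinearMap.ker (symmProj H) := by
  refine Submodule.span_le.mpr ?_
  rintro _ ⟨n, σ, α, F, rfl⟩
  rw [SetLike.mem_coe, LinearMap.mem_ker, map_sub, sub_eq_zero, symmProj_elt, symmProj_elt]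
  congr 1
  refine Fintype.sum_equiv (Equiv.mulRight σ) _ _ fun τ => ?_
  rw [Equiv.coe_mulRight, U_mul, fixZero_mul]
  simp only [mul_inv_rev, mul_assoc]

/-- The identification of `𝒯𝒫(H)` with the fixed point subspace of the actions of the groups
`S(n)`, which sends the class of `α ⊗ F` to `α ⊗_s F = P_n (α ⊗ F)`. -/
def sec : TP H →ₗ[ℂ] V H := (symmRel H).liftQ (symmProj H) (symmRel_le H)

/-- `T(ξ) = I(e^𝓛 ξ)`, defined for `q ≠ 0`. -/
def T (q : ℝ) : V H →ₗ[ℂ] TP H := I H ∘ₗ expL H q 1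

/-- The product on the graded space before symmetrization. For `q ≠ 0` it is determined by
`T(ξ) T(ζ) = T(ξ ∪ ζ)`, that is, it is the product `∪` transported by `e^𝓛`. For `q = 0`, where
`T` is not defined, it is given by the product formula for Hermite trace polynomials. -/
def mulV (q : ℝ) : V H →ₗ[ℂ] V H →ₗ[ℂ] V H :=
  if q = 0 then hermiteProd H 0
  else ((cupV H).compl₁₂ (expL H q (-1)) (expL H q (-1))).compr₂ (expL H q 1)

/-- The product of `𝒯𝒫(H)`, computed on the symmetrized representatives. -/
def mul (q : ℝ) : TP H →ₗ[ℂ] TP H →ₗ[ℂ] TP H :=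
  ((mulV H q).compl₁₂ (sec H) (sec H)).compr₂ (I H)

/-- The involution before symmetrization. For `q ≠ 0` it is determined by
`T(α ⊗ F)^* = T(α⁻¹ ⊗ F)`, and for `q = 0` by `I(α ⊗ F)^* = I(α⁻¹ ⊗ F)`. -/
def adjV (q : ℝ) (x : V H) : V H :=
  if q = 0 then starV H x else expL H q 1 (starV H (expL H q (-1) x))

/-- The involution of `𝒯𝒫(H)`. -/
def adj (q : ℝ) (A : TP H) : TP H := I H (adjV H q (sec H A))

/-- The `q`-inner product on `𝒯𝒫(H)`. -/
def innerTP (q : ℝ) (A B : TP H) : ℂ := innerV H q (sec H A) (sec H B)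

/-- The functional `φ`, with `φ(I(α ⊗ F)) = 0` in degree `n > 0` and `φ(I((0))) = 1`. -/
def phi : TP H →ₗ[ℂ] ℂ := phiV H ∘ₗ sec H

/-- The span of the null vectors of the `q`-inner product. -/
def Nvs (q : ℝ) : Submodule ℂ (TP H) := Submodule.span ℂ {ξ | innerTP H q ξ ξ = 0}

/-- The quotient `𝒯𝒫_q(H) = 𝒯𝒫(H) / N_{vs,q}`. -/
abbrev TPq (q : ℝ) : Type _ := TP H ⧸ Nvs H q

end Graded

/-- The unit `(0)` of degree `0`. -/
def unit (H : Type*) [NormedAddCommGroup H] [InnerProductSpace ℝ H] : V H :=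
  elt (1 : S0 0) (PiTensorProduct.tprod ℝ Fin.elim0)

/-- The set `{0} ∪ {±1/N : N ≥ 1}`. -/
def Z : Set ℝ := {q | q = 0 ∨ ∃ N : ℕ, 1 ≤ N ∧ (q = 1 / (N : ℝ) ∨ q = -(1 / (N : ℝ)))}

end HermiteTrace

end

open scoped TensorProduct DirectSum ComplexOrder

noncomputable section

namespace HermiteTrace

open Equiv

/-! ### First returns -/

section Returns

/-! The product has two descriptions. For `q ≠ 0` it is `∪` transported by `e^𝓛`, so associativity
and `(AB)^* = B^* A^*` are inherited from `∪`. It is also the sum `hprod` of the inhomogeneous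
contractions, which is polynomial in `q` and makes sense at `q = 0`. The two agree (`hprod_E_E`,
`mul_eq_hprod`) because contractions compose (`C_glue`), which makes `e^{-𝓛}` inverse to `e^𝓛` by
inclusion-exclusion (`E_comp_neg`), and because an involution of a disjoint union splits uniquely
into its pairs on the left, its pairs on the right and its mixed pairs (`isHomPart_iff`).

Applied to a product of two Hermite trace polynomials, `φ` keeps only the mixed partitions without
singletons. These are bijections `σ` between the index sets, and the cycles of `π (α ∪ β)`
correspond to those of `α σ β σ⁻¹` (`numCycles_pairingOf_mul`). Hence `φ[AB]` is the bilinear form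
`formT`, that is `⟨A, B^*⟩_q` (`phi_hprod`). It is symmetric because the number of cycles is a class
function, so `φ` is tracial. Contraction weights do not change under inversion, so the involution is
`α ↦ α⁻¹` on Hermite trace polynomials for every `q` (`adj_eq_starT`). The adjoint relations follow
from associativity and `(AB)^* = B^* A^*`, read inside `formT`. At `q = 0` they are limits of the
case `q ≠ 0`, since the exponents of `q` in mixed contractions are nonnegative (`contrExp_nonneg`,
`formT_hprod`, `formT_starT_hprod`).

For `q = 1/N`, positivity comes from `N^{cyc(a b⁻¹)}` being the number of maps `f` into an
`N`-element set with `f ∘ a = f ∘ b`, a Gram kernel. The case `-1/N` adds a sign character, and `q =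
0` gives the delta kernel (`isGram_chi`). Multiplying by the Gram kernel of the tensors and
averaging over labellings gives `formT_self_nonneg`. By Cauchy-Schwarz the null vectors are the
radical of `formT` (`mem_Nvs_iff`), a `*`-invariant two-sided ideal killed by `φ = ⟨·, 1⟩_q`, which
gives the quotient.

Two devices carry the bookkeeping. Index sets are arbitrary finite types (`J`), so sums of index
sets and sets of singletons need no renumbering. Cycles are counted through invariant functions
(`card_invFun`), so that equalities of cycle numbers become bijections between sets of functions. -/

/-- `FirstHit α S x y`: the orbit `α x, α (α x), …` runs outside `S` until it reaches `y`. -/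
inductive FirstHit {X : Type} (α : Perm X) (S : Set X) : X → X → Prop
  | one (x : X) : FirstHit α S x (α x)
  | step {x y : X} : α x ∉ S → FirstHit α S (α x) y → FirstHit α S x y

variable {X Y W : Type}

theorem FirstHit.of_pow (α : Perm X) (S : Set X) (m : ℕ) (x : X)
    (h : ∀ k, 0 < k → k ≤ m → (α ^ k) x ∉ S) : FirstHit α S x ((α ^ (m + 1)) x) := by
  induction m generalizing x with
  | zero => simpa using FirstHit.one x
  | succ m ih =>
    refine .step (by simpa using h 1 one_pos (by omega)) ?_
    have := ih (α x) fun k hk hkm => by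
      have := h (k + 1) (by omega) (by omega)
      rwa [pow_succ, Perm.mul_apply] at this
    rwa [← Perm.mul_apply, ← pow_succ] at this

/-- The end point of a run is not required to lie in `S`. Once it does, the run cannot be prolonged,
and this determines it. -/
theorem FirstHit.unique {α : Perm X} {S : Set X} {x y z : X} (h : FirstHit α S x y) (hy : y ∈ S)
    (h' : FirstHit α S x z) (hz : z ∈ S) : y = z := by
  induction h with
  | one x =>
    cases h' with
    | one => rfl
    | step hn _ => exact absurd hy hn
  | step hn _ ih =>
    cases h' with
    | one => exact absurd hz hn
    | step _ h' => exact ih hy h'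

theorem FirstHit.mono {α : Perm X} {S S' : Set X} (hS : S' ⊆ S) {x y : X}
    (h : FirstHit α S x y) : FirstHit α S' x y := by
  induction h with
  | one x => exact .one x
  | step hn _ ih => exact .step (fun h => hn (hS h)) ih

theorem FirstHit.trans {α : Perm X} {S : Set X} {x y z : X}
    (h : FirstHit α S x y) (hy : y ∉ S) (h' : FirstHit α S y z) : FirstHit α S x z := by
  induction h with
  | one x => exact .step hy h'
  | step hn _ ih => exact .step hn (ih hy h')

theorem FirstHit.symm {α : Perm X} {S : Set X} {x y : X}
    (h : FirstHit α S x y) : FirstHit α⁻¹ S y x := by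
  induction h with
  | one x => simpa using FirstHit.one (α := α⁻¹) (S := S) (α x)
  | @step x y hn _ ih =>
    refine ih.trans hn ?_
    simpa using FirstHit.one (α := α⁻¹) (S := S) (α x)

theorem FirstHit.map {α : Perm X} {β : Perm Y} {S : Set X} {S' : Set Y} (e : X → Y)
    (he : ∀ x, e (α x) = β (e x)) (hS : ∀ x, e x ∈ S' → x ∈ S) {x y : X}
    (h : FirstHit α S x y) : FirstHit β S' (e x) (e y) := by
  induction h with
  | one x => rw [he]; exact .one _
  | step hn _ ih =>
    refine .step (fun h => hn (hS _ (by rwa [he]))) ?_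
    rwa [he] at ih

/-- `τ` acts trivially on the intermediate points, so `τ * α` follows `α` up to the last step and
only the end point is moved. -/
theorem FirstHit.mul_left {α τ : Perm X} {S : Set X} (hτ : ∀ x, x ∉ S → τ x = x) {x y : X}
    (h : FirstHit α S x y) : FirstHit (τ * α) S x (τ y) := by
  induction h with
  | one x => exact .one (α := τ * α) x
  | @step x y hn _ ih =>
    have e : (τ * α) x = α x := hτ _ hn
    exact .step (by rwa [e]) (by rwa [e])

theorem FirstHit.sameCycle {α : Perm X} {S : Set X} {x y : X}
    (h : FirstHit α S x y) : α.SameCycle x y := by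
  induction h with
  | one x => exact ⟨1, by simp⟩
  | step _ _ ih => exact (Perm.sameCycle_apply_left).mp ih

variable [Finite X]

open Classical in
theorem firstHit_restrict (α : Perm X) (f : Y ↪ X) (y : Y) :
    FirstHit α (Set.range f) (f y) (f (restrict α f y)) := by
  have h : f (restrict α f y) = (α ^ returnTime α f y) (f y) := firstReturn_spec α f y
  obtain ⟨m, hm⟩ := Nat.exists_eq_succ_of_ne_zero (returnTime_spec α f y).1.ne'
  rw [h, hm]
  refine .of_pow α _ m _ fun k hk hkm hmem => ?_
  have hlt : k < returnTime α f y := by omega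
  exact Nat.find_min (exists_return α f y) hlt ⟨hk, hmem⟩

/-- Exhibiting a run is enough to compute a value of `restrict`; the return time no longer appears.
-/
theorem restrict_apply_eq {α : Perm X} {f : Y ↪ X} {y y' : Y}
    (h : FirstHit α (Set.range f) (f y) (f y')) : restrict α f y = y' :=
  f.injective ((firstHit_restrict α f y).unique ⟨_, rfl⟩ h ⟨_, rfl⟩)

theorem restrict_trans (α : Perm X) (f : Y ↪ X) [Finite Y] (g : W ↪ Y) :
    restrict (restrict α f) g = restrict α (g.trans f) := by
  have key : ∀ y y' : Y, FirstHit (restrict α f) (Set.range g) y y' →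
      FirstHit α (Set.range (g.trans f)) (f y) (f y') := by
    have hmono : Set.range (g.trans f) ⊆ Set.range f := by
      rintro _ ⟨w, rfl⟩
      exact ⟨g w, rfl⟩
    intro y y' h
    induction h with
    | one y => exact (firstHit_restrict α f y).mono hmono
    | @step y y' hn _ ih =>
      refine ((firstHit_restrict α f y).mono hmono).trans ?_ ih
      rintro ⟨w, hw⟩
      exact hn ⟨w, f.injective hw⟩
  ext w
  exact (restrict_apply_eq (key _ _ (firstHit_restrict (restrict α f) g w))).symm

theorem restrict_inv (α : Perm X) (f : Y ↪ X) : restrict α⁻¹ f = (restrict α f)⁻¹ := by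
  ext y
  rw [Perm.eq_inv_iff_eq]
  refine restrict_apply_eq ?_
  simpa using (firstHit_restrict α⁻¹ f y).symm

theorem restrict_mul_left (α τ : Perm X) (f : Y ↪ X) (τ' : Perm Y)
    (hf : ∀ y, τ (f y) = f (τ' y)) (hτ : ∀ x, x ∉ Set.range f → τ x = x) :
    restrict (τ * α) f = τ' * restrict α f := by
  ext y
  refine restrict_apply_eq ?_
  rw [Perm.mul_apply, ← hf]
  exact (firstHit_restrict α f y).mul_left hτ

/-- An intertwiner `eX` carries runs to runs, provided that it sends nothing outside the range of
`f` into the range of `f'`. Both relabellings and conjugation by `π` itself are used as `eX`. -/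
theorem restrict_map {X' Y' : Type} [Finite X'] (α : Perm X) (α' : Perm X') (f : Y ↪ X)
    (f' : Y' ↪ X') (eX : X → X') (eY : Y ≃ Y') (h : ∀ x, eX (α x) = α' (eX x))
    (hf : ∀ y, eX (f y) = f' (eY y)) (hX : ∀ x y', eX x = f' y' → x ∈ Set.range f) :
    restrict α' f' = (eY.symm.trans (restrict α f)).trans eY := by
  ext y'
  obtain ⟨y, rfl⟩ := eY.surjective y'
  refine restrict_apply_eq ?_
  have := (firstHit_restrict α f y).map (S' := Set.range f') eX h
    (by rintro x ⟨y', hy'⟩; exact hX x y' hy'.symm)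
  simpa [hf] using this

theorem sameCycle_restrict (α : Perm X) (f : Y ↪ X) (x y : Y) :
    (restrict α f).SameCycle x y ↔ α.SameCycle (f x) (f y) := by
  have : Finite Y := Finite.of_injective f f.injective
  constructor
  · intro h
    obtain ⟨i, hi⟩ := h.exists_nat_pow_eq
    induction i generalizing x with
    | zero =>
      obtain rfl : x = y := by simpa using hi
      rfl
    | succ i ih =>
      rw [pow_succ, Perm.mul_apply] at hi
      exact (firstHit_restrict α f x).sameCycle.trans
        (ih _ ((Perm.sameCycle_apply_left).mpr h) hi)
  · intro h
    obtain ⟨i, hi⟩ := h.exists_nat_pow_eq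
    induction i using Nat.strong_induction_on generalizing x with
    | _ i ih =>
      classical
      rcases Nat.eq_zero_or_pos i with rfl | hpos
      · obtain rfl : x = y := by simpa using hi
        rfl
      -- The exponent `i` is itself a return to the range of `f`, so the first return can be split
      -- off from it and the rest is shorter.
      · have hle : returnTime α f x ≤ i := Nat.find_min' (exists_return α f x) ⟨hpos, y, hi.symm⟩
        have hspec : f (restrict α f x) = (α ^ returnTime α f x) (f x) := firstReturn_spec α f x
        have h0 := (returnTime_spec α f x).1
        refine (Perm.sameCycle_apply_left).mp (ih (i - returnTime α f x) (by omega) _ ?_ ?_)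
        · rw [hspec]
          exact (Perm.sameCycle_pow_left).mpr h
        · rw [hspec, ← Perm.mul_apply, ← pow_add, Nat.sub_add_cancel hle, hi]

end Returns

/-! ### Counting cycles -/

section Cycles

variable {X Y : Type} [Finite X]

/-- The number of cycles of a permutation. -/
def numCycles (α : Perm X) : ℕ := Nat.card (Quotient (Perm.SameCycle.setoid α))

/-- The number of cycles of a permutation that are contained in `S`. -/
def numCyclesIn (α : Perm X) (S : Set X) : ℕ :=
  Nat.card {c : Quotient (Perm.SameCycle.setoid α) // ∀ x, Quotient.mk _ x = c → x ∈ S}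

theorem numCycles_eq_numCyclesIn_univ (α : Perm X) : numCycles α = numCyclesIn α Set.univ :=
  (Nat.card_congr (Equiv.subtypeUnivEquiv fun _ _ _ => Set.mem_univ _)).symm

/-- A cycle that meets the range of `f` leaves exactly one cycle of the restriction; the other
cycles lie in the complement and disappear. -/
theorem numCycles_eq_restrict_add (α : Perm X) (f : Y ↪ X) :
    numCycles α = numCycles (restrict α f) + numCyclesIn α (Set.range f)ᶜ := by
  classical
  have : Finite (Quotient (Perm.SameCycle.setoid α)) := inferInstance
  let p : Quotient (Perm.SameCycle.setoid α) → Prop := fun c =>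
    ∀ x, Quotient.mk _ x = c → x ∈ (Set.range f)ᶜ
  have h1 : numCycles (restrict α f) = Nat.card {c // ¬ p c} := by
    refine Nat.card_congr (Equiv.ofBijective
      (fun c => ⟨Quotient.map' (s₁ := Perm.SameCycle.setoid _) (s₂ := Perm.SameCycle.setoid _)
        f (fun a b h => (sameCycle_restrict α f a b).mp h) c, ?_⟩) ⟨?_, ?_⟩)
    · induction c using Quotient.inductionOn with
      | h y =>
        intro h
        exact h (f y) rfl ⟨y, rfl⟩
    · intro c d h
      induction c using Quotient.inductionOn with
      | h y =>
      induction d using Quotient.inductionOn with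
      | h z =>
      refine Quotient.sound ?_
      have := Quotient.exact (Subtype.ext_iff.mp h)
      exact (sameCycle_restrict α f y z).mpr this
    · rintro ⟨c, hc⟩
      have hc' : ∃ x, Quotient.mk _ x = c ∧ x ∈ Set.range f := by
        simpa [p] using hc
      obtain ⟨_, rfl, y, rfl⟩ := hc'
      exact ⟨Quotient.mk _ y, rfl⟩
  rw [h1, numCycles, ← Nat.card_congr (Equiv.sumCompl p), Nat.card_sum, add_comm]
  rfl

/-- The `A`-valued functions that are invariant under `α` and vanish outside `S`. -/
abbrev InvFun (α : Perm X) (S : Set X) (A : Type) [Zero A] : Type :=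
  {f : X → A // (∀ x, f (α x) = f x) ∧ ∀ x, x ∉ S → f x = 0}

theorem eq_of_sameCycle {A : Type} {α : Perm X} {f : X → A} (h : ∀ x, f (α x) = f x) {x y : X}
    (hxy : α.SameCycle x y) : f x = f y := by
  obtain ⟨i, rfl⟩ := hxy.exists_nat_pow_eq
  induction i with
  | zero => rfl
  | succ i ih =>
    rw [pow_succ', Perm.mul_apply, h]
    exact ih ⟨i, by simp⟩

/-- An invariant function is constant on cycles and must vanish on every cycle that leaves `S`; on
the cycles inside `S` its values are free. The case `A = Fin 2` compares cycle numbers, and `A = Fin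
N` gives positivity. -/
theorem card_invFun (α : Perm X) (S : Set X) (A : Type) [Zero A] :
    Nat.card (InvFun α S A) = Nat.card A ^ numCyclesIn α S := by
  classical
  have : Finite (Quotient (Perm.SameCycle.setoid α)) := inferInstance
  rw [numCyclesIn, ← Nat.card_fun]
  let P : Quotient (Perm.SameCycle.setoid α) → Prop := fun c => ∀ x, Quotient.mk _ x = c → x ∈ S
  refine Nat.card_congr
    { toFun := fun f c => Quotient.lift f.1 (fun a b h => eq_of_sameCycle f.2.1 h) c.1
      invFun := fun g => ⟨fun x => if h : P (Quotient.mk _ x) then g ⟨_, h⟩ else 0, ?_, ?_⟩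
      left_inv := ?_
      right_inv := ?_ }
  · intro x
    have : (Quotient.mk (Perm.SameCycle.setoid α) (α x)) = Quotient.mk _ x :=
      Quotient.sound ((Perm.sameCycle_apply_left).mpr (Perm.SameCycle.refl _ _))
    simp only [this]
  · intro x hx
    exact dif_neg fun h => hx (h x rfl)
  · intro f
    ext x
    simp only
    split_ifs with h
    · rfl
    · simp only [P, not_forall] at h
      obtain ⟨y, hy, hyS⟩ := h
      exact (f.2.2 y hyS).symm.trans (eq_of_sameCycle f.2.1 (Quotient.exact hy))
  · intro g
    funext c
    obtain ⟨c, hc⟩ := c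
    induction c using Quotient.inductionOn with
    | h x => exact dif_pos hc

theorem numCyclesIn_eq_of_equiv {X' : Type} [Finite X'] {α : Perm X} {S : Set X} {α' : Perm X'}
    {S' : Set X'} (e : InvFun α S (Fin 2) ≃ InvFun α' S' (Fin 2)) :
    numCyclesIn α S = numCyclesIn α' S' := by
  have := Nat.card_congr e
  rw [card_invFun, card_invFun] at this
  exact Nat.pow_right_injective le_rfl (by simpa using this)

theorem numCycles_eq_of_equiv {X' : Type} [Finite X'] {α : Perm X} {α' : Perm X'}
    (e : InvFun α Set.univ (Fin 2) ≃ InvFun α' Set.univ (Fin 2)) :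
    numCycles α = numCycles α' := by
  rw [numCycles_eq_numCyclesIn_univ, numCycles_eq_numCyclesIn_univ, numCyclesIn_eq_of_equiv e]

theorem numCyclesIn_map {X' : Type} [Finite X'] {α : Perm X} {α' : Perm X'} (e : X ≃ X')
    (h : ∀ x, e (α x) = α' (e x)) (S : Set X) :
    numCyclesIn α S = numCyclesIn α' (e.symm ⁻¹' S) := by
  refine numCyclesIn_eq_of_equiv
    { toFun := fun f => ⟨f.1 ∘ e.symm, fun x => ?_, fun x hx => f.2.2 _ hx⟩
      invFun := fun g => ⟨g.1 ∘ e, fun x => ?_, fun x hx => g.2.2 _ (by simpa using hx)⟩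
      left_inv := fun f => by ext; simp
      right_inv := fun f => by ext; simp }
  · obtain ⟨y, rfl⟩ := e.surjective x
    simp [← h, f.2.1]
  · simp [h, g.2.1]

theorem numCycles_map {X' : Type} [Finite X'] {α : Perm X} {α' : Perm X'} (e : X ≃ X')
    (h : ∀ x, e (α x) = α' (e x)) : numCycles α = numCycles α' := by
  rw [numCycles_eq_numCyclesIn_univ, numCycles_eq_numCyclesIn_univ, numCyclesIn_map e h]
  rfl

/-- `τ` preserves the complement of `S`, where the functions vanish, so `f ∘ τ = f` and the two
invariance conditions coincide. -/
theorem numCyclesIn_mul_left (α τ : Perm X) (S : Set X) (hτ : ∀ x ∈ S, τ x = x) :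
    numCyclesIn (τ * α) S = numCyclesIn α S := by
  have key : ∀ f : X → Fin 2, (∀ x, x ∉ S → f x = 0) → ∀ x, f (τ x) = f x := by
    intro f hf x
    by_cases hx : x ∈ S
    · rw [hτ x hx]
    · rw [hf x hx]
      refine hf _ fun h => hx ?_
      have := τ.injective (hτ _ h)
      rwa [← this]
  refine numCyclesIn_eq_of_equiv (Equiv.subtypeEquivRight fun f => ?_)
  refine and_congr_left fun hf => forall_congr' fun x => ?_
  rw [Perm.mul_apply, key f hf]

theorem numCycles_inv (α : Perm X) : numCycles α⁻¹ = numCycles α := by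
  refine numCycles_eq_of_equiv (Equiv.subtypeEquivRight fun f => ?_)
  refine and_congr_left fun _ => ⟨fun h x => ?_, fun h x => ?_⟩
  · simpa using (h (α x)).symm
  · simpa using (h (α⁻¹ x)).symm

theorem numCycles_mul_comm (α β : Perm X) : numCycles (α * β) = numCycles (β * α) :=
  numCycles_map β fun _ => rfl

/-- `f ∘ α` and `f` take the value `f x` equally often, so they cannot differ at just one point. -/
theorem apply_eq_of_forall_ne {A : Type} (α : Perm X) (f : X → A) (x : X)
    (h : ∀ y, y ≠ x → f (α y) = f y) : f (α x) = f x := by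
  classical
  have := Fintype.ofFinite X
  by_contra hne
  have h1 : ∑ y, (if f (α y) = f x then 1 else 0) = ∑ y, (if f y = f x then 1 else 0) :=
    Equiv.sum_comp α fun y => if f y = f x then 1 else 0
  rw [← Finset.add_sum_erase _ _ (Finset.mem_univ x),
    ← Finset.add_sum_erase (a := x) _ (fun y => if f y = f x then 1 else 0) (Finset.mem_univ x),
    Finset.sum_congr rfl fun y hy => by rw [h y (Finset.ne_of_mem_erase hy)]] at h1
  simp [hne] at h1

end Cycles

/-! ### Hermite trace polynomials with arbitrary finite index sets -/

section Labels

variable {H : Type*} [NormedAddCommGroup H] [InnerProductSpace ℝ H]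
variable {ι κ Y : Type}

theorem elt_smul {n : ℕ} (α : S0 n) (r : ℝ) (F : ⨂[ℝ]^n H) :
    elt α (r • F) = (r : ℂ) • elt α F := by
  rw [elt, TensorProduct.tmul_smul, TensorProduct.smul_tmul', elt, ← map_smul,
    TensorProduct.smul_tmul']
  rfl

theorem I_elt_conj {n : ℕ} (σ : Perm (Fin n)) (α : S0 n) (F : ⨂[ℝ]^n H) :
    I H (elt (fixZero σ * α * (fixZero σ)⁻¹) (U H σ F)) = I H (elt α F) :=
  (Submodule.Quotient.eq _).mpr (Submodule.subset_span ⟨n, σ, α, F, rfl⟩)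

variable [Finite ι] [Finite κ]

/-- The Hermite trace polynomial `I(α ⊗ h)`, where `α` is a permutation of `{0} ∪ ι` and `h` is a
family of vectors indexed by `ι`. -/
def J (α : Perm (Option ι)) (h : ι → H) : TP H :=
  I H (elt ((optionCongr (Finite.equivFin ι)).permCongr α)
    (PiTensorProduct.tprod ℝ (h ∘ (Finite.equivFin ι).symm)))

/-- Two labellings differ by a permutation of `Fin n`, and this is what the quotient by the actions
of `S(n)` forgets. The enumeration chosen in `J` therefore does not matter. -/
theorem J_eq_of_equiv {n : ℕ} (e : ι ≃ Fin n) (α : Perm (Option ι)) (h : ι → H) :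
    J α h = I H (elt ((optionCongr e).permCongr α) (PiTensorProduct.tprod ℝ (h ∘ e.symm))) := by
  obtain rfl : n = Nat.card ι := by rw [Nat.card_congr e, Nat.card_fin]
  obtain ⟨σ, hσ⟩ : ∃ σ : Perm (Fin (Nat.card ι)), e.trans σ = Finite.equivFin ι :=
    ⟨e.symm.trans (Finite.equivFin ι), by ext; simp⟩
  rw [← I_elt_conj σ ((optionCongr e).permCongr α), U_tprod, J, ← hσ, optionCongr_trans]
  rfl

theorem J_fin {n : ℕ} (α : S0 n) (h : Fin n → H) :
    J α h = I H (elt α (PiTensorProduct.tprod ℝ h)) := by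
  rw [J_eq_of_equiv (Equiv.refl _)]
  congr 3
  ext x : 1
  simp

theorem J_iso (e : ι ≃ κ) {α : Perm (Option ι)} {β : Perm (Option κ)} {h : ι → H} {g : κ → H}
    (hα : ∀ x, optionCongr e (α x) = β (optionCongr e x)) (hh : ∀ i, g (e i) = h i) :
    J α h = J β g := by
  have h1 : (optionCongr (e.trans (Finite.equivFin κ))).permCongr α =
      (optionCongr (Finite.equivFin κ)).permCongr β := by
    rw [optionCongr_trans]
    ext x : 1
    obtain ⟨x, rfl⟩ := ((optionCongr e).trans (optionCongr (Finite.equivFin κ))).surjective x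
    simp only [permCongr_apply, symm_apply_apply]
    simp only [trans_apply, symm_apply_apply, hα]
  have h2 : h ∘ (e.trans (Finite.equivFin κ)).symm = g ∘ (Finite.equivFin κ).symm := by
    funext i
    simp [← hh]
  rw [J_eq_of_equiv (e.trans (Finite.equivFin κ)), J, h1, h2]

/-! ### Pairs of an involution -/

/-- The involutions of `ι`, i.e. its partitions into pairs and singletons. -/
abbrev Invol (ι : Type) : Type := {π : Perm ι // π * π = 1}

theorem Invol.apply_apply (π : Invol ι) (i : ι) : π.1 (π.1 i) = i := by
  have := congrArg (fun σ : Perm ι => σ i) π.2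
  simpa using this

/-- The set of pairs of an involution. -/
def pairs (π : Perm ι) : Finset (Sym2 ι) :=
  (Set.toFinite {z : Sym2 ι | ∃ i, π i ≠ i ∧ z = s(i, π i)}).toFinset

theorem mem_pairs {π : Perm ι} {z : Sym2 ι} : z ∈ pairs π ↔ ∃ i, π i ≠ i ∧ z = s(i, π i) := by
  simp [pairs]

/-- The inner product `⟨h_i, h_j⟩` as a function of the unordered pair `{i, j}`. -/
def pairInner (h : ι → H) : Sym2 ι → ℝ :=
  Sym2.lift ⟨fun i j => inner ℝ (h i) (h j), fun _ _ => real_inner_comm _ _⟩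

/-- The product of `⟨h_i, h_j⟩` over all pairs `{i, j}` of `π`. -/
def pairProd (π : Perm ι) (h : ι → H) : ℝ := ∏ z ∈ pairs π, pairInner h z

theorem pairs_iso (e : ι ≃ κ) {π : Perm ι} {ρ : Perm κ} (hπ : ∀ i, e (π i) = ρ (e i)) :
    pairs ρ = (pairs π).map e.toEmbedding.sym2Map := by
  ext z
  simp only [Finset.mem_map, mem_pairs, Function.Embedding.sym2Map_apply]
  constructor
  · rintro ⟨k, hk, rfl⟩
    obtain ⟨i, rfl⟩ := e.surjective k
    exact ⟨s(i, π i), ⟨i, fun h => hk (by rw [← hπ, h]), rfl⟩, by simp [hπ]⟩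
  · rintro ⟨_, ⟨i, hi, rfl⟩, rfl⟩
    exact ⟨e i, fun h => hi (e.injective (by rw [hπ, h])), by simp [hπ]⟩

theorem card_pairs_iso (e : ι ≃ κ) {π : Perm ι} {ρ : Perm κ} (hπ : ∀ i, e (π i) = ρ (e i)) :
    (pairs ρ).card = (pairs π).card := by
  rw [pairs_iso e hπ, Finset.card_map]

theorem pairProd_iso (e : ι ≃ κ) {π : Perm ι} {ρ : Perm κ} (hπ : ∀ i, e (π i) = ρ (e i))
    {h : ι → H} {g : κ → H} (hh : ∀ i, g (e i) = h i) : pairProd ρ g = pairProd π h := by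
  rw [pairProd, pairs_iso e hπ, Finset.prod_map]
  refine Finset.prod_congr rfl fun z _ => ?_
  induction z with
  | _ i j => simp [pairInner, hh]

theorem pairs_eq_image_openers {n : ℕ} (π : P12 n) :
    pairs π.1 = (openers π).image fun i => s(i, π.1 i) := by
  ext z
  simp only [mem_pairs, Finset.mem_image, openers, Finset.mem_filter, Finset.mem_univ, true_and]
  constructor
  · rintro ⟨i, hi, rfl⟩
    rcases lt_or_gt_of_ne hi with h | h
    · exact ⟨π.1 i, by rwa [apply_apply], by rw [apply_apply, Sym2.eq_swap]⟩
    · exact ⟨i, h, rfl⟩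
  · rintro ⟨i, hi, rfl⟩
    exact ⟨i, hi.ne', rfl⟩

theorem openers_injOn {n : ℕ} (π : P12 n) :
    Set.InjOn (fun i => s(i, π.1 i)) (openers π : Set (Fin n)) := by
  intro i hi j hj hij
  simp only [openers, Finset.coe_filter, Finset.mem_univ, true_and, Set.mem_ofPred_eq] at hi hj
  rcases Sym2.eq_iff.mp hij with ⟨h, _⟩ | ⟨h1, h2⟩
  · exact h
  · exfalso
    rw [h2, h1] at hi
    exact lt_asymm hi hj

theorem card_pairs_fin {n : ℕ} (π : P12 n) : (pairs π.1).card = numPairs π := by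
  rw [pairs_eq_image_openers, Finset.card_image_of_injOn (openers_injOn π), numPairs]

theorem pairProd_fin {n : ℕ} (π : P12 n) (h : Fin n → H) :
    pairProd π.1 h = ∏ i ∈ openers π, (inner ℝ (h i) (h (π.1 i)) : ℝ) := by
  rw [pairProd, pairs_eq_image_openers, Finset.prod_image (openers_injOn π)]
  rfl

/-! ### Contractions -/

/-- The inclusion of the singletons of `π`. -/
def fixEmb (π : Perm ι) : {i // π i = i} ↪ ι := Function.Embedding.subtype _

/-- The contracted permutation. -/
def contrP (π : Perm ι) (α : Perm (Option ι)) : Perm (Option {i // π i = i}) :=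
  restrict (optionCongr π * α) (fixEmb π).optionMap

/-- The exponent of `q` in a contraction. -/
def contrExp (π : Perm ι) (α : Perm (Option ι)) : ℤ :=
  (numCycles (contrP π α) : ℤ) - numCycles (optionCongr π * α) + (pairs π).card

/-- The coefficient of a contraction. -/
def contrCoeff (q : ℝ) (π : Perm ι) (α : Perm (Option ι)) (h : ι → H) : ℝ :=
  q ^ contrExp π α * pairProd π h

/-- The contraction `C_π` of the Hermite trace polynomial `I(α ⊗ h)`. -/
def C (q : ℝ) (π : Perm ι) (α : Perm (Option ι)) (h : ι → H) : TP H :=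
  (contrCoeff q π α h : ℂ) • J (contrP π α) (h ∘ fixEmb π)

/-- The bijection induced by `e` between the fixed points of conjugate permutations. -/
def fixEquiv (e : ι ≃ κ) {π : Perm ι} {ρ : Perm κ} (hπ : ∀ i, e (π i) = ρ (e i)) :
    {i // π i = i} ≃ {k // ρ k = k} :=
  e.subtypeEquiv fun i => by rw [← hπ, e.apply_eq_iff_eq]

theorem optionMap_range (f : Y ↪ ι) (i : ι) :
    some i ∈ Set.range f.optionMap ↔ i ∈ Set.range f := by
  constructor
  · rintro ⟨_ | y, hy⟩
    · simp [Function.Embedding.optionMap] at hy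
    · exact ⟨y, by simpa [Function.Embedding.optionMap] using hy⟩
  · rintro ⟨y, rfl⟩
    exact ⟨some y, rfl⟩

theorem none_mem_range (f : Y ↪ ι) : none ∈ Set.range f.optionMap := ⟨none, rfl⟩

theorem contrP_iso (e : ι ≃ κ) {π : Perm ι} {ρ : Perm κ} (hπ : ∀ i, e (π i) = ρ (e i))
    {α : Perm (Option ι)} {β : Perm (Option κ)}
    (hα : ∀ x, optionCongr e (α x) = β (optionCongr e x)) (x) :
    optionCongr (fixEquiv e hπ) (contrP π α x) = contrP ρ β (optionCongr (fixEquiv e hπ) x) := by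
  rw [contrP, contrP, restrict_map (optionCongr π * α) (optionCongr ρ * β) (fixEmb π).optionMap
    (fixEmb ρ).optionMap (optionCongr e) (optionCongr (fixEquiv e hπ))]
  · rw [trans_apply, trans_apply, symm_apply_apply]
  · intro x
    rw [Perm.mul_apply, Perm.mul_apply, ← hα]
    cases α x with
    | none => rfl
    | some i => simp [hπ]
  · rintro (_ | y) <;> rfl
  · rintro (_ | x) (_ | y) h
    · exact ⟨none, rfl⟩
    · exact ⟨none, rfl⟩
    · simp [Function.Embedding.optionMap] at h
    · refine ⟨some ⟨x, ?_⟩, rfl⟩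
      have h : e x = y.1 := by simpa [Function.Embedding.optionMap, fixEmb] using h
      have := y.2
      rw [← h, ← hπ] at this
      exact e.injective this

theorem contrExp_iso (e : ι ≃ κ) {π : Perm ι} {ρ : Perm κ} (hπ : ∀ i, e (π i) = ρ (e i))
    {α : Perm (Option ι)} {β : Perm (Option κ)}
    (hα : ∀ x, optionCongr e (α x) = β (optionCongr e x)) : contrExp ρ β = contrExp π α := by
  rw [contrExp, contrExp, card_pairs_iso e hπ, numCycles_map _ (contrP_iso e hπ hα),
    numCycles_map (α := optionCongr π * α) (α' := optionCongr ρ * β) (optionCongr e)]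
  intro x
  rw [Perm.mul_apply, Perm.mul_apply, ← hα]
  cases α x with
  | none => rfl
  | some i => simp [hπ]

theorem C_iso (q : ℝ) (e : ι ≃ κ) {π : Perm ι} {ρ : Perm κ} (hπ : ∀ i, e (π i) = ρ (e i))
    {α : Perm (Option ι)} {β : Perm (Option κ)}
    (hα : ∀ x, optionCongr e (α x) = β (optionCongr e x)) {h : ι → H} {g : κ → H}
    (hh : ∀ i, g (e i) = h i) : C q ρ β g = C q π α h := by
  rw [C, C, contrCoeff, contrCoeff, contrExp_iso e hπ hα, pairProd_iso e hπ hh,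
    J_iso (fixEquiv e hπ) (contrP_iso e hπ hα)]
  intro i
  exact hh i

/-- The singletons of `π` appear with several parametrizations: order-preserving, iterated subtypes,
sums of subtypes. All of them give the same restriction up to relabelling. -/
theorem exists_equiv_fix {π : Perm ι} (f : Y ↪ ι) (hf : Set.range f = {i | π i = i}) :
    ∃ e : Y ≃ {i // π i = i}, (∀ y, (e y).1 = f y) ∧ ∀ (γ : Perm (Option ι)) (x : Option Y),
      optionCongr e (restrict γ f.optionMap x) =
        restrict γ (fixEmb π).optionMap (optionCongr e x) := by
  have h1 : ∀ y, π (f y) = f y := fun y => by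
    have : f y ∈ {i | π i = i} := hf ▸ Set.mem_range_self y
    exact this
  let e : Y ≃ {i // π i = i} := Equiv.ofBijective (fun y => ⟨f y, h1 y⟩)
    ⟨fun a b hab => f.injective (Subtype.ext_iff.mp hab), fun ⟨i, hi⟩ => by
      have : i ∈ Set.range f := hf ▸ hi
      obtain ⟨y, rfl⟩ := this
      exact ⟨y, rfl⟩⟩
  refine ⟨e, fun y => rfl, fun γ x => ?_⟩
  rw [restrict_map γ γ f.optionMap (fixEmb π).optionMap id (optionCongr e) (fun _ => rfl)]
  · rw [trans_apply, trans_apply, symm_apply_apply]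
  · rintro (_ | y) <;> rfl
  · rintro x (_ | y) h
    · exact ⟨none, h.symm⟩
    · refine ⟨some (e.symm y), ?_⟩
      have : f (e.symm y) = (e (e.symm y)).1 := rfl
      rw [id] at h
      rw [h]
      simp [Function.Embedding.optionMap, fixEmb, this]

theorem J_restrict_eq [Finite Y] {π : Perm ι} (f : Y ↪ ι) (hf : Set.range f = {i | π i = i})
    (α : Perm (Option ι)) (h : ι → H) :
    J (restrict (optionCongr π * α) f.optionMap) (h ∘ f) = J (contrP π α) (h ∘ fixEmb π) := by
  obtain ⟨e, he, he'⟩ := exists_equiv_fix f hf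
  refine J_iso e (he' _) fun y => ?_
  simp [fixEmb, he]

theorem numCycles_restrict_eq [Finite Y] {π : Perm ι} (f : Y ↪ ι)
    (hf : Set.range f = {i | π i = i}) (α : Perm (Option ι)) :
    numCycles (restrict (optionCongr π * α) f.optionMap) = numCycles (contrP π α) := by
  obtain ⟨e, he, he'⟩ := exists_equiv_fix f hf
  exact numCycles_map _ (he' _)

theorem numCycles_pos (α : Perm (Option ι)) : 0 < numCycles α :=
  Nat.card_pos_iff.mpr ⟨⟨Quotient.mk _ none⟩, inferInstance⟩

theorem cyc_eq_numCycles {n : ℕ} (α : S0 n) : cyc α = numCycles α := rfl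

theorem cyc0_cast {n : ℕ} (α : S0 n) : (cyc0 α : ℤ) = numCycles α - 1 := by
  have := numCycles_pos α
  rw [cyc0, cyc_eq_numCycles]
  omega

theorem range_singEmb {n : ℕ} (π : P12 n) : Set.range (singEmb π) = {i | π.1 i = i} := by
  have := Finset.range_orderEmbOfFin (sing π) rfl
  refine Eq.trans this ?_
  ext i
  simp [sing]

/-- Passing from `cyc0` to all cycles subtracts one in both counts, and the difference is unchanged.
-/
theorem contrWeight_eq (q : ℝ) {n : ℕ} (π : P12 n) (α : S0 n) :
    contrWeight q π α = q ^ contrExp π.1 α := by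
  rw [contrWeight, contrExp, cyc0_cast, cyc0_cast, card_pairs_fin, contrPerm, fixZero,
    numCycles_restrict_eq _ (range_singEmb π)]
  congr 1
  ring

theorem I_contr (q : ℝ) {n : ℕ} (π : P12 n) (α : S0 n) (h : Fin n → H) :
    I H (contr H q π (Finsupp.single α 1 ⊗ₜ[ℝ] PiTensorProduct.tprod ℝ h)) = C q π.1 α h := by
  have h1 : contr H q π (Finsupp.single α 1 ⊗ₜ[ℝ] PiTensorProduct.tprod ℝ h) =
      ((contrCoeff q π.1 α h : ℝ) : ℂ) • elt (contrPerm π α)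
        (PiTensorProduct.tprod ℝ (h ∘ singEmb π)) := by
    rw [contrCoeff, ← contrWeight_eq, pairProd_fin, Complex.ofReal_mul, mul_smul, ← elt_smul]
    simp only [contr, contrGA, LinearMap.comp_apply, TensorProduct.AlgebraTensorModule.map_tmul,
      Finsupp.linearCombination_single, one_smul, contrTensor_tprod, elt]
    rw [← (DirectSum.lof ℂ ℕ (Comp H) _).map_smul, TensorProduct.smul_tmul', Finsupp.smul_single,
      smul_eq_mul, mul_one]
    rfl
  rw [h1, map_smul, ← J_fin, C]
  congr 1
  exact J_restrict_eq (singEmb π) (range_singEmb π) α h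

end Labels

/-! ### Induction principles and the section -/

section Induction

variable {H : Type*} [NormedAddCommGroup H] [InnerProductSpace ℝ H]

/-- The element `α ⊗ (h_1 ⊗ ⋯ ⊗ h_n)`. -/
abbrev pureElt {n : ℕ} (α : S0 n) (h : Fin n → H) : V H := elt α (PiTensorProduct.tprod ℝ h)

theorem lof_single {n : ℕ} (α : S0 n) (c : ℂ) (F : ⨂[ℝ]^n H) :
    DirectSum.lof ℂ ℕ (Comp H) n (Finsupp.single α c ⊗ₜ[ℝ] F) = c • elt α F := by
  rw [elt, ← (DirectSum.lof ℂ ℕ (Comp H) n).map_smul, TensorProduct.smul_tmul',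
    Finsupp.smul_single, smul_eq_mul, mul_one]

theorem V_induction {p : V H → Prop} (x : V H)
    (pure : ∀ (n : ℕ) (α : S0 n) (h : Fin n → H), p (pureElt α h))
    (add : ∀ x y, p x → p y → p (x + y)) (smul : ∀ (c : ℂ) x, p x → p (c • x)) : p x := by
  have zero : p 0 := by
    have := smul 0 _ (pure 0 1 Fin.elim0)
    rwa [zero_smul] at this
  have helt : ∀ (n : ℕ) (α : S0 n) (F : ⨂[ℝ]^n H), p (elt α F) := by
    intro n α F
    induction F using PiTensorProduct.induction_on with
    | smul_tprod r h => rw [elt_smul]; exact smul _ _ (pure _ _ _)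
    | add F G hF hG =>
      have : elt α (F + G) = elt α F + elt α G := by
        simp only [elt, TensorProduct.tmul_add, map_add]
      rw [this]
      exact add _ _ hF hG
  refine DirectSum.induction_on (motive := p) x zero (fun n y => ?_) add
  change p (DirectSum.lof ℂ ℕ (Comp H) n y)
  induction y using TensorProduct.induction_on with
  | zero => rwa [map_zero]
  | add a b ha hb => rw [map_add]; exact add _ _ ha hb
  | tmul a F =>
    induction a using Finsupp.induction_linear with
    | zero => rwa [TensorProduct.zero_tmul, map_zero]
    | add a b ha hb => rw [TensorProduct.add_tmul, map_add]; exact add _ _ ha hb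
    | single α c => rw [lof_single]; exact smul _ _ (helt n α F)

theorem TP_induction {p : TP H → Prop} (A : TP H)
    (pure : ∀ (n : ℕ) (α : S0 n) (h : Fin n → H), p (J α h))
    (add : ∀ A B, p A → p B → p (A + B)) (smul : ∀ (c : ℂ) A, p A → p (c • A)) : p A := by
  obtain ⟨x, rfl⟩ := (symmRel H).mkQ_surjective A
  change p (I H x)
  induction x using V_induction with
  | pure n α h => rw [← J_fin]; exact pure n α h
  | add x y hx hy => rw [map_add]; exact add _ _ hx hy
  | smul c x hx => rw [map_smul]; exact smul _ _ hx

theorem V_ext {W : Type*} [AddCommGroup W] [Module ℂ W] {f g : V H →ₗ[ℂ] W}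
    (h : ∀ (n : ℕ) (α : S0 n) (h : Fin n → H), f (pureElt α h) = g (pureElt α h)) : f = g := by
  refine LinearMap.ext fun x => ?_
  induction x using V_induction with
  | pure n α k => exact h n α k
  | add x y hx hy => rw [map_add, map_add, hx, hy]
  | smul c x hx => rw [map_smul, map_smul, hx]

theorem symmProj_pure {n : ℕ} (α : S0 n) (h : Fin n → H) :
    symmProj H (pureElt α h) = ((n.factorial : ℂ)⁻¹) • ∑ σ : Perm (Fin n),
      pureElt (fixZero σ * α * (fixZero σ)⁻¹) fun i => h (σ⁻¹ i) := by
  simp only [pureElt, symmProj_elt, U_tprod]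

theorem sec_I (x : V H) : sec H (I H x) = symmProj H x := Submodule.liftQ_apply _ _ _

theorem apply_symmProj_pure {W : Type*} [AddCommGroup W] [Module ℂ W] (L : V H →ₗ[ℂ] W) {n : ℕ}
    (α : S0 n) (h : Fin n → H)
    (hL : ∀ σ : Perm (Fin n), L (pureElt (fixZero σ * α * (fixZero σ)⁻¹) fun i => h (σ⁻¹ i)) =
      L (pureElt α h)) : L (symmProj H (pureElt α h)) = L (pureElt α h) := by
  rw [symmProj_pure, map_smul, map_sum, Finset.sum_congr rfl fun σ _ => hL σ, Finset.sum_const,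
    Finset.card_univ, Fintype.card_perm, Fintype.card_fin, ← Nat.cast_smul_eq_nsmul ℂ, smul_smul,
    inv_mul_cancel₀ (Nat.cast_ne_zero.mpr n.factorial_ne_zero), one_smul]

theorem conj_iso {n : ℕ} (σ : Perm (Fin n)) (α : S0 n) (x : Option (Fin n)) :
    optionCongr σ (α x) = (fixZero σ * α * (fixZero σ)⁻¹) (optionCongr σ x) := by
  change _ = optionCongr σ (α ((optionCongr σ).symm (optionCongr σ x)))
  rw [symm_apply_apply]

/-- The maps on `TP H` are defined on symmetrized representatives. This lets an invariant map be
computed on any representative instead. -/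
theorem apply_symmProj {W : Type*} [AddCommGroup W] [Module ℂ W] (L : V H →ₗ[ℂ] W)
    (hL : ∀ (n : ℕ) (σ : Perm (Fin n)) (α : S0 n) (h : Fin n → H),
      L (pureElt (fixZero σ * α * (fixZero σ)⁻¹) fun i => h (σ⁻¹ i)) = L (pureElt α h))
    (x : V H) : L (symmProj H x) = L x := by
  have : L ∘ₗ symmProj H = L := V_ext fun n α h => apply_symmProj_pure L α h fun σ => hL n σ α h
  exact LinearMap.congr_fun this x

theorem I_symmProj (x : V H) : I H (symmProj H x) = I H x := by
  refine apply_symmProj (I H) (fun n σ α h => ?_) x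
  rw [pureElt, pureElt, ← U_tprod, I_elt_conj]

end Induction

/-! ### The maps induced on `𝒯𝒫(H)` -/

section Induced

variable {H : Type*} [NormedAddCommGroup H] [InnerProductSpace ℝ H]
variable {ι κ : Type}

/-- The sum of `t ^ ℓ(π) C_π` over all partitions into pairs and singletons. -/
def sumC [Fintype ι] [DecidableEq ι] (q : ℝ) (t : ℂ) (α : Perm (Option ι)) (h : ι → H) : TP H :=
  ∑ π : Invol ι, t ^ (pairs π.1).card • C q π.1 α h

/-- Conjugation of involutions by a bijection. -/
def involCongr (e : ι ≃ κ) : Invol ι ≃ Invol κ :=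
  e.permCongr.subtypeEquiv fun π => by
    rw [← e.permCongr.apply_eq_iff_eq, ← Equiv.permCongr_mul]
    have : e.permCongr 1 = 1 := by ext; simp
    rw [this]

theorem involCongr_apply (e : ι ≃ κ) (π : Invol ι) (i : ι) :
    e (π.1 i) = (involCongr e π).1 (e i) := by
  simp [involCongr]

theorem sumC_iso [Fintype ι] [DecidableEq ι] [Fintype κ] [DecidableEq κ] (q : ℝ) (t : ℂ)
    (e : ι ≃ κ) {α : Perm (Option ι)} {β : Perm (Option κ)} {h : ι → H} {g : κ → H}
    (hα : ∀ x, optionCongr e (α x) = β (optionCongr e x)) (hh : ∀ i, g (e i) = h i) :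
    sumC q t α h = sumC q t β g := by
  refine Fintype.sum_equiv (involCongr e) _ _ fun π => ?_
  rw [card_pairs_iso e (involCongr_apply e π), C_iso q e (involCongr_apply e π) hα hh]

theorem I_expL_pure (q : ℝ) (t : ℂ) {n : ℕ} (α : S0 n) (h : Fin n → H) :
    I H (expL H q t (pureElt α h)) = sumC q t α h := by
  rw [pureElt, elt, expL, DirectSum.toModule_lof, LinearMap.sum_apply, map_sum, sumC]
  refine Finset.sum_congr rfl fun π _ => ?_
  rw [LinearMap.smul_apply, map_smul, I_contr, card_pairs_fin]

/-- The map `I(ξ) ↦ I(e^{t𝓛} ξ)`. -/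
def E (q : ℝ) (t : ℂ) : TP H →ₗ[ℂ] TP H := (I H ∘ₗ expL H q t) ∘ₗ sec H

/-- Conjugation by `σ` only permutes the involutions in the sum, so `e^{t𝓛}` descends to classes. -/
theorem E_I (q : ℝ) (t : ℂ) (x : V H) : E q t (I H x) = I H (expL H q t x) := by
  rw [E, LinearMap.comp_apply, sec_I]
  refine apply_symmProj (I H ∘ₗ expL H q t) (fun n σ α h => ?_) x
  rw [LinearMap.comp_apply, LinearMap.comp_apply, I_expL_pure, I_expL_pure]
  exact (sumC_iso q t σ (conj_iso σ α) fun i => by simp).symm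

theorem exists_J_eq [Finite ι] (α : Perm (Option ι)) (h : ι → H) :
    ∃ (n : ℕ) (e : ι ≃ Fin n) (β : S0 n) (g : Fin n → H),
      (∀ x, optionCongr e (α x) = β (optionCongr e x)) ∧ (∀ i, g (e i) = h i) ∧ J α h = J β g := by
  refine ⟨_, Finite.equivFin ι, (optionCongr (Finite.equivFin ι)).permCongr α,
    h ∘ (Finite.equivFin ι).symm, fun x => ?_, fun i => by simp, J_iso (Finite.equivFin ι)
      (fun x => ?_) fun i => by simp⟩ <;>
  rw [permCongr_apply, symm_apply_apply]

theorem E_J [Fintype ι] [DecidableEq ι] (q : ℝ) (t : ℂ) (α : Perm (Option ι)) (h : ι → H) :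
    E q t (J α h) = sumC q t α h := by
  obtain ⟨n, e, β, g, hα, hh, hJ⟩ := exists_J_eq α h
  rw [hJ, J_fin, E_I, I_expL_pure, sumC_iso q t e hα hh]

/-! The cup product -/

/-- `α ∪ β` for arbitrary index sets. -/
def cupPerm (α : Perm (Option ι)) (β : Perm (Option κ)) : Perm (Option (ι ⊕ κ)) :=
  β.viaEmbedding Function.Embedding.inr.optionMap * α.viaEmbedding Function.Embedding.inl.optionMap

theorem viaEmbedding_inl (α : Perm (Option ι)) (x : Option ι) :
    α.viaEmbedding (Function.Embedding.inl : ι ↪ ι ⊕ κ).optionMap (x.map Sum.inl) =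
      (α x).map Sum.inl :=
  Perm.viaEmbedding_apply α _ x

theorem viaEmbedding_inr (β : Perm (Option κ)) (x : Option κ) :
    β.viaEmbedding (Function.Embedding.inr : κ ↪ ι ⊕ κ).optionMap (x.map Sum.inr) =
      (β x).map Sum.inr :=
  Perm.viaEmbedding_apply β _ x

theorem viaEmbedding_inl_inr (α : Perm (Option ι)) (k : κ) :
    α.viaEmbedding (Function.Embedding.inl : ι ↪ ι ⊕ κ).optionMap (some (Sum.inr k)) =
      some (Sum.inr k) := by
  refine Perm.viaEmbedding_apply_of_notMem α _ _ ?_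
  rintro ⟨_ | x, hx⟩ <;> simp [Function.Embedding.optionMap] at hx

theorem viaEmbedding_inr_inl (β : Perm (Option κ)) (i : ι) :
    β.viaEmbedding (Function.Embedding.inr : κ ↪ ι ⊕ κ).optionMap (some (Sum.inl i)) =
      some (Sum.inl i) := by
  refine Perm.viaEmbedding_apply_of_notMem β _ _ ?_
  rintro ⟨_ | x, hx⟩ <;> simp [Function.Embedding.optionMap] at hx

theorem cupPerm_inr (α : Perm (Option ι)) (β : Perm (Option κ)) (k : κ) :
    cupPerm α β (some (Sum.inr k)) = (β (some k)).map Sum.inr := by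
  rw [cupPerm, Perm.mul_apply, viaEmbedding_inl_inr]
  exact viaEmbedding_inr β (some k)

theorem cupPerm_of_apply_eq_some (α : Perm (Option ι)) (β : Perm (Option κ)) {x : Option ι} {i : ι}
    (h : α x = some i) : cupPerm α β (x.map Sum.inl) = some (Sum.inl i) := by
  rw [cupPerm, Perm.mul_apply, viaEmbedding_inl, h]
  exact viaEmbedding_inr_inl β i

theorem cupPerm_of_apply_eq_none (α : Perm (Option ι)) (β : Perm (Option κ)) {x : Option ι}
    (h : α x = none) : cupPerm α β (x.map Sum.inl) = (β none).map Sum.inr := by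
  rw [cupPerm, Perm.mul_apply, viaEmbedding_inl, h]
  exact viaEmbedding_inr β none

theorem eq_viaEmbedding {X Y : Type} (α : Perm X) (f : X ↪ Y) (γ : Perm Y)
    (h : ∀ x, γ (f x) = f (α x)) (h' : ∀ y, y ∉ Set.range f → γ y = y) :
    γ = α.viaEmbedding f := by
  ext y
  by_cases hy : y ∈ Set.range f
  · obtain ⟨x, rfl⟩ := hy
    rw [h, Perm.viaEmbedding_apply]
  · rw [h' y hy, Perm.viaEmbedding_apply_of_notMem α f y hy]

theorem viaEmbedding_comp {X Y Z : Type} (α : Perm X) (f : X ↪ Y) (e : Y ≃ Z) :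
    e.permCongr (α.viaEmbedding f) = α.viaEmbedding (f.trans e.toEmbedding) := by
  refine eq_viaEmbedding _ _ _ (fun x => ?_) fun y hy => ?_
  · simp [Perm.viaEmbedding_apply]
  · rw [permCongr_apply, Perm.viaEmbedding_apply_of_notMem, apply_symm_apply]
    rintro ⟨x, hx⟩
    exact hy ⟨x, by simp [hx]⟩

theorem cup_eq_cupPerm {n k : ℕ} (α : S0 n) (β : S0 k) :
    cup α β = (optionCongr finSumFinEquiv).permCongr (cupPerm α β) := by
  rw [cupPerm, permCongr_mul, viaEmbedding_comp, viaEmbedding_comp, cup]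
  congr 2
  · ext1 x; cases x <;> rfl
  · ext1 x; cases x <;> rfl

/-- The bilinear map induced on `𝒯𝒫(H)` by `∪`. -/
def cupT : TP H →ₗ[ℂ] TP H →ₗ[ℂ] TP H := ((cupV H).compl₁₂ (sec H) (sec H)).compr₂ (I H)

theorem bilin_elt {W : Type*} [AddCommGroup W] [Module ℂ W]
    (f : (n k : ℕ) → Comp H n →ₗ[ℂ] Comp H k →ₗ[ℂ] W) {n k : ℕ} (α : S0 n) (β : S0 k)
    (F : ⨂[ℝ]^n H) (G : ⨂[ℝ]^k H) :
    bilin f (elt α F) (elt β G) =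
      f n k (Finsupp.single α 1 ⊗ₜ[ℝ] F) (Finsupp.single β 1 ⊗ₜ[ℝ] G) := by
  simp [bilin, elt]

theorem cupComp_pure {n k : ℕ} (α : S0 n) (β : S0 k) (h : Fin n → H) (g : Fin k → H) :
    cupComp H n k (Finsupp.single α 1 ⊗ₜ[ℝ] PiTensorProduct.tprod ℝ h)
      (Finsupp.single β 1 ⊗ₜ[ℝ] PiTensorProduct.tprod ℝ g) =
      Finsupp.single (cup α β) 1 ⊗ₜ[ℝ] PiTensorProduct.tprod ℝ (Fin.append h g) := by
  have : tensorMul H n k (PiTensorProduct.tprod ℝ h) (PiTensorProduct.tprod ℝ g) =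
      PiTensorProduct.tprod ℝ (Fin.append h g) := TensorPower.tprod_mul_tprod ℝ h g
  simp [cupComp, cupGA, this]

theorem append_iso {n k : ℕ} (h : Fin n → H) (g : Fin k → H) (i : Fin n ⊕ Fin k) :
    Fin.append h g (finSumFinEquiv i) = Sum.elim h g i := by
  cases i <;> simp

theorem cup_iso {n k : ℕ} (α : S0 n) (β : S0 k) (x : Option (Fin n ⊕ Fin k)) :
    optionCongr finSumFinEquiv (cupPerm α β x) = cup α β (optionCongr finSumFinEquiv x) := by
  rw [cup_eq_cupPerm, permCongr_apply, symm_apply_apply]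

theorem I_cupV_pure {n k : ℕ} (α : S0 n) (β : S0 k) (h : Fin n → H) (g : Fin k → H) :
    I H (cupV H (pureElt α h) (pureElt β g)) = J (cupPerm α β) (Sum.elim h g) := by
  rw [cupV, bilin_elt, LinearMap.compr₂_apply, cupComp_pure, J_iso finSumFinEquiv (cup_iso α β)
    (append_iso h g), J_fin]
  rfl

theorem cupPerm_map {ι' κ' : Type} (e : ι ≃ ι') (f : κ ≃ κ') {α : Perm (Option ι)}
    {β : Perm (Option κ)} {α' : Perm (Option ι')} {β' : Perm (Option κ')}
    (hα : ∀ x, optionCongr e (α x) = α' (optionCongr e x))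
    (hβ : ∀ x, optionCongr f (β x) = β' (optionCongr f x)) (x : Option (ι ⊕ κ)) :
    optionCongr (e.sumCongr f) (cupPerm α β x) =
      cupPerm α' β' (optionCongr (e.sumCongr f) x) := by
  have hL : ∀ x : Option ι, optionCongr (e.sumCongr f) (x.map Sum.inl) =
      (optionCongr e x).map Sum.inl := by rintro (_ | _) <;> rfl
  have hR : ∀ x : Option κ, optionCongr (e.sumCongr f) (x.map Sum.inr) =
      (optionCongr f x).map Sum.inr := by rintro (_ | _) <;> rfl
  have key : ∀ x : Option ι, optionCongr (e.sumCongr f) (cupPerm α β (x.map Sum.inl)) =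
      cupPerm α' β' (optionCongr (e.sumCongr f) (x.map Sum.inl)) := by
    intro x
    rw [hL]
    rcases h : α x with _ | i
    · rw [cupPerm_of_apply_eq_none α β h, hR, hβ, cupPerm_of_apply_eq_none α' β']
      · rfl
      · rw [← hα, h]; rfl
    · rw [cupPerm_of_apply_eq_some α β h, cupPerm_of_apply_eq_some α' β' (i := e i)]
      · rfl
      · rw [← hα, h]; rfl
  rcases x with _ | i | k
  · exact key none
  · exact key (some i)
  · rw [cupPerm_inr, hR, hβ]
    exact (cupPerm_inr α' β' (f k)).symm

theorem cupT_I (x y : V H) : cupT (I H x) (I H y) = I H (cupV H x y) := by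
  have h1 : ∀ x y, I H (cupV H (symmProj H x) y) = I H (cupV H x y) := by
    intro x y
    refine apply_symmProj (((cupV H).compr₂ (I H)).flip y) (fun n σ α h => ?_) x
    rw [LinearMap.flip_apply, LinearMap.flip_apply]
    congr 1
    refine V_ext fun k β g => ?_
    rw [LinearMap.compr₂_apply, LinearMap.compr₂_apply, I_cupV_pure, I_cupV_pure]
    refine (J_iso (Equiv.sumCongr σ (Equiv.refl _)) (cupPerm_map σ (Equiv.refl _) (conj_iso σ α)
      fun x => ?_) ?_).symm
    · simp
    · rintro (i | i) <;> simp
  have h2 : ∀ x y, I H (cupV H x (symmProj H y)) = I H (cupV H x y) := by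
    intro x y
    refine apply_symmProj ((cupV H).compr₂ (I H) x) (fun n σ α h => ?_) y
    refine LinearMap.congr_fun (f := ((cupV H).compr₂ (I H)).flip _)
      (g := ((cupV H).compr₂ (I H)).flip _) (V_ext fun k β g => ?_) x
    rw [LinearMap.flip_apply, LinearMap.flip_apply, LinearMap.compr₂_apply,
      LinearMap.compr₂_apply, I_cupV_pure, I_cupV_pure]
    refine (J_iso (Equiv.sumCongr (Equiv.refl _) σ) (cupPerm_map (Equiv.refl _) σ (fun x => ?_)
      (conj_iso σ α)) ?_).symm
    · simp
    · rintro (i | i) <;> simp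
  rw [cupT, LinearMap.compr₂_apply, LinearMap.compl₁₂_apply, sec_I, sec_I, h1, h2]

theorem cupT_J [Finite ι] [Finite κ] (α : Perm (Option ι)) (β : Perm (Option κ)) (h : ι → H)
    (g : κ → H) : cupT (J α h) (J β g) = J (cupPerm α β) (Sum.elim h g) := by
  obtain ⟨n, e, α', h', hα, hh, hJ⟩ := exists_J_eq α h
  obtain ⟨k, f, β', g', hβ, hg, hJ'⟩ := exists_J_eq β g
  rw [hJ, hJ', J_fin, J_fin, cupT_I, I_cupV_pure]
  refine (J_iso (e.sumCongr f) (cupPerm_map e f hα hβ) ?_).symm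
  rintro (i | i) <;> simp [hh, hg]

end Induced

/-! ### The product formula, the involution, the functional and the inner product on `𝒯𝒫(H)`. -/

section Bilinear

variable {H : Type*} [NormedAddCommGroup H] [InnerProductSpace ℝ H]
variable {ι κ : Type}

theorem apply₂_symmProj {W : Type*} [AddCommGroup W] [Module ℂ W] (B : V H →ₗ[ℂ] V H →ₗ[ℂ] W)
    (h₁ : ∀ (n k : ℕ) (σ : Perm (Fin n)) (α : S0 n) (h : Fin n → H) (β : S0 k) (g : Fin k → H),
      B (pureElt (fixZero σ * α * (fixZero σ)⁻¹) fun i => h (σ⁻¹ i)) (pureElt β g) =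
        B (pureElt α h) (pureElt β g))
    (h₂ : ∀ (n k : ℕ) (σ : Perm (Fin k)) (α : S0 n) (h : Fin n → H) (β : S0 k) (g : Fin k → H),
      B (pureElt α h) (pureElt (fixZero σ * β * (fixZero σ)⁻¹) fun i => g (σ⁻¹ i)) =
        B (pureElt α h) (pureElt β g)) (x y : V H) :
    B (symmProj H x) (symmProj H y) = B x y := by
  rw [apply_symmProj B fun n σ α h => V_ext fun k β g => h₁ n k σ α h β g]
  refine apply_symmProj (B x) (fun k σ β g => ?_) y
  exact LinearMap.congr_fun (f := B.flip _) (g := B.flip _) (V_ext fun n α h => h₂ n k σ α h β g) x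

/-- Every pair of `π` has one element in `ι` and one in `κ`. -/
def Inhom (π : Perm (ι ⊕ κ)) : Prop := ∀ x, π x ≠ x → (π x).isLeft ≠ x.isLeft

theorem isInhom_iff {n k : ℕ} (π : Invol (Fin n ⊕ Fin k)) :
    IsInhom (involCongr finSumFinEquiv π : P12 (n + k)) ↔ Inhom π.1 := by
  have hlt : ∀ x : Fin n ⊕ Fin k, (finSumFinEquiv x : ℕ) < n ↔ x.isLeft = true := by
    rintro (i | i) <;> simp
  have happ := involCongr_apply finSumFinEquiv π
  constructor
  · intro h x hx
    rcases lt_or_gt_of_ne (fun e => hx (finSumFinEquiv.injective e)) with h' | h'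
    · have := h (finSumFinEquiv (π.1 x)) (by rwa [← happ, π.apply_apply])
      rw [← happ, π.apply_apply, hlt, ← not_lt, hlt] at this
      simp_all
    · have := h (finSumFinEquiv x) (by rwa [← happ])
      rw [← happ, hlt, ← not_lt, hlt] at this
      simp_all
  · intro h i hi
    obtain ⟨x, rfl⟩ := finSumFinEquiv.surjective i
    rw [← happ] at hi ⊢
    rw [hlt, ← not_lt, hlt]
    have h1 := h x fun e => by rw [e] at hi; exact lt_irrefl _ hi
    have h2 : (π.1 x).isLeft = true → x.isLeft = true := by
      rw [← hlt, ← hlt]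
      have : (finSumFinEquiv x : ℕ) < (finSumFinEquiv (π.1 x) : ℕ) := hi
      omega
    rcases hb : (π.1 x).isLeft with _ | _ <;> rcases hb' : x.isLeft with _ | _ <;> simp_all

open Classical in
/-- The sum of the inhomogeneous contractions of `(α ∪ β) ⊗ (h ⊗ g)`. -/
def sumInhom [Fintype ι] [DecidableEq ι] [Fintype κ] [DecidableEq κ] (q : ℝ)
    (α : Perm (Option ι)) (β : Perm (Option κ)) (h : ι → H) (g : κ → H) : TP H :=
  ∑ π : Invol (ι ⊕ κ), if Inhom π.1 then C q π.1 (cupPerm α β) (Sum.elim h g) else 0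

theorem sumInhom_iso {ι' κ' : Type} [Fintype ι] [DecidableEq ι] [Fintype κ] [DecidableEq κ]
    [Fintype ι'] [DecidableEq ι'] [Fintype κ'] [DecidableEq κ'] (q : ℝ) (e : ι ≃ ι') (f : κ ≃ κ')
    {α : Perm (Option ι)} {β : Perm (Option κ)} {α' : Perm (Option ι')} {β' : Perm (Option κ')}
    (hα : ∀ x, optionCongr e (α x) = α' (optionCongr e x))
    (hβ : ∀ x, optionCongr f (β x) = β' (optionCongr f x))
    {h : ι → H} {g : κ → H} {h' : ι' → H} {g' : κ' → H}
    (hh : ∀ i, h' (e i) = h i) (hg : ∀ i, g' (f i) = g i) :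
    sumInhom q α β h g = sumInhom q α' β' h' g' := by
  have hL : ∀ x, (e.sumCongr f x).isLeft = x.isLeft := by rintro (x | x) <;> rfl
  refine Fintype.sum_equiv (involCongr (e.sumCongr f)) _ _ fun π => ?_
  have happ := involCongr_apply (e.sumCongr f) π
  have h1 : Inhom π.1 ↔ Inhom (involCongr (e.sumCongr f) π).1 := by
    constructor
    · intro h x hx
      obtain ⟨x, rfl⟩ := (e.sumCongr f).surjective x
      rw [← happ, hL, hL]
      exact h x fun e' => hx (by rw [← happ, e'])
    · intro h x hx
      have := h (e.sumCongr f x) (by rwa [← happ, Ne, Equiv.apply_eq_iff_eq])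
      rwa [← happ, hL, hL] at this
  have h2 : C q (involCongr (e.sumCongr f) π).1 (cupPerm α' β') (Sum.elim h' g') =
      C q π.1 (cupPerm α β) (Sum.elim h g) := by
    refine C_iso q (e.sumCongr f) happ (cupPerm_map e f hα hβ) ?_
    rintro (i | i) <;> simp [hh, hg]
  rw [h2]
  by_cases hi : Inhom π.1
  · rw [if_pos hi, if_pos (h1.mp hi)]
  · rw [if_neg hi, if_neg fun h => hi (h1.mpr h)]

theorem I_hermiteProd_pure (q : ℝ) {n k : ℕ} (α : S0 n) (β : S0 k) (h : Fin n → H)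
    (g : Fin k → H) :
    I H (hermiteProd H q (pureElt α h) (pureElt β g)) = sumInhom q α β h g := by
  rw [hermiteProd, bilin_elt, LinearMap.compr₂_apply, cupComp_pure, LinearMap.sum_apply, map_sum]
  refine (Fintype.sum_equiv (involCongr finSumFinEquiv) _ _ fun π => ?_).symm
  have h1 := isInhom_iff π
  by_cases hi : Inhom π.1
  · rw [if_pos hi, if_pos (h1.mpr hi), I_contr]
    exact (C_iso q finSumFinEquiv (involCongr_apply finSumFinEquiv π) (cup_iso α β)
      (append_iso h g)).symm
  · rw [if_neg hi, if_neg (fun h' => hi (h1.mp h')), LinearMap.zero_apply, map_zero]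

/-- The product formula for Hermite trace polynomials, as a bilinear map on `𝒯𝒫(H)`. -/
def hprod (q : ℝ) : TP H →ₗ[ℂ] TP H →ₗ[ℂ] TP H :=
  ((hermiteProd H q).compl₁₂ (sec H) (sec H)).compr₂ (I H)

theorem hprod_J [Fintype ι] [DecidableEq ι] [Fintype κ] [DecidableEq κ] (q : ℝ)
    (α : Perm (Option ι)) (β : Perm (Option κ)) (h : ι → H) (g : κ → H) :
    hprod q (J α h) (J β g) = sumInhom q α β h g := by
  obtain ⟨n, e, α', h', hα, hh, hJ⟩ := exists_J_eq α h
  obtain ⟨k, f, β', g', hβ, hg, hJ'⟩ := exists_J_eq β g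
  rw [hJ, hJ', J_fin, J_fin, hprod, LinearMap.compr₂_apply, LinearMap.compl₁₂_apply, sec_I, sec_I]
  rw [sumInhom_iso q e f hα hβ hh hg, ← I_hermiteProd_pure]
  refine apply₂_symmProj ((hermiteProd H q).compr₂ (I H)) ?_ ?_ _ _
  · intro n k σ α h β g
    rw [LinearMap.compr₂_apply, LinearMap.compr₂_apply, I_hermiteProd_pure, I_hermiteProd_pure]
    exact (sumInhom_iso q σ (Equiv.refl _) (conj_iso σ α) (fun x => by simp) (fun i => by simp)
      fun i => rfl).symm
  · intro n k σ α h β g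
    rw [LinearMap.compr₂_apply, LinearMap.compr₂_apply, I_hermiteProd_pure, I_hermiteProd_pure]
    exact (sumInhom_iso q (Equiv.refl _) σ (fun x => by simp) (conj_iso σ β) (fun i => rfl)
      fun i => by simp).symm

theorem mul_zero_eq : mul H 0 = hprod 0 := by
  rw [mul, mulV, if_pos rfl]
  rfl

/-- The algebraic laws of `∪` are transferred to the product through this form once `E q 1` and `E q
(-1)` are known to be inverse. -/
theorem mul_apply_of_ne {q : ℝ} (hq : q ≠ 0) (A B : TP H) :
    mul H q A B = E q 1 (cupT (E q (-1) A) (E q (-1) B)) := by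
  rw [mul, mulV, if_neg hq, LinearMap.compr₂_apply, LinearMap.compl₁₂_apply,
    LinearMap.compr₂_apply, LinearMap.compl₁₂_apply, ← E_I, ← cupT_I]
  rfl

/-! ### The involution -/

theorem starV_smul_elt {n : ℕ} (c : ℂ) (α : S0 n) (F : ⨂[ℝ]^n H) :
    starV H (c • elt α F) = starRingEnd ℂ c • elt α⁻¹ F := by
  rw [← lof_single, ← lof_single, starV]
  refine (DirectSum.toModule_lof ℝ n _).trans ?_
  rw [LinearMap.comp_apply, TensorProduct.map_tmul, starGA]
  simp
  rfl

theorem starV_elt {n : ℕ} (α : S0 n) (F : ⨂[ℝ]^n H) : starV H (elt α F) = elt α⁻¹ F := by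
  simpa using starV_smul_elt 1 α F

theorem starV_smul (c : ℂ) (x : V H) : starV H (c • x) = starRingEnd ℂ c • starV H x := by
  induction x using V_induction generalizing c with
  | pure n α h => rw [starV_smul_elt, starV_elt]
  | add x y hx hy => rw [smul_add, map_add, map_add, hx, hy, smul_add]
  | smul d x hx => rw [smul_smul, hx, hx, smul_smul, map_mul]

/-- The anti-linear involution on `V`, as a semilinear map. -/
def starVₛ : V H →ₗ⋆[ℂ] V H where
  toFun := starV H
  map_add' := map_add _
  map_smul' := starV_smul

/-- The anti-linear involution `I(α ⊗ F) ↦ I(α⁻¹ ⊗ F)`. -/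
def starT : TP H →ₗ⋆[ℂ] TP H := ((I H).comp starVₛ).comp (sec H)

theorem starV_symmProj (x : V H) : starV H (symmProj H x) = symmProj H (starV H x) := by
  induction x using V_induction with
  | pure n α h =>
    rw [symmProj_pure, starV_smul, map_sum, starV_elt, symmProj_pure]
    simp only [starV_elt, map_inv₀, map_natCast]
    simp [mul_assoc]
  | add x y hx hy => rw [map_add, map_add, map_add, map_add, hx, hy]
  | smul d x hx => rw [map_smul, starV_smul, starV_smul, map_smul, hx]

theorem starT_I (x : V H) : starT (I H x) = I H (starV H x) := by
  change I H (starV H (sec H (I H x))) = _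
  rw [sec_I, starV_symmProj, I_symmProj]

theorem starT_J [Finite ι] (α : Perm (Option ι)) (h : ι → H) : starT (J α h) = J α⁻¹ h := by
  rw [J, starT_I, starV_elt, J]
  rfl

theorem starT_starT (A : TP H) : starT (starT A) = A := by
  induction A using TP_induction with
  | pure n α h => rw [starT_J, starT_J, inv_inv]
  | add x y hx hy => rw [map_add, map_add, hx, hy]
  | smul c x hx => rw [map_smulₛₗ, map_smulₛₗ, hx, Complex.conj_conj]

theorem adj_zero (A : TP H) : adj H 0 A = starT A := by
  rw [adj, adjV, if_pos rfl]
  rfl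

theorem adj_of_ne {q : ℝ} (hq : q ≠ 0) (A : TP H) :
    adj H q A = E q 1 (starT (E q (-1) A)) := by
  rw [adj, adjV, if_neg hq, ← E_I, ← starT_I]
  rfl

/-! ### The functional -/

theorem phi_I (x : V H) : phi H (I H x) = phiV H x := by
  rw [phi, LinearMap.comp_apply, sec_I]
  refine apply_symmProj (phiV H) (fun n σ α h => ?_) x
  cases n with
  -- In degree `0` the action is trivial; in positive degree both sides vanish.
  | zero =>
    have : (fixZero σ * α * (fixZero σ)⁻¹) = α := Subsingleton.elim _ _
    rw [this, Subsingleton.elim (fun i => h (σ⁻¹ i)) h]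
  | succ n => simp [phiV, pureElt, elt, scalarPart]

theorem phi_J [Finite ι] (α : Perm (Option ι)) (h : ι → H) :
    phi H (J α h) = if Nat.card ι = 0 then 1 else 0 := by
  rw [J, phi_I]
  generalize Finite.equivFin ι = e
  generalize Nat.card ι = n at e
  cases n with
  | zero => simp [phiV, elt, scalarPart]
  | succ n => simp [phiV, elt, scalarPart]

/-! ### The inner product -/

/-- The value of the `q`-inner product on pure tensors: the sum over all bijections
between the index sets. -/
def pairing [Fintype ι] [DecidableEq ι] [Fintype κ] [DecidableEq κ] (q : ℝ)
    (α : Perm (Option ι)) (h : ι → H) (β : Perm (Option κ)) (g : κ → H) : ℝ :=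
  ∑ σ : κ ≃ ι, q ^ (Nat.card ι + 1 - numCycles (α * (optionCongr σ).permCongr β)) *
    ∏ i, inner ℝ (h i) (g (σ.symm i))

theorem pairing_iso {ι' κ' : Type} [Fintype ι] [DecidableEq ι] [Fintype κ] [DecidableEq κ]
    [Fintype ι'] [DecidableEq ι'] [Fintype κ'] [DecidableEq κ'] (q : ℝ) (e : ι ≃ ι') (f : κ ≃ κ')
    {α : Perm (Option ι)} {β : Perm (Option κ)} {α' : Perm (Option ι')} {β' : Perm (Option κ')}
    (hα : ∀ x, optionCongr e (α x) = α' (optionCongr e x))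
    (hβ : ∀ x, optionCongr f (β x) = β' (optionCongr f x))
    {h : ι → H} {g : κ → H} {h' : ι' → H} {g' : κ' → H}
    (hh : ∀ i, h' (e i) = h i) (hg : ∀ i, g' (f i) = g i) :
    pairing q α h β g = pairing q α' h' β' g' := by
  refine Fintype.sum_equiv (f.equivCongr e) _ _ fun σ => ?_
  rw [Nat.card_congr e]
  congr 1
  · congr 2
    refine numCycles_map (optionCongr e) fun x => ?_
    obtain ⟨y, rfl⟩ := (optionCongr σ).surjective x
    have h1 : ∀ x, optionCongr (f.equivCongr e σ) (optionCongr f x) =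
        optionCongr e (optionCongr σ x) := by rintro (_ | x) <;> simp
    rw [Perm.mul_apply, Perm.mul_apply, hα, ← h1, permCongr_apply, permCongr_apply,
      symm_apply_apply, symm_apply_apply, ← hβ, h1]
  · refine Fintype.prod_equiv e _ _ fun i => ?_
    have h1 : (f.equivCongr e σ).symm (e i) = f (σ.symm i) := by
      change f (σ.symm (e.symm (e i))) = _
      rw [symm_apply_apply]
    rw [hh, h1, hg]

/-- Replace `σ` by its inverse; the two permutations have the same number of cycles because it is
unchanged under conjugation and cyclic rotation of products. This is the source of the trace
property. -/
theorem pairing_comm [Fintype ι] [DecidableEq ι] [Fintype κ] [DecidableEq κ] (q : ℝ)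
    (α : Perm (Option ι)) (h : ι → H) (β : Perm (Option κ)) (g : κ → H) :
    pairing q α h β g = pairing q β g α h := by
  refine Fintype.sum_equiv (Equiv.symmEquiv κ ι) _ _ fun σ => ?_
  change _ = q ^ (Nat.card κ + 1 - numCycles (β * (optionCongr σ.symm).permCongr α)) *
    ∏ i, inner ℝ (g i) (h (σ i))
  rw [Nat.card_congr σ]
  congr 1
  · congr 2
    rw [numCycles_mul_comm]
    refine numCycles_map (optionCongr σ.symm) fun x => ?_
    change (optionCongr σ).symm (optionCongr σ (β ((optionCongr σ).symm (α x)))) =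
      β ((optionCongr σ).symm (α (optionCongr σ ((optionCongr σ).symm x))))
    rw [symm_apply_apply, apply_symm_apply]
  · refine Fintype.prod_equiv σ.symm _ _ fun i => ?_
    simp [real_inner_comm]

theorem pairing_inv [Fintype ι] [DecidableEq ι] [Fintype κ] [DecidableEq κ] (q : ℝ)
    (α : Perm (Option ι)) (h : ι → H) (β : Perm (Option κ)) (g : κ → H) :
    pairing q α⁻¹ h β⁻¹ g = pairing q α h β g := by
  refine Finset.sum_congr rfl fun σ _ => ?_
  congr 3
  rw [← numCycles_inv, mul_inv_rev, inv_inv, numCycles_mul_comm]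
  rfl

/-- The bilinear form `⟨x, y^*⟩_q` on `V`. -/
def formV (q : ℝ) : V H →ₗ[ℂ] V H →ₗ[ℂ] ℂ :=
  DirectSum.toModule ℂ ℕ (V H →ₗ[ℂ] ℂ) fun n =>
    (formComp H q n).compl₂ (DirectSum.component ℂ ℕ (Comp H) n)

theorem innerV_eq_formV (q : ℝ) (x y : V H) : innerV H q x y = formV q x (starV H y) := rfl

theorem formV_elt_of_ne (q : ℝ) {n k : ℕ} (hnk : n ≠ k) (α : S0 n) (β : S0 k) (F : ⨂[ℝ]^n H)
    (G : ⨂[ℝ]^k H) : formV q (elt α F) (elt β G) = 0 := by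
  rw [formV, elt, DirectSum.toModule_lof, LinearMap.compl₂_apply, elt, DirectSum.component.of,
    dif_neg hnk.symm, map_zero]

theorem formV_elt (q : ℝ) {n : ℕ} (α β : S0 n) (F G : ⨂[ℝ]^n H) :
    formV q (elt α F) (elt β G) = ∑ σ : Perm (Fin n),
      ((chi q (α * fixZero σ * β * (fixZero σ)⁻¹) * tensorInner H n F (U H σ G) : ℝ) : ℂ) := by
  rw [formV, elt, DirectSum.toModule_lof, LinearMap.compl₂_apply, elt, DirectSum.component.lof_self]
  simp [formComp, chiForm]
  simp [mul_comm]

theorem formV_pure (q : ℝ) {n k : ℕ} (α : S0 n) (β : S0 k) (h : Fin n → H) (g : Fin k → H) :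
    formV q (pureElt α h) (pureElt β g) = (pairing q α h β g : ℝ) := by
  by_cases hnk : n = k
  · subst hnk
    rw [formV_elt, pairing, Complex.ofReal_sum]
    refine Finset.sum_congr rfl fun σ _ => ?_
    rw [U_tprod, tensorInner_tprod, chi, len, cyc_eq_numCycles, Nat.card_fin, mul_assoc, mul_assoc]
    rfl
  · rw [formV_elt_of_ne q hnk]
    -- Orthogonality of different degrees is built into `pairing`: there are no bijections to sum
    -- over.
    have : IsEmpty (Fin k ≃ Fin n) := ⟨fun e => hnk (by simpa using (Fintype.card_congr e).symm)⟩
    simp [pairing]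

theorem formV_symmProj (q : ℝ) (x y : V H) :
    formV q (symmProj H x) (symmProj H y) = formV q x y := by
  refine apply₂_symmProj (formV q) ?_ ?_ _ _
  · intro n k σ α h β g
    rw [formV_pure, formV_pure]
    congr 1
    exact (pairing_iso q σ (Equiv.refl _) (conj_iso σ α) (fun x => by simp) (fun i => by simp)
      fun i => rfl).symm
  · intro n k σ α h β g
    rw [formV_pure, formV_pure]
    congr 1
    exact (pairing_iso q (Equiv.refl _) σ (fun x => by simp) (conj_iso σ β) (fun i => rfl)
      fun i => by simp).symm

/-- The bilinear form `⟨A, B^*⟩_q` on `𝒯𝒫(H)`. -/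
def formT (q : ℝ) : TP H →ₗ[ℂ] TP H →ₗ[ℂ] ℂ := (formV q).compl₁₂ (sec H) (sec H)

theorem formT_I (q : ℝ) (x y : V H) : formT q (I H x) (I H y) = formV q x y := by
  rw [formT, LinearMap.compl₁₂_apply, sec_I, sec_I, formV_symmProj]

theorem formT_J [Fintype ι] [DecidableEq ι] [Fintype κ] [DecidableEq κ] (q : ℝ)
    (α : Perm (Option ι)) (h : ι → H) (β : Perm (Option κ)) (g : κ → H) :
    formT q (J α h) (J β g) = (pairing q α h β g : ℝ) := by
  obtain ⟨n, e, α', h', hα, hh, hJ⟩ := exists_J_eq α h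
  obtain ⟨k, f, β', g', hβ, hg, hJ'⟩ := exists_J_eq β g
  rw [hJ, hJ', J_fin, J_fin, formT_I, formV_pure, pairing_iso q e f hα hβ hh hg]

theorem innerTP_eq (q : ℝ) (A B : TP H) : innerTP H q A B = formT q A (starT B) := by
  obtain ⟨x, rfl⟩ := (symmRel H).mkQ_surjective A
  obtain ⟨y, rfl⟩ := (symmRel H).mkQ_surjective B
  change innerTP H q (I H x) (I H y) = formT q (I H x) (starT (I H y))
  rw [starT_I, formT_I, innerTP, innerV_eq_formV, sec_I, sec_I, starV_symmProj, formV_symmProj]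

theorem formT_comm (q : ℝ) (A B : TP H) : formT q A B = formT q B A := by
  induction A using TP_induction with
  | pure n α h =>
    induction B using TP_induction with
    | pure k β g => rw [formT_J, formT_J, pairing_comm]
    | add x y hx hy => rw [map_add, map_add, hx, hy, LinearMap.add_apply]
    | smul c x hx => rw [map_smul, map_smul, hx, LinearMap.smul_apply]
  | add x y hx hy => rw [map_add, map_add, LinearMap.add_apply, hx, hy]
  | smul c x hx => rw [map_smul, map_smul, LinearMap.smul_apply, hx]

theorem formT_star (q : ℝ) (A B : TP H) :
    formT q (starT A) (starT B) = starRingEnd ℂ (formT q A B) := by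
  induction A using TP_induction with
  | pure n α h =>
    induction B using TP_induction with
    | pure k β g => rw [starT_J, starT_J, formT_J, formT_J, pairing_inv, Complex.conj_ofReal]
    | add x y hx hy => rw [map_add, map_add, hx, hy, map_add, map_add]
    | smul c x hx => simp only [map_smulₛₗ, hx, smul_eq_mul, map_mul, RingHom.id_apply]
  | add x y hx hy => simp only [map_add, LinearMap.add_apply, hx, hy]
  | smul c x hx => simp only [map_smulₛₗ, LinearMap.smul_apply, hx, smul_eq_mul, map_mul,
      RingHom.id_apply]

end Bilinear

/-! ### Composition of contractions -/

section Composition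

variable {H : Type*} [NormedAddCommGroup H] [InnerProductSpace ℝ H]
variable {ι κ : Type} [Fintype ι] [DecidableEq ι] [Fintype κ] [DecidableEq κ]

/-- The involution which consists of the pairs of `π` and of the pairs of an involution `π'` of
the singletons of `π`. -/
def glue (π : Perm ι) (π' : Perm {i // π i = i}) : Perm ι := Perm.ofSubtype π' * π

theorem glue_apply_of_ne {π : Invol ι} {π' : Perm {i // π.1 i = i}} {i : ι} (h : π.1 i ≠ i) :
    glue π.1 π' i = π.1 i := by
  rw [glue, Perm.mul_apply]
  refine Perm.ofSubtype_apply_of_not_mem π' fun h' => h ?_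
  rwa [π.apply_apply, eq_comm] at h'

theorem glue_apply_of_eq {π : Perm ι} {π' : Perm {i // π i = i}} {i : ι} (h : π i = i) :
    glue π π' i = π' ⟨i, h⟩ := by
  rw [glue, Perm.mul_apply, h, Perm.ofSubtype_apply_of_mem]

theorem pairs_glue (π : Invol ι) (π' : Perm {i // π.1 i = i}) :
    pairs (glue π.1 π') = (pairs π.1).disjUnion ((pairs π').map (fixEmb π.1).sym2Map) (by
      rw [Finset.disjoint_left]
      intro z hz hz'
      obtain ⟨i, hi, rfl⟩ := mem_pairs.mp hz
      obtain ⟨w, _, hw⟩ := Finset.mem_map.mp hz'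
      induction w with
      | _ a b =>
        have : i ∈ s((a : ι), (b : ι)) := by
          have e : s((a : ι), (b : ι)) = s(i, π.1 i) := hw
          rw [e]
          exact Sym2.mem_mk_left _ _
        rcases Sym2.mem_iff.mp this with rfl | rfl
        · exact hi a.2
        · exact hi b.2) := by
  ext z
  rw [Finset.mem_disjUnion, Finset.mem_map, mem_pairs, mem_pairs]
  constructor
  · rintro ⟨i, hi, rfl⟩
    by_cases h : π.1 i = i
    · rw [glue_apply_of_eq h] at hi ⊢
      refine Or.inr ⟨s(⟨i, h⟩, π' ⟨i, h⟩), mem_pairs.mpr ⟨⟨i, h⟩, fun e => hi ?_, rfl⟩, rfl⟩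
      rw [e]
    · exact Or.inl ⟨i, h, by rw [glue_apply_of_ne h]⟩
  · rintro (⟨i, hi, rfl⟩ | ⟨w, hw, rfl⟩)
    · exact ⟨i, by rwa [glue_apply_of_ne hi], by rw [glue_apply_of_ne hi]⟩
    · obtain ⟨i, hi, rfl⟩ := mem_pairs.mp hw
      refine ⟨i, ?_, ?_⟩
      · rw [glue_apply_of_eq i.2]
        exact fun e => hi (Subtype.ext e)
      · rw [glue_apply_of_eq i.2]
        rfl

theorem card_pairs_glue (π : Invol ι) (π' : Perm {i // π.1 i = i}) :
    (pairs (glue π.1 π')).card = (pairs π.1).card + (pairs π').card := by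
  rw [pairs_glue, Finset.card_disjUnion, Finset.card_map]

theorem pairProd_glue (π : Invol ι) (π' : Perm {i // π.1 i = i}) (h : ι → H) :
    pairProd (glue π.1 π') h = pairProd π.1 h * pairProd π' (h ∘ fixEmb π.1) := by
  rw [pairProd, pairs_glue, Finset.prod_disjUnion, Finset.prod_map, pairProd, pairProd]
  congr 1
  refine Finset.prod_congr rfl fun z _ => ?_
  induction z with
  | _ a b => rfl

/-- `π'` touches only singletons of `π`, so multiplying by it commutes with erasing the support of
`π`. -/
theorem contrP_contrP_aux (π : Perm ι) (π' : Perm {i // π i = i}) (α : Perm (Option ι)) :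
    optionCongr π' * contrP π α =
      restrict (optionCongr (glue π π') * α) (fixEmb π).optionMap := by
  have h1 : optionCongr (glue π π') * α =
      optionCongr (Perm.ofSubtype π') * (optionCongr π * α) := by
    ext x : 1
    rw [glue, Perm.mul_apply, Perm.mul_apply, Perm.mul_apply]
    cases α x <;> rfl
  rw [h1, contrP, restrict_mul_left (optionCongr π * α) (optionCongr (Perm.ofSubtype π')) _
    (optionCongr π')]
  · rintro (_ | y)
    · rfl
    · exact congrArg some (Perm.ofSubtype_apply_coe π' y)
  · rintro (_ | i) hi
    · rfl
    · refine congrArg some (Perm.ofSubtype_apply_of_not_mem π' fun h => hi ⟨some ⟨i, h⟩, rfl⟩)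

theorem contrP_contrP (π : Perm ι) (π' : Perm {i // π i = i}) (α : Perm (Option ι)) :
    contrP π' (contrP π α) =
      restrict (optionCongr (glue π π') * α) ((fixEmb π').trans (fixEmb π)).optionMap := by
  rw [contrP, contrP_contrP_aux, restrict_trans]
  congr 1
  ext1 x
  cases x <;> rfl

theorem range_fixEmb_trans (π : Invol ι) (π' : Perm {i // π.1 i = i}) :
    Set.range ((fixEmb π').trans (fixEmb π.1)) = {i | glue π.1 π' i = i} := by
  ext i
  constructor
  · rintro ⟨j, rfl⟩
    change glue π.1 π' j.1.1 = j.1.1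
    rw [glue_apply_of_eq j.1.2]
    exact congrArg Subtype.val j.2
  · intro hi
    have hi : glue π.1 π' i = i := hi
    by_cases h : π.1 i = i
    · rw [glue_apply_of_eq h] at hi
      exact ⟨⟨⟨i, h⟩, Subtype.ext hi⟩, rfl⟩
    · rw [glue_apply_of_ne h] at hi
      exact absurd hi h

/-- Erasing the support of `π` loses the cycles contained in it. Multiplying by `π'` does not change
those cycles, so the losses before and after gluing are equal and the exponents telescope. -/
theorem contrExp_glue (π : Invol ι) (π' : Perm {i // π.1 i = i}) (α : Perm (Option ι)) :
    contrExp (glue π.1 π') α = contrExp π.1 α + contrExp π' (contrP π.1 α) := by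
  have h1 : numCycles (contrP π' (contrP π.1 α)) = numCycles (contrP (glue π.1 π') α) := by
    rw [contrP_contrP, numCycles_restrict_eq _ (range_fixEmb_trans π π')]
  have h2 := numCycles_eq_restrict_add (optionCongr π.1 * α) (fixEmb π.1).optionMap
  have h3 := numCycles_eq_restrict_add (optionCongr (glue π.1 π') * α) (fixEmb π.1).optionMap
  rw [← contrP_contrP_aux] at h3
  have h4 : numCyclesIn (optionCongr (glue π.1 π') * α) (Set.range (fixEmb π.1).optionMap)ᶜ =
      numCyclesIn (optionCongr π.1 * α) (Set.range (fixEmb π.1).optionMap)ᶜ := by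
    have h5 : optionCongr (glue π.1 π') * α =
        optionCongr (Perm.ofSubtype π') * (optionCongr π.1 * α) := by
      ext x : 1
      rw [glue, Perm.mul_apply, Perm.mul_apply, Perm.mul_apply]
      cases α x <;> rfl
    rw [h5]
    refine numCyclesIn_mul_left _ _ _ ?_
    rintro (_ | i) hi
    · rfl
    · exact congrArg some (Perm.ofSubtype_apply_of_not_mem π' fun h => hi ⟨some ⟨i, h⟩, rfl⟩)
  have h6 : numCycles (contrP π.1 α) =
    numCycles (restrict (optionCongr π.1 * α) (fixEmb π.1).optionMap) := rfl
  rw [contrExp, contrExp, contrExp, card_pairs_glue, h1]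
  push_cast
  omega

/-- Contracting in two stages is contracting once. Exponents of homogeneous contractions may be
negative, hence `q ≠ 0`. -/
theorem C_glue {q : ℝ} (hq : q ≠ 0) (π : Invol ι) (π' : Perm {i // π.1 i = i})
    (α : Perm (Option ι)) (h : ι → H) :
    C q (glue π.1 π') α h =
      (contrCoeff q π.1 α h : ℂ) • C q π' (contrP π.1 α) (h ∘ fixEmb π.1) := by
  have h1 : contrCoeff q (glue π.1 π') α h =
      contrCoeff q π.1 α h * contrCoeff q π' (contrP π.1 α) (h ∘ fixEmb π.1) := by
    rw [contrCoeff, contrCoeff, contrCoeff, contrExp_glue, pairProd_glue, zpow_add₀ hq]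
    ring
  have h2 : J (contrP (glue π.1 π') α) (h ∘ fixEmb (glue π.1 π')) =
      J (contrP π' (contrP π.1 α)) ((h ∘ fixEmb π.1) ∘ fixEmb π') := by
    rw [contrP_contrP]
    exact (J_restrict_eq _ (range_fixEmb_trans π π') α h).symm
  rw [C, C, smul_smul, ← Complex.ofReal_mul, h1, h2]

/-- `π` consists of some of the pairs of `ρ`. -/
def IsSub (π ρ : Perm ι) : Prop := ∀ i, π i ≠ i → ρ i = π i

theorem glue_mul_self (π : Invol ι) (π' : Invol {i // π.1 i = i}) :
    glue π.1 π'.1 * glue π.1 π'.1 = 1 := by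
  ext i
  rw [Perm.mul_apply, Perm.one_apply]
  by_cases h : π.1 i = i
  · rw [glue_apply_of_eq h, glue_apply_of_eq (π'.1 ⟨i, h⟩).2, Subtype.coe_eta, π'.apply_apply]
  · rw [glue_apply_of_ne h, glue_apply_of_ne, π.apply_apply]
    rw [π.apply_apply]
    exact fun h' => h h'.symm

/-- `glue π π'` as an involution. -/
def glueInvol (π : Invol ι) (π' : Invol {i // π.1 i = i}) : Invol ι :=
  ⟨glue π.1 π'.1, glue_mul_self π π'⟩

/-- Gluing onto `π` is a bijection from the involutions of its singletons to the involutions that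
contain all its pairs, and `p` selects only among the latter. -/
theorem sum_glue {M : Type*} [AddCommMonoid M] (π : Invol ι) (F : Perm ι → M)
    (p : Perm ι → Prop) [DecidablePred p]
    (hp : ∀ ρ : Invol ι, p ρ.1 → IsSub π.1 ρ.1) :
    ∑ π' : Invol {i // π.1 i = i}, (if p (glue π.1 π'.1) then F (glue π.1 π'.1) else 0) =
      ∑ ρ : Invol ι, if p ρ.1 then F ρ.1 else 0 := by
  refine Fintype.sum_of_injective (glueInvol π) (fun a b hab => ?_)
    (fun π' => if p (glue π.1 π'.1) then F (glue π.1 π'.1) else 0)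
    (fun ρ => if p ρ.1 then F ρ.1 else 0) (fun ρ hρ => ?_) fun π' => ?_
  · refine Subtype.ext (Perm.ext fun i => Subtype.ext ?_)
    have := congrArg (fun ρ : Invol ι => ρ.1 i) hab
    simpa only [glueInvol, glue_apply_of_eq i.2] using this
  · refine if_neg fun h => hρ ?_
    have hs := hp ρ h
    -- Since `ρ` contains the pairs of `π`, it maps singletons of `π` to singletons of `π`. Its
    -- restriction to them is the preimage under gluing.
    have hfix : ∀ i, π.1 i = i ↔ π.1 (ρ.1 i) = ρ.1 i := by
      intro i
      by_cases hi : π.1 i = i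
      · refine iff_of_true hi ?_
        by_contra h'
        have := hs _ h'
        rw [ρ.apply_apply] at this
        have h3 : ρ.1 i = i :=
            (π.apply_apply (ρ.1 i)).symm.trans ((congrArg π.1 this.symm).trans hi)
        exact h' (by rw [h3, hi])
      · refine iff_of_false hi ?_
        rw [hs i hi, π.apply_apply]
        exact fun h' => hi h'.symm
    refine ⟨⟨ρ.1.subtypePerm fun i => (hfix i).symm, ?_⟩, ?_⟩
    · ext i
      exact ρ.apply_apply _
    · refine Subtype.ext (Perm.ext fun i => ?_)
      by_cases hi : π.1 i = i
      · exact glue_apply_of_eq hi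
      · exact (glue_apply_of_ne hi).trans (hs i hi).symm
  · rfl

theorem card_pairs_swap_mul {π : Perm ι} {a b : ι} (ha : π a = a) (hb : π b = b) (hab : a ≠ b) :
    (pairs (swap a b * π)).card = (pairs π).card + 1 := by
  have hmem : s(a, b) ∉ pairs π := by
    intro h
    obtain ⟨i, hi, h⟩ := mem_pairs.mp h
    have : i ∈ s(a, b) := h ▸ Sym2.mem_mk_left _ _
    rcases Sym2.mem_iff.mp this with rfl | rfl
    · exact hi ha
    · exact hi hb
  have hother : ∀ i, i ≠ a → i ≠ b → (swap a b * π) i = π i := by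
    intro i hia hib
    rw [Perm.mul_apply]
    exact swap_apply_of_ne_of_ne (fun e => hia (π.injective (e.trans ha.symm)))
      (fun e => hib (π.injective (e.trans hb.symm)))
  have ha' : (swap a b * π) a = b := by rw [Perm.mul_apply, ha, swap_apply_left]
  have hb' : (swap a b * π) b = a := by rw [Perm.mul_apply, hb, swap_apply_right]
  have : pairs (swap a b * π) = insert s(a, b) (pairs π) := by
    ext z
    rw [Finset.mem_insert, mem_pairs, mem_pairs]
    constructor
    · rintro ⟨i, hi, rfl⟩
      by_cases hia : i = a
      · exact Or.inl (by rw [hia, ha'])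
      by_cases hib : i = b
      · exact Or.inl (by rw [hib, hb', Sym2.eq_swap])
      · rw [hother i hia hib] at hi ⊢
        exact Or.inr ⟨i, hi, rfl⟩
    · rintro (rfl | ⟨i, hi, rfl⟩)
      · exact ⟨a, by rw [ha']; exact hab.symm, by rw [ha']⟩
      · have h1 : i ≠ a := fun e => hi (by rw [e, ha])
        have h2 : i ≠ b := fun e => hi (by rw [e, hb])
        exact ⟨i, by rwa [hother i h1 h2], by rw [hother i h1 h2]⟩
  rw [this, Finset.card_insert_of_notMem hmem]

-- Inclusion-exclusion over sets of pairs of `ρ`: adding or removing one chosen pair `{a, ρ a}`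
-- reverses the sign.
open Classical in
theorem sum_neg_one_pow_card_pairs (ρ : Invol ι) (hρ : ρ ≠ ⟨1, one_mul 1⟩) :
    ∑ π : Invol ι, (if IsSub π.1 ρ.1 then (-1 : ℂ) ^ (pairs π.1).card else 0) = 0 := by
  obtain ⟨a, ha⟩ : ∃ a, ρ.1 a ≠ a := by
    by_contra! h
    exact hρ (Subtype.ext (Perm.ext h))
  have hρb : ρ.1 (ρ.1 a) = a := ρ.apply_apply a
  have hcases : ∀ π : Invol ι, IsSub π.1 ρ.1 →
      (π.1 a = a ∧ π.1 (ρ.1 a) = ρ.1 a) ∨ (π.1 a = ρ.1 a ∧ π.1 (ρ.1 a) = a) := by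
    intro π hπ
    by_cases h : π.1 a = a
    · refine Or.inl ⟨h, ?_⟩
      by_contra h'
      have := hπ _ h'
      rw [hρb] at this
      exact ha (π.1.injective (by rw [h, ← this]))
    · have := hπ _ h
      exact Or.inr ⟨this.symm, by rw [this, π.apply_apply]⟩
  have hinv : ∀ π : Invol ι, IsSub π.1 ρ.1 →
      (swap a (ρ.1 a) * π.1) * (swap a (ρ.1 a) * π.1) = 1 := by
    intro π hπ
    -- The transposition commutes with `π` because `π` either fixes both `a` and `ρ a` or exchanges
    -- them.
    have h1 : π.1 * swap a (ρ.1 a) = swap a (ρ.1 a) * π.1 := by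
      rw [mul_swap_eq_swap_mul]
      rcases hcases π hπ with ⟨h1, h2⟩ | ⟨h1, h2⟩
      · rw [h1, h2]
      · rw [h1, h2, swap_comm]
    rw [mul_assoc, ← mul_assoc π.1, h1, mul_assoc, π.2, mul_one, swap_mul_self]
  rw [← Finset.sum_filter]
  refine Finset.sum_involution
    (fun π hπ => ⟨swap a (ρ.1 a) * π.1, hinv π (Finset.mem_filter.mp hπ).2⟩) ?_ ?_ ?_ ?_
  · intro π hπ
    rcases hcases π (Finset.mem_filter.mp hπ).2 with ⟨h1, h2⟩ | ⟨h1, h2⟩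
    · rw [card_pairs_swap_mul h1 h2 (Ne.symm ha), pow_succ]
      ring
    · have := card_pairs_swap_mul (π := swap a (ρ.1 a) * π.1) (a := a) (b := ρ.1 a)
        (by rw [Perm.mul_apply, h1, swap_apply_right])
        (by rw [Perm.mul_apply, h2, swap_apply_left]) (Ne.symm ha)
      rw [swap_mul_self_mul] at this
      rw [this, pow_succ]
      ring
  · intro π hπ _ h
    have h1 : swap a (ρ.1 a) * π.1 = π.1 := congrArg Subtype.val h
    have h2 : swap a (ρ.1 a) = 1 := mul_eq_right.mp h1
    exact ha (swap_eq_one_iff.mp h2).symm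
  · intro π hπ
    have hs := (Finset.mem_filter.mp hπ).2
    refine Finset.mem_filter.mpr ⟨Finset.mem_univ _, fun i hi => ?_⟩
    change (swap a (ρ.1 a)) (π.1 i) ≠ i at hi
    change _ = (swap a (ρ.1 a)) (π.1 i)
    by_cases h1 : π.1 i = a
    · have h3 : i = π.1 a := by rw [← h1, π.apply_apply]
      rw [h1, swap_apply_left] at hi ⊢
      rcases hcases π hs with ⟨h, _⟩ | ⟨h, _⟩
      · rw [h3, h]
      · exact absurd (h3.trans h).symm hi
    by_cases h2 : π.1 i = ρ.1 a
    · have h3 : i = π.1 (ρ.1 a) := by rw [← h2, π.apply_apply]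
      rw [h2, swap_apply_right] at hi ⊢
      rcases hcases π hs with ⟨_, h⟩ | ⟨_, h⟩
      · rw [h3, h, hρb]
      · exact absurd (h3.trans h).symm hi
    · rw [swap_apply_of_ne_of_ne h1 h2] at hi ⊢
      exact hs i hi
  · intro π hπ
    exact Subtype.ext (swap_mul_self_mul _ _ _)

theorem restrict_surjective {X Y : Type} [Finite X] (α : Perm X) (e : Y ≃ X) (y : Y) :
    e (restrict α e.toEmbedding y) = α (e y) := by
  have : restrict α e.toEmbedding y = e.symm (α (e y)) := by
    refine restrict_apply_eq ?_
    have := FirstHit.one (α := α) (S := Set.range e.toEmbedding) (e y)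
    simpa using this
  rw [this, apply_symm_apply]

theorem contrP_one (α : Perm (Option ι)) (x) :
    optionCongr (Equiv.subtypeUnivEquiv fun i => Perm.one_apply (α := ι) i) (contrP 1 α x) =
      α (optionCongr (Equiv.subtypeUnivEquiv fun i => Perm.one_apply (α := ι) i) x) := by
  have h1 : (optionCongr (1 : Perm ι) * α) = α := by
    ext x : 1
    rw [Perm.mul_apply]
    cases α x <;> rfl
  have h2 : (fixEmb (1 : Perm ι)).optionMap = (optionCongr
      (Equiv.subtypeUnivEquiv fun i => Perm.one_apply (α := ι) i)).toEmbedding := by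
    ext1 x
    cases x <;> rfl
  rw [contrP, h1, h2]
  exact restrict_surjective _ _ _

theorem pairs_one : pairs (1 : Perm ι) = ∅ := by
  ext z
  simp [mem_pairs]

theorem C_one (q : ℝ) (α : Perm (Option ι)) (h : ι → H) : C q 1 α h = J α h := by
  have h1 : (optionCongr (1 : Perm ι) * α) = α := by
    ext x : 1
    rw [Perm.mul_apply]
    cases α x <;> rfl
  rw [C, contrCoeff, contrExp, numCycles_map _ (contrP_one α), h1, pairProd, pairs_one,
    J_iso (h := h ∘ fixEmb 1) (g := h) _ (contrP_one α) (fun i => rfl)]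
  simp

/-- After composing the contractions, `C_ρ` has coefficient `s^{ℓ(ρ)}` times the alternating sum
over the sets of pairs `π` of `ρ`, which vanishes unless `ρ` is trivial. -/
theorem E_comp_neg {q : ℝ} (hq : q ≠ 0) (s : ℂ) (A : TP H) :
    E q s (E q (-s) A) = A := by
  classical
  induction A using TP_induction with
  | add A B hA hB => rw [map_add, map_add, hA, hB]
  | smul c A hA => rw [map_smul, map_smul, hA]
  | pure n α h =>
    rw [E_J, sumC, map_sum]
    have h1 : ∀ π : Invol (Fin n), E q s ((-s) ^ (pairs π.1).card • C q π.1 α h) =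
        ∑ ρ : Invol (Fin n), if IsSub π.1 ρ.1 then
          ((-1) ^ (pairs π.1).card * s ^ (pairs ρ.1).card) • C q ρ.1 α h else 0 := by
      intro π
      rw [← sum_glue π (fun ρ => ((-1) ^ (pairs π.1).card * s ^ (pairs ρ).card) • C q ρ α h)
        (IsSub π.1) fun ρ hρ => hρ]
      rw [map_smul, C, map_smul, E_J, sumC, Finset.smul_sum, Finset.smul_sum]
      refine Finset.sum_congr rfl fun π' _ => ?_
      have : IsSub π.1 (glue π.1 π'.1) := fun i hi => glue_apply_of_ne hi
      rw [if_pos this, C_glue hq, card_pairs_glue, smul_smul, smul_smul, smul_smul, pow_add,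
        neg_pow s]
      congr 1
      ring
    rw [Finset.sum_congr rfl fun π _ => h1 π, Finset.sum_comm]
    have h2 : ∀ ρ : Invol (Fin n), ∑ π : Invol (Fin n), (if IsSub π.1 ρ.1 then
          ((-1) ^ (pairs π.1).card * s ^ (pairs ρ.1).card) • C q ρ.1 α h else 0) =
        (∑ π : Invol (Fin n), (if IsSub π.1 ρ.1 then (-1 : ℂ) ^ (pairs π.1).card else 0)) •
          s ^ (pairs ρ.1).card • C q ρ.1 α h := by
      intro ρ
      rw [Finset.sum_smul]
      refine Finset.sum_congr rfl fun π _ => ?_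
      split_ifs
      · rw [mul_smul]
      · rw [zero_smul]
    rw [Finset.sum_congr rfl fun ρ _ => h2 ρ,
      Finset.sum_eq_single (⟨1, one_mul 1⟩ : Invol (Fin n))]
    · have h3 : ∑ π : Invol (Fin n), (if IsSub π.1 (1 : Perm (Fin n)) then
          (-1 : ℂ) ^ (pairs π.1).card else 0) = 1 := by
        rw [Finset.sum_eq_single (⟨1, one_mul 1⟩ : Invol (Fin n)), if_pos, pairs_one]
        · simp
        · exact fun i hi => absurd rfl hi
        · intro π _ hπ
          refine if_neg fun h => hπ (Subtype.ext (Perm.ext fun i => ?_))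
          by_contra h'
          exact h' (h i h').symm
        · simp
      rw [h3, pairs_one, C_one]
      simp
    · intro ρ _ hρ
      rw [sum_neg_one_pow_card_pairs ρ hρ, zero_smul]
    · simp

theorem E_neg_one_E {q : ℝ} (hq : q ≠ 0) (A : TP H) : E q (-1) (E q 1 A) = A := by
  simpa using E_comp_neg hq (-1) A

theorem E_E_neg_one {q : ℝ} (hq : q ≠ 0) (A : TP H) : E q 1 (E q (-1) A) = A :=
  E_comp_neg hq 1 A

end Composition

/-! ### Contractions of cup products -/

section CupPerm

variable {ι κ Y Z : Type}

theorem FirstHit.cup_inl {α : Perm (Option ι)} {β : Perm (Option κ)} {S : Set (Option ι)}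
    {S' : Set (Option (ι ⊕ κ))} (h0 : none ∈ S)
    (hS : ∀ i, some (Sum.inl i) ∈ S' → some i ∈ S) {x y : Option ι} (h : FirstHit α S x y) {i : ι}
    (hy : y = some i) : FirstHit (cupPerm α β) S' (x.map Sum.inl) (some (Sum.inl i)) := by
  induction h with
  | one x =>
    rw [← cupPerm_of_apply_eq_some α β hy]
    exact .one _
  | @step x y hn _ ih =>
    rcases hx : α x with _ | j
    · rw [hx] at hn
      exact absurd h0 hn
    · have e := cupPerm_of_apply_eq_some α β hx
      rw [hx] at hn ih
      refine .step ?_ ?_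
      · rw [e]
        exact fun h' => hn (hS _ h')
      · rw [e]
        exact ih hy

theorem FirstHit.cup_inr {α : Perm (Option ι)} {β : Perm (Option κ)} {T : Set (Option κ)}
    {S' : Set (Option (ι ⊕ κ))} (h0 : none ∈ T)
    (hT : ∀ k, some (Sum.inr k) ∈ S' → some k ∈ T) {x y : Option κ} (h : FirstHit β T x y)
    {k : κ} (hx : x = some k) : FirstHit (cupPerm α β) S' (some (Sum.inr k)) (y.map Sum.inr) := by
  induction h generalizing k with
  | one x =>
    subst hx
    rw [← cupPerm_inr α]
    exact .one _
  | @step x y hn _ ih =>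
    subst hx
    have e := cupPerm_inr α β k
    rcases hx : β (some k) with _ | j
    · rw [hx] at hn
      exact absurd h0 hn
    · rw [hx] at hn e
      refine .step ?_ ?_
      · rw [e]
        exact fun h' => hn (hT _ h')
      · rw [e]
        exact ih hx

/-- When `α` would return to `0`, the union continues from `0` along `β`. The run of `α` that ends
at `0` and the run of `β` that starts there are therefore concatenated. -/
theorem FirstHit.cup_none {α : Perm (Option ι)} {β : Perm (Option κ)} {S : Set (Option ι)}
    {T : Set (Option κ)} {S' : Set (Option (ι ⊕ κ))} (h0 : none ∈ S) (h0' : none ∈ T)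
    (hS : ∀ i, some (Sum.inl i) ∈ S' → some i ∈ S) (hT : ∀ k, some (Sum.inr k) ∈ S' → some k ∈ T)
    {x y : Option ι} (h : FirstHit α S x y) (hy : y = none) {z : Option κ}
    (hz : FirstHit β T none z) :
    FirstHit (cupPerm α β) S' (x.map Sum.inl) (z.map Sum.inr) := by
  induction h with
  | one x =>
    have e := cupPerm_of_apply_eq_none α β hy
    cases hz with
    | one =>
      rw [← e]
      exact .one _
    | step hn hz =>
      rcases hb : β none with _ | k
      · rw [hb] at hn
        exact absurd h0' hn
      · rw [hb] at hn e
        refine .step ?_ ?_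
        · rw [e]
          exact fun h' => hn (hT _ h')
        · rw [e]
          exact hz.cup_inr h0' hT hb
  | @step x y hn _ ih =>
    rcases hx : α x with _ | j
    · rw [hx] at hn
      exact absurd h0 hn
    · have e := cupPerm_of_apply_eq_some α β hx
      rw [hx] at hn ih
      refine .step ?_ ?_
      · rw [e]
        exact fun h' => hn (hS _ h')
      · rw [e]
        exact ih hy

/-- Runs stop at `0` since `0` is never erased. A run in the union is thus a run of `α`, a run of
`β`, or a concatenation of the two at `0`. -/
theorem restrict_cupPerm [Finite ι] [Finite κ] (α : Perm (Option ι)) (β : Perm (Option κ))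
    (f : Y ↪ ι) (g : Z ↪ κ) :
    restrict (cupPerm α β) (f.sumMap g).optionMap =
      cupPerm (restrict α f.optionMap) (restrict β g.optionMap) := by
  have hS : ∀ i, some (Sum.inl i) ∈ Set.range (f.sumMap g).optionMap →
      some i ∈ Set.range f.optionMap := by
    intro i hi
    rw [optionMap_range] at hi ⊢
    obtain ⟨y | z, h⟩ := hi
    · exact ⟨y, Sum.inl_injective h⟩
    · simp at h
  have hT : ∀ k, some (Sum.inr k) ∈ Set.range (f.sumMap g).optionMap →
      some k ∈ Set.range g.optionMap := by
    intro i hi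
    rw [optionMap_range] at hi ⊢
    obtain ⟨y | z, h⟩ := hi
    · simp at h
    · exact ⟨z, Sum.inr_injective h⟩
  have key : ∀ y : Option Y, restrict (cupPerm α β) (f.sumMap g).optionMap (y.map Sum.inl) =
      cupPerm (restrict α f.optionMap) (restrict β g.optionMap) (y.map Sum.inl) := by
    intro y
    refine restrict_apply_eq ?_
    have h1 := firstHit_restrict α f.optionMap y
    have hL : (f.sumMap g).optionMap (y.map Sum.inl) = (f.optionMap y).map Sum.inl := by
      cases y <;> rfl
    rw [hL]
    rcases hy : restrict α f.optionMap y with _ | y'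
    · rw [cupPerm_of_apply_eq_none _ _ hy]
      have h2 := firstHit_restrict β g.optionMap none
      have hR : ∀ z : Option Z, (f.sumMap g).optionMap (z.map Sum.inr) =
          (g.optionMap z).map Sum.inr := by intro z; cases z <;> rfl
      rw [hR]
      rw [hy] at h1
      exact h1.cup_none (none_mem_range f) (none_mem_range g) hS hT rfl h2
    · rw [cupPerm_of_apply_eq_some _ _ hy]
      rw [hy] at h1
      exact h1.cup_inl (none_mem_range f) hS rfl
  ext x : 1
  rcases x with _ | y | z
  · exact key none
  · exact key (some y)
  · refine restrict_apply_eq ?_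
    rw [cupPerm_inr]
    have h1 := (firstHit_restrict β g.optionMap (some z)).cup_inr (α := α) (none_mem_range g) hT rfl
    have hR : ∀ z : Option Z, (f.sumMap g).optionMap (z.map Sum.inr) =
        (g.optionMap z).map Sum.inr := by intro z; cases z <;> rfl
    rw [hR]
    exact h1

theorem numCycles_eq_add_one [Finite ι] (α : Perm (Option ι)) :
    numCycles α = numCyclesIn α {none}ᶜ + 1 := by
  have hf : Function.Injective (fun _ : Unit => (none : Option ι)) := fun _ _ _ => rfl
  have h := numCycles_eq_restrict_add α ⟨fun _ : Unit => (none : Option ι), hf⟩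
  have h1 : numCycles (restrict α ⟨fun _ : Unit => (none : Option ι), hf⟩) = 1 := by
    refine Nat.card_eq_one_iff_unique.mpr ⟨⟨fun a b => ?_⟩, ⟨Quotient.mk _ ()⟩⟩
    induction a using Quotient.inductionOn with
    | h a =>
    induction b using Quotient.inductionOn with
    | h b => rfl
  have h2 : Set.range (⟨fun _ : Unit => (none : Option ι), hf⟩ : Unit ↪ Option ι) = {none} :=
    Set.range_const
  rw [h, h1, h2, add_comm]

/-- The cycles avoiding `0` are untouched by the union. On invariant functions that vanish at `0`,
this says that the parts on `ι` and on `κ` can be chosen independently. -/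
theorem numCyclesIn_cupPerm [Finite ι] [Finite κ] (α : Perm (Option ι)) (β : Perm (Option κ)) :
    numCyclesIn (cupPerm α β) {none}ᶜ = numCyclesIn α {none}ᶜ + numCyclesIn β {none}ᶜ := by
  have e : InvFun (cupPerm α β) {none}ᶜ (Fin 2) ≃
      InvFun α {none}ᶜ (Fin 2) × InvFun β {none}ᶜ (Fin 2) :=
    { toFun := fun f =>
        (⟨fun x => f.1 (x.map Sum.inl), by
            -- Only at `α⁻¹ 0` does the union differ from `α` on the left part, and invariance at a
            -- single missing point is automatic.
            have h1 : ∀ x, x ≠ α⁻¹ none → f.1 ((α x).map Sum.inl) = f.1 (x.map Sum.inl) := by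
              intro x hx
              rcases h : α x with _ | i
              · exact absurd (Perm.eq_inv_iff_eq.mpr h) hx
              · have h2 := f.2.1 (x.map Sum.inl)
                rwa [cupPerm_of_apply_eq_some α β h] at h2
            intro x
            by_cases hx : x = α⁻¹ none
            · subst hx
              exact apply_eq_of_forall_ne α (fun x => f.1 (x.map Sum.inl)) _ h1
            · exact h1 x hx,
          by
            rintro (_ | i) hi
            · exact f.2.2 none (by simp)
            · simp at hi⟩,
        ⟨fun x => f.1 (x.map Sum.inr), by
            have h1 : ∀ x, x ≠ none → f.1 ((β x).map Sum.inr) = f.1 (x.map Sum.inr) := by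
              rintro (_ | k) hx
              · exact absurd rfl hx
              · rw [← cupPerm_inr α, f.2.1]
                rfl
            intro x
            by_cases hx : x = none
            · subst hx
              exact apply_eq_of_forall_ne β (fun x => f.1 (x.map Sum.inr)) _ h1
            · exact h1 x hx,
          by
            rintro (_ | i) hi
            · exact f.2.2 none (by simp)
            · simp at hi⟩)
      invFun := fun p => ⟨fun x => x.elim 0 (Sum.elim (fun i => p.1.1 (some i))
          fun k => p.2.1 (some k)), by
        have hp := p.1.2.2 none (by simp)
        have hp' := p.2.2.2 none (by simp)
        have hR : ∀ x : Option κ, (x.map Sum.inr).elim 0 (Sum.elim (fun i => p.1.1 (some i))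
            fun k => p.2.1 (some k)) = p.2.1 x := by
          rintro (_ | k)
          · exact hp'.symm
          · rfl
        have key : ∀ x : Option ι, (cupPerm α β (x.map Sum.inl)).elim 0
            (Sum.elim (fun i => p.1.1 (some i)) fun k => p.2.1 (some k)) = p.1.1 x := by
          intro x
          rcases h : α x with _ | i
          · rw [cupPerm_of_apply_eq_none α β h, hR, p.2.2.1, hp', ← p.1.2.1, h, hp]
          · rw [cupPerm_of_apply_eq_some α β h, ← p.1.2.1, h]
            rfl
        rintro (_ | i | k)
        · exact (key none).trans hp
        · exact key (some i)
        · change (cupPerm α β (some (Sum.inr k))).elim 0 _ = _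
          rw [cupPerm_inr]
          exact (hR _).trans (p.2.2.1 _), by
        rintro (_ | x) hx
        · rfl
        · simp at hx⟩
      left_inv := fun f => by
        ext x
        rcases x with _ | i | k
        · exact congrArg Fin.val (f.2.2 none (by simp)).symm
        · rfl
        · rfl
      right_inv := fun p => by
        refine Prod.ext (Subtype.ext (funext fun x => ?_)) (Subtype.ext (funext fun x => ?_))
        · rcases x with _ | i
          · exact (p.1.2.2 none (by simp)).symm
          · rfl
        · rcases x with _ | i
          · exact (p.2.2.2 none (by simp)).symm
          · rfl }
  have h := Nat.card_congr e
  rw [Nat.card_prod, card_invFun, card_invFun, card_invFun, ← pow_add] at h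
  exact Nat.pow_right_injective le_rfl (by simpa using h)

/-- The two cycles through `0` merge into one. -/
theorem numCycles_cupPerm [Finite ι] [Finite κ] (α : Perm (Option ι)) (β : Perm (Option κ)) :
    numCycles (cupPerm α β) + 1 = numCycles α + numCycles β := by
  rw [numCycles_eq_add_one, numCycles_eq_add_one α, numCycles_eq_add_one β, numCyclesIn_cupPerm]
  omega

theorem optionCongr_sumCongr_mul_cupPerm (π₁ : Perm ι) (π₂ : Perm κ) (α : Perm (Option ι))
    (β : Perm (Option κ)) : optionCongr (π₁.sumCongr π₂) * cupPerm α β =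
      cupPerm (optionCongr π₁ * α) (optionCongr π₂ * β) := by
  have hR : ∀ x : Option κ, optionCongr (π₁.sumCongr π₂) (x.map Sum.inr) =
      (optionCongr π₂ x).map Sum.inr := by rintro (_ | _) <;> rfl
  have key : ∀ x : Option ι, (optionCongr (π₁.sumCongr π₂) * cupPerm α β) (x.map Sum.inl) =
      cupPerm (optionCongr π₁ * α) (optionCongr π₂ * β) (x.map Sum.inl) := by
    intro x
    rw [Perm.mul_apply]
    rcases h : α x with _ | i
    · rw [cupPerm_of_apply_eq_none α β h, hR, cupPerm_of_apply_eq_none]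
      · rfl
      · rw [Perm.mul_apply, h]; rfl
    · rw [cupPerm_of_apply_eq_some α β h, cupPerm_of_apply_eq_some (i := π₁ i)]
      · rfl
      · rw [Perm.mul_apply, h]; rfl
  ext x : 1
  rcases x with _ | i | k
  · exact key none
  · exact key (some i)
  · rw [Perm.mul_apply, cupPerm_inr, cupPerm_inr, hR]
    rfl

end CupPerm

/-! ### Contractions of a union, split into homogeneous and inhomogeneous pairs. -/

section CupContraction

variable {H : Type*} [NormedAddCommGroup H] [InnerProductSpace ℝ H]
variable {ι κ : Type} [Fintype ι] [DecidableEq ι] [Fintype κ] [DecidableEq κ]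

theorem range_sumMap_fixEmb (π₁ : Perm ι) (π₂ : Perm κ) :
    Set.range ((fixEmb π₁).sumMap (fixEmb π₂)) = {x | π₁.sumCongr π₂ x = x} := by
  ext x
  rcases x with i | k
  · constructor
    · rintro ⟨j | j, h⟩
      · obtain rfl : j.1 = i := Sum.inl_injective h
        exact congrArg Sum.inl j.2
      · simp at h
    · intro h
      exact ⟨Sum.inl ⟨i, Sum.inl_injective h⟩, rfl⟩
  · constructor
    · rintro ⟨j | j, h⟩
      · simp at h
      · obtain rfl : j.1 = k := Sum.inr_injective h
        exact congrArg Sum.inr j.2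
    · intro h
      exact ⟨Sum.inr ⟨k, Sum.inr_injective h⟩, rfl⟩

theorem pairs_sumCongr (π₁ : Perm ι) (π₂ : Perm κ) :
    pairs (π₁.sumCongr π₂) = ((pairs π₁).map Function.Embedding.inl.sym2Map).disjUnion
      ((pairs π₂).map Function.Embedding.inr.sym2Map) (by
        rw [Finset.disjoint_left]
        intro z hz hz'
        obtain ⟨w, _, rfl⟩ := Finset.mem_map.mp hz
        obtain ⟨w', _, h⟩ := Finset.mem_map.mp hz'
        induction w with
        | _ a b =>
        induction w' with
        | _ c d => simp at h) := by
  ext z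
  rw [Finset.mem_disjUnion, Finset.mem_map, Finset.mem_map, mem_pairs]
  constructor
  · rintro ⟨i | k, hi, rfl⟩
    · exact Or.inl ⟨s(i, π₁ i), mem_pairs.mpr ⟨i, fun e => hi (congrArg Sum.inl e), rfl⟩, rfl⟩
    · exact Or.inr ⟨s(k, π₂ k), mem_pairs.mpr ⟨k, fun e => hi (congrArg Sum.inr e), rfl⟩, rfl⟩
  · rintro (⟨w, hw, rfl⟩ | ⟨w, hw, rfl⟩)
    · obtain ⟨i, hi, rfl⟩ := mem_pairs.mp hw
      exact ⟨Sum.inl i, fun e => hi (Sum.inl_injective e), rfl⟩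
    · obtain ⟨i, hi, rfl⟩ := mem_pairs.mp hw
      exact ⟨Sum.inr i, fun e => hi (Sum.inr_injective e), rfl⟩

theorem card_pairs_sumCongr (π₁ : Perm ι) (π₂ : Perm κ) :
    (pairs (π₁.sumCongr π₂)).card = (pairs π₁).card + (pairs π₂).card := by
  rw [pairs_sumCongr, Finset.card_disjUnion, Finset.card_map, Finset.card_map]

theorem pairProd_sumCongr (π₁ : Perm ι) (π₂ : Perm κ) (h : ι → H) (g : κ → H) :
    pairProd (π₁.sumCongr π₂) (Sum.elim h g) = pairProd π₁ h * pairProd π₂ g := by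
  rw [pairProd, pairs_sumCongr, Finset.prod_disjUnion, Finset.prod_map, Finset.prod_map, pairProd,
    pairProd]
  congr 1
  · refine Finset.prod_congr rfl fun z _ => ?_
    induction z with
    | _ a b => rfl
  · refine Finset.prod_congr rfl fun z _ => ?_
    induction z with
    | _ a b => rfl

theorem contrP_cupPerm (π₁ : Perm ι) (π₂ : Perm κ) (α : Perm (Option ι)) (β : Perm (Option κ)) :
    cupPerm (contrP π₁ α) (contrP π₂ β) = restrict (optionCongr (π₁.sumCongr π₂) * cupPerm α β)
      ((fixEmb π₁).sumMap (fixEmb π₂)).optionMap := by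
  rw [optionCongr_sumCongr_mul_cupPerm, restrict_cupPerm]
  rfl

/-- The merging of the cycles through `0` costs one both before and after erasing, so it cancels. -/
theorem contrExp_cupPerm (π₁ : Perm ι) (π₂ : Perm κ) (α : Perm (Option ι))
    (β : Perm (Option κ)) : contrExp (π₁.sumCongr π₂) (cupPerm α β) =
      contrExp π₁ α + contrExp π₂ β := by
  have h1 := numCycles_cupPerm (contrP π₁ α) (contrP π₂ β)
  have h2 := numCycles_cupPerm (optionCongr π₁ * α) (optionCongr π₂ * β)
  rw [contrP_cupPerm, numCycles_restrict_eq _ (range_sumMap_fixEmb π₁ π₂)] at h1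
  rw [contrExp, contrExp, contrExp, card_pairs_sumCongr, optionCongr_sumCongr_mul_cupPerm]
  push_cast
  omega

theorem contrCoeff_cupPerm {q : ℝ} (hq : q ≠ 0) (π₁ : Perm ι) (π₂ : Perm κ)
    (α : Perm (Option ι)) (β : Perm (Option κ)) (h : ι → H) (g : κ → H) :
    contrCoeff q (π₁.sumCongr π₂) (cupPerm α β) (Sum.elim h g) =
      contrCoeff q π₁ α h * contrCoeff q π₂ β g := by
  rw [contrCoeff, contrExp_cupPerm, pairProd_sumCongr, zpow_add₀ hq, contrCoeff, contrCoeff]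
  ring

/-- The sum of two involutions. -/
def sumInvol (π₁ : Invol ι) (π₂ : Invol κ) : Invol (ι ⊕ κ) :=
  ⟨π₁.1.sumCongr π₂.1, by
    ext x : 1
    rcases x with i | k
    · exact congrArg Sum.inl (π₁.apply_apply i)
    · exact congrArg Sum.inr (π₂.apply_apply k)⟩

/-- All pairs of `ρ` other than those of `π` are inhomogeneous, and `π` consists of pairs
of `ρ`. -/
def IsHomPart (π ρ : Perm (ι ⊕ κ)) : Prop :=
  IsSub π ρ ∧ ∀ x, π x = x → ρ x ≠ x → (ρ x).isLeft ≠ x.isLeft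

theorem isHomPart_glue_iff (π : Invol (ι ⊕ κ)) (π' : Perm {x // π.1 x = x}) :
    IsHomPart π.1 (glue π.1 π') ↔ ∀ x, π' x ≠ x → (π' x).1.isLeft ≠ x.1.isLeft := by
  constructor
  · rintro ⟨_, h⟩ x hx
    have := h x x.2
    rw [glue_apply_of_eq x.2] at this
    exact this fun e => hx (Subtype.ext e)
  · intro h
    refine ⟨fun i hi => glue_apply_of_ne hi, fun x hx hne => ?_⟩
    rw [glue_apply_of_eq hx] at hne ⊢
    exact h ⟨x, hx⟩ fun e => hne (congrArg Subtype.val e)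

-- First contracting inside `α` and `β`, then between them, amounts to contracting `α ∪ β` by the
-- involutions whose homogeneous pairs are those of `π₁` and `π₂`.
open Classical in
theorem coeff_smul_sumInhom {q : ℝ} (hq : q ≠ 0) (π₁ : Invol ι) (π₂ : Invol κ)
    (α : Perm (Option ι)) (β : Perm (Option κ)) (h : ι → H) (g : κ → H) :
    ((contrCoeff q π₁.1 α h : ℂ) * (contrCoeff q π₂.1 β g : ℂ)) •
      sumInhom q (contrP π₁.1 α) (contrP π₂.1 β) (h ∘ fixEmb π₁.1) (g ∘ fixEmb π₂.1) =
    ∑ ρ : Invol (ι ⊕ κ), if IsHomPart (sumInvol π₁ π₂).1 ρ.1 then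
      C q ρ.1 (cupPerm α β) (Sum.elim h g) else 0 := by
  have hs := sum_glue (sumInvol π₁ π₂) (fun ρ => C q ρ (cupPerm α β) (Sum.elim h g))
    (IsHomPart (sumInvol π₁ π₂).1) fun ρ hρ => hρ.1
  rw [← hs, sumInhom, Finset.smul_sum]
  obtain ⟨e, he, he'⟩ := exists_equiv_fix (π := (sumInvol π₁ π₂).1)
    ((fixEmb π₁.1).sumMap (fixEmb π₂.1))
      (range_sumMap_fixEmb π₁.1 π₂.1)
  refine Fintype.sum_equiv (involCongr e) _ _ fun π' => ?_
  have happ := involCongr_apply e π'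
  have hleft : ∀ x, (e x).1.isLeft = x.isLeft := by
    intro x
    rw [he]
    cases x <;> rfl
  have hiff : IsHomPart (sumInvol π₁ π₂).1 (glue (sumInvol π₁ π₂).1 (involCongr e π').1) ↔
      Inhom π'.1 := by
    refine (isHomPart_glue_iff (sumInvol π₁ π₂) _).trans ⟨fun h x hx => ?_, fun h x hx => ?_⟩
    · have := h (e x) (by rwa [← happ, Ne, e.apply_eq_iff_eq])
      rwa [← happ, hleft, hleft] at this
    · obtain ⟨x, rfl⟩ := e.surjective x
      rw [← happ, hleft, hleft]
      exact h x fun e' => hx (by rw [← happ, e'])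
  have hC : C q (glue (sumInvol π₁ π₂).1 (involCongr e π').1) (cupPerm α β) (Sum.elim h g) =
      ((contrCoeff q π₁.1 α h : ℂ) * (contrCoeff q π₂.1 β g : ℂ)) •
        C q π'.1 (cupPerm (contrP π₁.1 α) (contrP π₂.1 β))
          (Sum.elim (h ∘ fixEmb π₁.1) (g ∘ fixEmb π₂.1)) := by
    rw [C_glue hq]
    have h1 : contrCoeff q (sumInvol π₁ π₂).1 (cupPerm α β) (Sum.elim h g) =
      contrCoeff q π₁.1 α h * contrCoeff q π₂.1 β g := contrCoeff_cupPerm hq _ _ _ _ _ _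
    rw [h1, Complex.ofReal_mul]
    congr 1
    refine C_iso q e happ (fun x => ?_) fun x => ?_
    · rw [contrP_cupPerm]
      exact he' _ x
    · change Sum.elim h g (e x).1 = _
      rw [he]
      cases x <;> rfl
  by_cases hi : Inhom π'.1
  · rw [if_pos hi]
    refine Eq.trans ?_ (if_pos (hiff.mpr hi)).symm
    exact hC.symm
  · rw [if_neg hi, smul_zero]
    exact (if_neg fun h' => hi (hiff.mp h')).symm

/-- The pairs of `ρ` inside `ι`. -/
def leftPart (ρ : Invol (ι ⊕ κ)) : Invol ι :=
  let f : ι → ι := fun i => Sum.elim id (fun _ => i) (ρ.1 (Sum.inl i))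
  have hf : ∀ i, f (f i) = i := fun i => by
    change Sum.elim id (fun _ => f i) (ρ.1 (Sum.inl (f i))) = i
    rcases h : ρ.1 (Sum.inl i) with j | k
    · have h1 : f i = j := by simp [f, h]
      have h2 := ρ.apply_apply (Sum.inl i)
      rw [h] at h2
      rw [h1, h2]
      rfl
    · have h1 : f i = i := by simp [f, h]
      rw [h1, h]
      rfl
  ⟨Function.Involutive.toPerm f hf, Perm.ext hf⟩

/-- The pairs of `ρ` inside `κ`. -/
def rightPart (ρ : Invol (ι ⊕ κ)) : Invol κ :=
  let f : κ → κ := fun k => Sum.elim (fun _ => k) id (ρ.1 (Sum.inr k))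
  have hf : ∀ k, f (f k) = k := fun k => by
    change Sum.elim (fun _ => f k) id (ρ.1 (Sum.inr (f k))) = k
    rcases h : ρ.1 (Sum.inr k) with j | j
    · have h1 : f k = k := by simp [f, h]
      rw [h1, h]
      rfl
    · have h1 : f k = j := by simp [f, h]
      have h2 := ρ.apply_apply (Sum.inr k)
      rw [h] at h2
      rw [h1, h2]
      rfl
  ⟨Function.Involutive.toPerm f hf, Perm.ext hf⟩

theorem isHomPart_iff (ρ : Invol (ι ⊕ κ)) (π₁ : Invol ι) (π₂ : Invol κ) :
    IsHomPart (sumInvol π₁ π₂).1 ρ.1 ↔ π₁ = leftPart ρ ∧ π₂ = rightPart ρ := by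
  have hl : ∀ i, (leftPart ρ).1 i = Sum.elim id (fun _ => i) (ρ.1 (Sum.inl i)) := fun i => rfl
  have hr : ∀ k, (rightPart ρ).1 k = Sum.elim (fun _ => k) id (ρ.1 (Sum.inr k)) := fun i => rfl
  constructor
  · rintro ⟨h1, h2⟩
    refine ⟨Subtype.ext (Perm.ext fun i => ?_), Subtype.ext (Perm.ext fun k => ?_)⟩
    · rw [hl]
      by_cases hi : π₁.1 i = i
      · have h3 := h2 (Sum.inl i) (congrArg Sum.inl hi)
        rcases h : ρ.1 (Sum.inl i) with j | k
        · rw [h] at h3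
          by_contra h4
          refine h3 (fun h5 => h4 ?_) rfl
          rw [hi, Sum.inl_injective h5]
          rfl
        · exact hi
      · rw [h1 (Sum.inl i) fun e => hi (Sum.inl_injective e)]
        rfl
    · rw [hr]
      by_cases hi : π₂.1 k = k
      · have h3 := h2 (Sum.inr k) (congrArg Sum.inr hi)
        rcases h : ρ.1 (Sum.inr k) with j | j
        · exact hi
        · rw [h] at h3
          by_contra h4
          refine h3 (fun h5 => h4 ?_) rfl
          rw [hi, Sum.inr_injective h5]
          rfl
      · rw [h1 (Sum.inr k) fun e => hi (Sum.inr_injective e)]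
        rfl
  · rintro ⟨rfl, rfl⟩
    refine ⟨?_, ?_⟩
    · rintro (i | k) hi
      · rcases h : ρ.1 (Sum.inl i) with j | j
        · exact congrArg Sum.inl (by rw [hl, h]; rfl)
        · exact absurd (congrArg Sum.inl (by rw [hl, h]; rfl)) hi
      · rcases h : ρ.1 (Sum.inr k) with j | j
        · exact absurd (congrArg Sum.inr (by rw [hr, h]; rfl)) hi
        · exact congrArg Sum.inr (by rw [hr, h]; rfl)
    · rintro (i | k) hi hne
      · rcases h : ρ.1 (Sum.inl i) with j | j
        · have h1 : (leftPart ρ).1 i = i := Sum.inl_injective hi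
          rw [hl, h] at h1
          rw [h] at hne
          exact absurd (congrArg Sum.inl h1) hne
        · simp
      · rcases h : ρ.1 (Sum.inr k) with j | j
        · simp
        · have h1 : (rightPart ρ).1 k = k := Sum.inr_injective hi
          rw [hr, h] at h1
          rw [h] at hne
          exact absurd (congrArg Sum.inr h1) hne

/-- Expanding the left side produces every involution of `ι ⊕ κ` exactly once, from its unique
homogeneous part. -/
theorem hprod_E_E_J {q : ℝ} (hq : q ≠ 0) (α : Perm (Option ι)) (β : Perm (Option κ)) (h : ι → H)
    (g : κ → H) :
    hprod q (E q 1 (J α h)) (E q 1 (J β g)) = E q 1 (cupT (J α h) (J β g)) := by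
  classical
  rw [cupT_J, E_J, E_J, E_J, sumC, sumC, sumC]
  simp only [one_pow, one_smul, map_sum, LinearMap.sum_apply]
  have h1 : ∀ (π₂ : Invol κ) (π₁ : Invol ι), hprod q (C q π₁.1 α h) (C q π₂.1 β g) =
      ∑ ρ : Invol (ι ⊕ κ), if IsHomPart (sumInvol π₁ π₂).1 ρ.1 then
        C q ρ.1 (cupPerm α β) (Sum.elim h g) else 0 := by
    intro π₂ π₁
    rw [← coeff_smul_sumInhom hq, C, C, map_smul, map_smul, LinearMap.smul_apply, hprod_J,
      smul_smul, mul_comm]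
  simp only [h1]
  rw [Finset.sum_congr rfl fun π₂ _ => Finset.sum_comm, Finset.sum_comm]
  refine Finset.sum_congr rfl fun ρ _ => ?_
  simp only [isHomPart_iff]
  rw [Finset.sum_eq_single (rightPart ρ)]
  · simp
  · intro π₂ _ h2
    simp [h2]
  · simp

theorem hprod_E_E {q : ℝ} (hq : q ≠ 0) (A B : TP H) :
    hprod q (E q 1 A) (E q 1 B) = E q 1 (cupT A B) := by
  induction A using TP_induction with
  | pure n α h =>
    induction B using TP_induction with
    | pure k β g => exact hprod_E_E_J hq α β h g
    | add x y hx hy => simp only [map_add, hx, hy]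
    | smul c x hx => simp only [map_smul, hx]
  | add x y hx hy => simp only [map_add, LinearMap.add_apply, hx, hy]
  | smul c x hx => simp only [map_smul, LinearMap.smul_apply, hx]

/-- This gives one formula for all `q`, without division by `q`, and makes the passage to `q = 0`
possible. -/
theorem mul_eq_hprod (q : ℝ) : mul H q = hprod q := by
  by_cases hq : q = 0
  · subst hq
    exact mul_zero_eq
  · refine LinearMap.ext₂ fun A B => ?_
    rw [mul_apply_of_ne hq, ← hprod_E_E hq, E_E_neg_one hq, E_E_neg_one hq]

end CupContraction

/-! ### The functional on products -/

section PhiProduct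

variable {H : Type*} [NormedAddCommGroup H] [InnerProductSpace ℝ H]
variable {ι κ : Type} [Fintype ι] [DecidableEq ι] [Fintype κ] [DecidableEq κ]

/-- The inhomogeneous pairing of `ι ⊕ κ` given by a bijection. -/
def pairingOf (σ : κ ≃ ι) : Invol (ι ⊕ κ) :=
  ⟨(Equiv.sumComm ι κ).trans (Equiv.sumCongr σ σ.symm), by
    ext x : 1
    cases x <;> simp⟩

theorem pairingOf_inl (σ : κ ≃ ι) (i : ι) : (pairingOf σ).1 (Sum.inl i) = Sum.inr (σ.symm i) := rfl

theorem pairingOf_inr (σ : κ ≃ ι) (k : κ) : (pairingOf σ).1 (Sum.inr k) = Sum.inl (σ k) := rfl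

theorem pairingOf_injective : Function.Injective (pairingOf : (κ ≃ ι) → Invol (ι ⊕ κ)) := by
  intro σ τ h
  ext k
  have := congrArg (fun π : Invol (ι ⊕ κ) => π.1 (Sum.inr k)) h
  exact Sum.inl_injective this

theorem inhom_pairingOf (σ : κ ≃ ι) : Inhom (pairingOf σ).1 := by
  rintro (i | k) _
  · simp [pairingOf_inl]
  · simp [pairingOf_inr]

theorem isEmpty_fix_pairingOf (σ : κ ≃ ι) : IsEmpty {x // (pairingOf σ).1 x = x} :=
  ⟨fun ⟨x, hx⟩ => by
    rcases x with i | k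
    · rw [pairingOf_inl] at hx
      simp at hx
    · rw [pairingOf_inr] at hx
      simp at hx⟩

theorem exists_pairingOf_eq (π : Invol (ι ⊕ κ)) (hπ : Inhom π.1) (hne : ∀ x, π.1 x ≠ x) :
    ∃ σ : κ ≃ ι, pairingOf σ = π := by
  have hs : ∀ k, ∃ i, π.1 (Sum.inr k) = Sum.inl i := fun k => by
    have := hπ (Sum.inr k) (hne _)
    rcases h : π.1 (Sum.inr k) with i | j
    · exact ⟨i, rfl⟩
    · simp [h] at this
  have ht : ∀ i, ∃ k, π.1 (Sum.inl i) = Sum.inr k := fun i => by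
    have := hπ (Sum.inl i) (hne _)
    rcases h : π.1 (Sum.inl i) with i | j
    · simp [h] at this
    · exact ⟨j, rfl⟩
  choose s hs using hs
  choose t ht using ht
  have hst : ∀ k, t (s k) = k := fun k => by
    have := π.apply_apply (Sum.inr k)
    rw [hs, ht] at this
    exact Sum.inr_injective this
  have hts : ∀ i, s (t i) = i := fun i => by
    have := π.apply_apply (Sum.inl i)
    rw [ht, hs] at this
    exact Sum.inl_injective this
  refine ⟨⟨s, t, hst, hts⟩, Subtype.ext (Perm.ext ?_)⟩
  rintro (i | k)
  · exact (ht i).symm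
  · exact (hs k).symm

/-- The pairs of `pairingOf σ`, indexed by `ι`. -/
def pairEmb (σ : κ ≃ ι) : ι ↪ Sym2 (ι ⊕ κ) :=
  ⟨fun i => s(Sum.inl i, Sum.inr (σ.symm i)), fun i j h => by
    rcases Sym2.eq_iff.mp h with ⟨h, _⟩ | ⟨h, _⟩
    · exact Sum.inl_injective h
    · cases h⟩

theorem pairs_pairingOf (σ : κ ≃ ι) : pairs (pairingOf σ).1 = Finset.univ.map (pairEmb σ) := by
  ext z
  simp only [mem_pairs, Finset.mem_map, Finset.mem_univ, true_and]
  constructor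
  · rintro ⟨i | k, _, rfl⟩
    · exact ⟨i, rfl⟩
    · refine ⟨σ k, ?_⟩
      change s(Sum.inl (σ k), Sum.inr (σ.symm (σ k))) = _
      rw [pairingOf_inr, symm_apply_apply, Sym2.eq_swap]
  · rintro ⟨i, rfl⟩
    exact ⟨Sum.inl i, by simp [pairingOf_inl], rfl⟩

theorem card_pairs_pairingOf (σ : κ ≃ ι) : (pairs (pairingOf σ).1).card = Nat.card ι := by
  rw [pairs_pairingOf, Finset.card_map, Finset.card_univ, Nat.card_eq_fintype_card]

theorem pairProd_pairingOf (σ : κ ≃ ι) (h : ι → H) (g : κ → H) :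
    pairProd (pairingOf σ).1 (Sum.elim h g) = ∏ i, inner ℝ (h i) (g (σ.symm i)) := by
  rw [pairProd, pairs_pairingOf, Finset.prod_map]
  rfl

/-- Moving the pairing past `β` turns `β` on the right into `σ β σ⁻¹` on the left. What remains is
the left permutation `α σ β σ⁻¹` times the pairing. This only inserts, after each left point, its
partner on the right, so the number of cycles is the same. -/
theorem numCycles_pairingOf_mul (σ : κ ≃ ι) (α : Perm (Option ι)) (β : Perm (Option κ)) :
    numCycles (optionCongr (pairingOf σ).1 * cupPerm α β) =
      numCycles (α * (optionCongr σ).permCongr β) := by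
  set L := (Function.Embedding.inl : ι ↪ ι ⊕ κ).optionMap
  set δ := (optionCongr σ).permCongr β
  have h1 : optionCongr (pairingOf σ).1 *
      β.viaEmbedding (Function.Embedding.inr : κ ↪ ι ⊕ κ).optionMap =
        δ.viaEmbedding L * optionCongr (pairingOf σ).1 := by
    ext x : 1
    rw [Perm.mul_apply, Perm.mul_apply]
    rcases x with _ | i | k
    · have e1 := viaEmbedding_inr (ι := ι) β none
      have e2 := viaEmbedding_inl (κ := κ) δ none
      refine (congrArg _ e1).trans (Eq.trans ?_ e2.symm)
      change _ = ((optionCongr σ) (β none)).map Sum.inl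
      cases β none <;> rfl
    · rw [viaEmbedding_inr_inl]
      exact (viaEmbedding_inl_inr δ (σ.symm i)).symm
    · have e1 := viaEmbedding_inr (ι := ι) β (some k)
      have e2 := viaEmbedding_inl (κ := κ) δ (some (σ k))
      refine (congrArg _ e1).trans (Eq.trans ?_ e2.symm)
      have e3 : δ (some (σ k)) = optionCongr σ (β (some k)) := by
        change optionCongr σ (β ((optionCongr σ).symm (optionCongr σ (some k)))) = _
        rw [symm_apply_apply]
      rw [e3]
      cases β (some k) <;> rfl
  have h2 : α.viaEmbedding L * δ.viaEmbedding L = (α * δ).viaEmbedding L :=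
    ((Perm.viaEmbeddingHom L).map_mul α δ).symm
  have h3 : cupPerm α β =
    β.viaEmbedding (Function.Embedding.inr : κ ↪ ι ⊕ κ).optionMap * α.viaEmbedding L := rfl
  rw [h3, ← mul_assoc, h1, numCycles_mul_comm, ← mul_assoc, h2]
  generalize α * δ = ε
  -- An invariant function takes the same value at a left point and at its partner, so it is
  -- determined by its values on `Option ι`.
  refine numCycles_eq_of_equiv
    { toFun := fun f => ⟨fun x => f.1 (x.map Sum.inl), fun x => ?_, fun x hx => (hx trivial).elim⟩
      invFun := fun u => ⟨fun x => x.elim (u.1 none) (Sum.elim (fun i => u.1 (some i))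
        fun k => u.1 (some (σ k))), fun x => ?_, fun x hx => (hx trivial).elim⟩
      left_inv := fun f => ?_
      right_inv := fun u => ?_ }
  · change f.1 ((ε x).map Sum.inl) = f.1 (x.map Sum.inl)
    rw [← viaEmbedding_inl (κ := κ)]
    rcases x with _ | i
    · exact f.2.1 none
    · have h3 := f.2.1 (some (Sum.inr (σ.symm i)))
      have h4 := f.2.1 (some (Sum.inl i))
      have h5 : (ε.viaEmbedding L * optionCongr (pairingOf σ).1) (some (Sum.inl i)) =
        some (Sum.inr (σ.symm i)) := viaEmbedding_inl_inr ε _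
      have h6 : (ε.viaEmbedding L * optionCongr (pairingOf σ).1) (some (Sum.inr (σ.symm i))) =
          ε.viaEmbedding L (some (Sum.inl i)) := by
        change ε.viaEmbedding L (some (Sum.inl (σ (σ.symm i)))) = _
        rw [apply_symm_apply]
      rw [h5] at h4
      rw [h6, h4] at h3
      exact h3
  · have hL : ∀ x : Option ι, (x.map Sum.inl).elim (u.1 none) (Sum.elim (fun i => u.1 (some i))
        fun k => u.1 (some (σ k))) = u.1 x := by rintro (_ | i) <;> rfl
    rcases x with _ | i | k
    · have e : (ε.viaEmbedding L * optionCongr (pairingOf σ).1) none = (ε none).map Sum.inl :=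
        viaEmbedding_inl ε none
      simp only [e, hL, u.2.1]
      rfl
    · have e : (ε.viaEmbedding L * optionCongr (pairingOf σ).1) (some (Sum.inl i)) =
        some (Sum.inr (σ.symm i)) := viaEmbedding_inl_inr ε _
      simp [e]
    · have e : (ε.viaEmbedding L * optionCongr (pairingOf σ).1) (some (Sum.inr k)) =
        (ε (some (σ k))).map Sum.inl := viaEmbedding_inl ε (some (σ k))
      simp only [e, hL, u.2.1]
      rfl
  · ext x
    rcases x with _ | i | k
    · rfl
    · rfl
    · have h4 := f.2.1 (some (Sum.inl (σ k)))
      have h5 : (ε.viaEmbedding L * optionCongr (pairingOf σ).1) (some (Sum.inl (σ k))) =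
          some (Sum.inr k) := by
        refine (viaEmbedding_inl_inr ε (σ.symm (σ k))).trans ?_
        rw [symm_apply_apply]
      rw [h5] at h4
      exact congrArg Fin.val h4.symm
  · ext x
    cases x <;> rfl

theorem numCycles_le (α : Perm (Option ι)) : numCycles α ≤ Nat.card ι + 1 := by
  have := Nat.card_le_card_of_surjective _ (Quotient.mk_surjective (s := Perm.SameCycle.setoid α))
  rwa [Finite.card_option] at this

theorem phi_C (q : ℝ) (π : Perm ι) (α : Perm (Option ι)) (h : ι → H) :
    phi H (C q π α h) = if Nat.card {i // π i = i} = 0 then (contrCoeff q π α h : ℂ) else 0 := by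
  rw [C, map_smul, phi_J, smul_eq_mul, mul_ite, mul_one, mul_zero]

theorem contrExp_of_isEmpty (π : Perm ι) (α : Perm (Option ι)) (hπ : IsEmpty {i // π i = i}) :
    contrExp π α = 1 + (pairs π).card - numCycles (optionCongr π * α) := by
  have h1 := numCycles_le (contrP π α)
  have h2 := numCycles_pos (contrP π α)
  rw [Nat.card_of_isEmpty] at h1
  rw [contrExp]
  omega

/-- `φ` kills every contraction with a singleton left. The surviving inhomogeneous partitions are
perfect matchings between `ι` and `κ`, hence bijections. -/
theorem phi_hprod_J (q : ℝ) (α : Perm (Option ι)) (h : ι → H) (β : Perm (Option κ)) (g : κ → H) :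
    phi H (hprod q (J α h) (J β g)) = (pairing q α h β g : ℝ) := by
  classical
  rw [hprod_J, sumInhom, map_sum, pairing, Complex.ofReal_sum]
  refine (Fintype.sum_of_injective pairingOf pairingOf_injective _ _ (fun π hπ => ?_)
    fun σ => ?_).symm
  · by_cases hi : Inhom π.1
    · rw [if_pos hi, phi_C]
      refine if_neg fun h0 => hπ ?_
      refine exists_pairingOf_eq π hi fun x hx => ?_
      have : Nonempty {x // π.1 x = x} := ⟨⟨x, hx⟩⟩
      exact Nat.card_pos.ne' h0
    · rw [if_neg hi, map_zero]
  · have he := isEmpty_fix_pairingOf σ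
    rw [if_pos (inhom_pairingOf σ), phi_C, if_pos (Nat.card_of_isEmpty), contrCoeff,
      pairProd_pairingOf, contrExp_of_isEmpty _ _ he, card_pairs_pairingOf,
      numCycles_pairingOf_mul]
    have h1 := numCycles_le (α * (optionCongr σ).permCongr β)
    -- There are at most `Nat.card ι + 1` cycles, so the subtraction of naturals is not truncated
    -- and the integer power is a natural power, also at `q = 0`.
    have h2 : (1 + (Nat.card ι : ℤ) - (numCycles (α * (optionCongr σ).permCongr β) : ℤ)) =
      ((Nat.card ι + 1 - numCycles (α * (optionCongr σ).permCongr β) : ℕ) : ℤ) := by omega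
    rw [h2, zpow_natCast]

theorem phi_hprod (q : ℝ) (A B : TP H) : phi H (hprod q A B) = formT q A B := by
  induction A using TP_induction with
  | pure n α h =>
    induction B using TP_induction with
    | pure k β g => rw [formT_J, phi_hprod_J]
    | add x y hx hy => simp only [map_add, hx, hy]
    | smul c x hx => simp only [map_smul, hx]
  | add x y hx hy => simp only [map_add, LinearMap.add_apply, hx, hy]
  | smul c x hx => simp only [map_smul, LinearMap.smul_apply, hx]

/-! ### The involution and the products -/

theorem optionCongr_inv (π : Invol ι) : (optionCongr π.1)⁻¹ = optionCongr π.1 := by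
  rw [inv_eq_iff_mul_eq_one]
  ext x : 1
  rcases x with _ | i
  · rfl
  · exact congrArg some (π.apply_apply i)

/-- The inverse of `π α` is `α⁻¹ π`, which `π` conjugates to `π α⁻¹` while fixing the singletons. -/
theorem contrP_inv (π : Invol ι) (α : Perm (Option ι)) : contrP π.1 α⁻¹ = (contrP π.1 α)⁻¹ := by
  rw [contrP, contrP, ← restrict_inv, mul_inv_rev, optionCongr_inv]
  rw [restrict_map (α⁻¹ * optionCongr π.1) (optionCongr π.1 * α⁻¹) (fixEmb π.1).optionMap
    (fixEmb π.1).optionMap (optionCongr π.1) (Equiv.refl _) (fun _ => rfl)]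
  · rfl
  · rintro (_ | y)
    · rfl
    · exact congrArg some y.2
  · rintro (_ | i) (_ | y) h
    · exact ⟨none, rfl⟩
    · exact ⟨none, rfl⟩
    · cases h
    · have h1 : π.1 i = y.1 := Option.some_injective _ h
      refine ⟨some ⟨i, ?_⟩, rfl⟩
      rw [← π.apply_apply i, h1, y.2]
      exact y.2

theorem contrExp_inv (π : Invol ι) (α : Perm (Option ι)) :
    contrExp π.1 α⁻¹ = contrExp π.1 α := by
  have h1 : numCycles (optionCongr π.1 * α⁻¹) = numCycles (optionCongr π.1 * α) := by
    rw [← numCycles_inv, mul_inv_rev, inv_inv, optionCongr_inv, numCycles_mul_comm]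
  rw [contrExp, contrExp, contrP_inv, numCycles_inv, h1]

/-- Inversion commutes with contractions, and the weights are real and invariant under it.
Consequently the involution defined through `T` is the same map on Hermite trace polynomials for all
`q`. -/
theorem E_starT (q : ℝ) (t : ℝ) (A : TP H) : E q t (starT A) = starT (E q t A) := by
  induction A using TP_induction with
  | pure n α h =>
    rw [starT_J, E_J, E_J, sumC, sumC, map_sum]
    refine Finset.sum_congr rfl fun π _ => ?_
    rw [C, C, contrCoeff, contrCoeff, contrExp_inv, contrP_inv, ← starT_J, map_smulₛₗ, map_smulₛₗ,
      map_pow, Complex.conj_ofReal, Complex.conj_ofReal]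
  | add x y hx hy => simp only [map_add, hx, hy]
  | smul c x hx => simp only [map_smulₛₗ, hx, RingHom.id_apply]

theorem adj_eq_starT (q : ℝ) (A : TP H) : adj H q A = starT A := by
  by_cases hq : q = 0
  · subst hq
    exact adj_zero A
  · have h1 := E_starT q (-1) A
    have h2 := E_starT q 1 (E q (-1) A)
    rw [Complex.ofReal_one] at h2
    rw [adj_of_ne hq, h2, E_E_neg_one hq]

theorem cupPerm_inv (α : Perm (Option ι)) (β : Perm (Option κ)) (x : Option (ι ⊕ κ)) :
    optionCongr (Equiv.sumComm ι κ) ((cupPerm α β)⁻¹ x) =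
      cupPerm β⁻¹ α⁻¹ (optionCongr (Equiv.sumComm ι κ) x) := by
  have h1 : (optionCongr (Equiv.sumComm ι κ)).permCongr (cupPerm α β)⁻¹ = cupPerm β⁻¹ α⁻¹ := by
    have hα : (α.viaEmbedding (Function.Embedding.inl : ι ↪ ι ⊕ κ).optionMap)⁻¹ =
      α⁻¹.viaEmbedding _ := ((Perm.viaEmbeddingHom _).map_inv α).symm
    have hβ : (β.viaEmbedding (Function.Embedding.inr : κ ↪ ι ⊕ κ).optionMap)⁻¹ =
      β⁻¹.viaEmbedding _ := ((Perm.viaEmbeddingHom _).map_inv β).symm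
    rw [cupPerm, mul_inv_rev, hα, hβ, permCongr_mul, viaEmbedding_comp, viaEmbedding_comp, cupPerm]
    congr 2
    · ext1 x; cases x <;> rfl
    · ext1 x; cases x <;> rfl
  rw [← h1, permCongr_apply, symm_apply_apply]

theorem starT_cupT (A B : TP H) : starT (cupT A B) = cupT (starT B) (starT A) := by
  induction A using TP_induction with
  | pure n α h =>
    induction B using TP_induction with
    | pure k β g =>
      rw [cupT_J, starT_J, starT_J, starT_J, cupT_J]
      refine J_iso (Equiv.sumComm _ _) (cupPerm_inv α β) ?_
      rintro (i | i) <;> rfl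
    | add x y hx hy => simp only [map_add, LinearMap.add_apply, hx, hy]
    | smul c x hx => simp only [map_smulₛₗ, LinearMap.smul_apply, hx, RingHom.id_apply]
  | add x y hx hy => simp only [map_add, LinearMap.add_apply, hx, hy]
  | smul c x hx => simp only [map_smulₛₗ, LinearMap.smul_apply, hx, RingHom.id_apply]

theorem viaEmbedding_trans {X Y Z : Type} (α : Perm X) (f : X ↪ Y) (g : Y ↪ Z) :
    (α.viaEmbedding f).viaEmbedding g = α.viaEmbedding (f.trans g) := by
  refine eq_viaEmbedding _ _ _ (fun x => ?_) fun z hz => ?_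
  · rw [Function.Embedding.trans_apply, Perm.viaEmbedding_apply, Perm.viaEmbedding_apply]
    rfl
  · by_cases h : z ∈ Set.range g
    · obtain ⟨y, rfl⟩ := h
      rw [Perm.viaEmbedding_apply, Perm.viaEmbedding_apply_of_notMem]
      rintro ⟨x, rfl⟩
      exact hz ⟨x, rfl⟩
    · rw [Perm.viaEmbedding_apply_of_notMem _ _ _ h]

theorem viaEmbedding_mul {X Y : Type} (α β : Perm X) (f : X ↪ Y) :
    (α * β).viaEmbedding f = α.viaEmbedding f * β.viaEmbedding f :=
  (Perm.viaEmbeddingHom f).map_mul α β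

theorem cupPerm_assoc {μ : Type} (α : Perm (Option ι)) (β : Perm (Option κ))
    (γ : Perm (Option μ)) (x) :
    optionCongr (Equiv.sumAssoc ι κ μ) (cupPerm (cupPerm α β) γ x) =
      cupPerm α (cupPerm β γ) (optionCongr (Equiv.sumAssoc ι κ μ) x) := by
  have h1 : (optionCongr (Equiv.sumAssoc ι κ μ)).permCongr (cupPerm (cupPerm α β) γ) =
      cupPerm α (cupPerm β γ) := by
    simp only [cupPerm, viaEmbedding_mul, viaEmbedding_trans, permCongr_mul, viaEmbedding_comp,
      mul_assoc]
    congr 1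
    · congr 1
      ext1 x; cases x <;> rfl
    · congr 1
      · congr 1
        ext1 x; cases x <;> rfl
      · congr 1
        ext1 x; cases x <;> rfl
  rw [← h1, permCongr_apply, symm_apply_apply]

theorem cupT_assoc (A B D : TP H) : cupT (cupT A B) D = cupT A (cupT B D) := by
  induction A using TP_induction with
  | pure n α h =>
    induction B using TP_induction with
    | pure k β g =>
      induction D using TP_induction with
      | pure m γ f =>
        rw [cupT_J, cupT_J, cupT_J, cupT_J]
        refine J_iso (Equiv.sumAssoc _ _ _) (cupPerm_assoc α β γ) ?_
        rintro ((i | i) | i) <;> rfl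
      | add x y hx hy => simp only [map_add, hx, hy]
      | smul c x hx => simp only [map_smul, hx]
    | add x y hx hy => simp only [map_add, LinearMap.add_apply, hx, hy]
    | smul c x hx => simp only [map_smul, LinearMap.smul_apply, hx]
  | add x y hx hy => simp only [map_add, LinearMap.add_apply, hx, hy]
  | smul c x hx => simp only [map_smul, LinearMap.smul_apply, hx]

theorem hprod_assoc {q : ℝ} (hq : q ≠ 0) (A B D : TP H) :
    hprod q (hprod q A B) D = hprod q A (hprod q B D) := by
  simp only [← mul_eq_hprod, mul_apply_of_ne hq, E_neg_one_E hq, cupT_assoc]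

theorem starT_hprod {q : ℝ} (hq : q ≠ 0) (A B : TP H) :
    starT (hprod q A B) = hprod q (starT B) (starT A) := by
  have h1 : ∀ A : TP H, E q (-1) (starT A) = starT (E q (-1) A) := fun A => by
    have := E_starT q (-1) A
    rwa [Complex.ofReal_neg, Complex.ofReal_one] at this
  have h2 : ∀ A : TP H, E q 1 (starT A) = starT (E q 1 A) := fun A => by
    have := E_starT q 1 A
    rwa [Complex.ofReal_one] at this
  simp only [← mul_eq_hprod, mul_apply_of_ne hq, h1, ← starT_cupT, h2]

theorem formT_hprod_of_ne {q : ℝ} (hq : q ≠ 0) (A B D : TP H) :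
    formT q (hprod q A B) D = formT q A (hprod q B D) := by
  rw [← phi_hprod, hprod_assoc hq, phi_hprod]

/-! ### Continuity in `q` -/

/-- The exponent is the number of pairs minus the number of cycles of `π (α ∪ β)` inside the support
of `π`. Each such cycle contains a paired point of `ι`, and each mixed pair has only one. -/
theorem contrExp_nonneg (π : Invol (ι ⊕ κ)) (hπ : Inhom π.1) (α : Perm (Option ι))
    (β : Perm (Option κ)) : 0 ≤ contrExp π.1 (cupPerm α β) := by
  classical
  have h1 := numCycles_eq_restrict_add (optionCongr π.1 * cupPerm α β) (fixEmb π.1).optionMap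
  have h2 : Nat.card {i : ι // π.1 (Sum.inl i) ≠ Sum.inl i} ≤ (pairs π.1).card := by
    rw [← Fintype.card_coe, ← Nat.card_eq_fintype_card]
    refine Nat.card_le_card_of_injective
      (fun i => ⟨s(Sum.inl i.1, π.1 (Sum.inl i.1)), mem_pairs.mpr ⟨_, i.2, rfl⟩⟩) fun i j hij => ?_
    rcases Sym2.eq_iff.mp (congrArg Subtype.val hij) with ⟨h, _⟩ | ⟨h, _⟩
    · exact Subtype.ext (Sum.inl_injective h)
    · have := hπ _ j.2
      rw [← h] at this
      simp at this
  have h3 : numCyclesIn (optionCongr π.1 * cupPerm α β) (Set.range (fixEmb π.1).optionMap)ᶜ ≤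
      Nat.card {i : ι // π.1 (Sum.inl i) ≠ Sum.inl i} := by
    rw [← Nat.pow_le_pow_iff_right (a := 2) one_lt_two]
    have h4 := card_invFun (optionCongr π.1 * cupPerm α β) (Set.range (fixEmb π.1).optionMap)ᶜ
      (Fin 2)
    rw [Nat.card_fin] at h4
    rw [← h4]
    have h5 : Nat.card ({i : ι // π.1 (Sum.inl i) ≠ Sum.inl i} → Fin 2) =
        2 ^ Nat.card {i : ι // π.1 (Sum.inl i) ≠ Sum.inl i} := by rw [Nat.card_fun, Nat.card_fin]
    rw [← h5]
    -- It suffices that an invariant function vanishing off the support is determined by its values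
    -- at the paired points of `ι`.
    refine Nat.card_le_card_of_injective (fun f i => f.1 (some (Sum.inl i.1)))
      fun f f' hf => ?_
    have hfix : ∀ x, π.1 x = x → f.1 (some x) = f'.1 (some x) := fun x hx => by
      rw [f.2.2, f'.2.2] <;> exact fun h => h ⟨some ⟨x, hx⟩, rfl⟩
    have hnone : f.1 none = f'.1 none := by
      rw [f.2.2, f'.2.2] <;> exact fun h => h ⟨none, rfl⟩
    have hl : ∀ i, f.1 (some (Sum.inl i)) = f'.1 (some (Sum.inl i)) := fun i => by
      by_cases hi : π.1 (Sum.inl i) = Sum.inl i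
      · exact hfix _ hi
      · exact congrFun hf ⟨i, hi⟩
    refine Subtype.ext (funext fun x => ?_)
    rcases x with _ | i | k
    · exact hnone
    · exact hl i
    -- From a point of `κ`, the union leads to `0` or stays in `κ`, and `π` then either fixes the
    -- result or moves it into `ι`, where the values are already known.
    · rw [← f.2.1, ← f'.2.1, Perm.mul_apply, cupPerm_inr]
      rcases β (some k) with _ | k'
      · exact hnone
      · change f.1 (some (π.1 (Sum.inr k'))) = f'.1 (some (π.1 (Sum.inr k')))
        by_cases hk : π.1 (Sum.inr k') = Sum.inr k'
        · rw [hk]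
          exact hfix _ hk
        · have := hπ _ hk
          rcases hx : π.1 (Sum.inr k') with i | j
          · exact hl i
          · simp [hx] at this
  have h4 : numCycles (contrP π.1 (cupPerm α β)) = numCycles (restrict (optionCongr π.1 *
    cupPerm α β) (fixEmb π.1).optionMap) := rfl
  rw [contrExp]
  omega

theorem continuous_pairing (α : Perm (Option ι)) (h : ι → H) (β : Perm (Option κ)) (g : κ → H) :
    Continuous fun q => pairing q α h β g :=
  continuous_finsetSum _ fun _ _ => (continuous_pow _).mul continuous_const

theorem continuous_formT_hprod (A B D : TP H) :
    Continuous fun q => formT q (hprod q A B) D := by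
  classical
  induction A using TP_induction with
  | pure n α h =>
    induction B using TP_induction with
    | pure k β g =>
      induction D using TP_induction with
      | pure m γ f =>
        have h1 : (fun q : ℝ => formT q (hprod q (J α h) (J β g)) (J γ f)) = fun q : ℝ =>
            ∑ π : Invol (Fin n ⊕ Fin k), if Inhom π.1 then
              ((q ^ (contrExp π.1 (cupPerm α β)).toNat * pairProd π.1 (Sum.elim h g) *
                pairing q (contrP π.1 (cupPerm α β)) (Sum.elim h g ∘ fixEmb π.1) γ f : ℝ) : ℂ)
              else 0 := by
          funext q
          rw [hprod_J, sumInhom, map_sum, LinearMap.sum_apply]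
          refine Finset.sum_congr rfl fun π _ => ?_
          by_cases hi : Inhom π.1
          · rw [if_pos hi, if_pos hi, C, map_smul, LinearMap.smul_apply, formT_J, smul_eq_mul,
              ← Complex.ofReal_mul, contrCoeff, ← zpow_natCast,
              Int.toNat_of_nonneg (contrExp_nonneg π hi α β)]
          · rw [if_neg hi, if_neg hi, map_zero, LinearMap.zero_apply]
        rw [h1]
        refine continuous_finsetSum _ fun π _ => ?_
        split_ifs
        · exact Complex.continuous_ofReal.comp
            (((continuous_pow _).mul continuous_const).mul (continuous_pairing _ _ _ _))
        · exact continuous_const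
      | add x y hx hy => simp only [map_add]; exact hx.add hy
      | smul c x hx => simp only [map_smul]; exact hx.const_smul c
    | add x y hx hy => simp only [map_add, LinearMap.add_apply]; exact hx.add hy
    | smul c x hx => simp only [map_smul, LinearMap.smul_apply]; exact hx.const_smul c
  | add x y hx hy => simp only [map_add, LinearMap.add_apply]; exact hx.add hy
  | smul c x hx => simp only [map_smul, LinearMap.smul_apply]; exact hx.const_smul c

theorem eq_of_continuous_of_ne_zero {f g : ℝ → ℂ} (hf : Continuous f) (hg : Continuous g)
    (h : ∀ q, q ≠ 0 → f q = g q) (q : ℝ) : f q = g q := by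
  have hd : Dense ({0}ᶜ : Set ℝ) := dense_compl_singleton 0
  exact congrFun (hf.ext_on hd hg fun q hq => h q hq) q

/-- After pairing, associativity is an identity between continuous functions of `q`, so it extends
from `q ≠ 0` to `q = 0`. -/
theorem formT_hprod (q : ℝ) (A B D : TP H) :
    formT q (hprod q A B) D = formT q A (hprod q B D) := by
  simp only [formT_comm q A]
  exact eq_of_continuous_of_ne_zero (continuous_formT_hprod A B D) (continuous_formT_hprod B D A)
    (fun q hq => by rw [formT_hprod_of_ne hq, formT_comm]) q

/-- Anti-multiplicativity of `*`, tested against `D`; again a scalar identity that passes to the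
limit `q → 0`. -/
theorem formT_starT_hprod (q : ℝ) (A B D : TP H) :
    formT q (starT (hprod q A B)) D = formT q (hprod q (starT B) (starT A)) D := by
  have h1 : ∀ q, formT q (starT (hprod q A B)) D =
      starRingEnd ℂ (formT q (hprod q A B) (starT D)) := fun q => by
    rw [← formT_star, starT_starT]
  simp only [h1]
  exact eq_of_continuous_of_ne_zero
    (Complex.continuous_conj.comp (continuous_formT_hprod A B (starT D)))
    (continuous_formT_hprod _ _ D) (fun q hq => by rw [← starT_hprod hq, h1]; rfl) q

theorem formT_starT_left (q : ℝ) (A B : TP H) :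
    formT q (starT A) B = starRingEnd ℂ (formT q A (starT B)) := by
  rw [← formT_star, starT_starT]

end PhiProduct

/-! ### The number of cycles and the sign -/

section Sign

variable {X : Type} [Finite X]

/-- The transposition inserts the fixed point `y` into the cycle of `x`. An invariant function
thereby loses its free value at `y`, which is the factor `Fin 2` below. -/
theorem numCycles_swap_mul [DecidableEq X] {α : Perm X} {x y : X} (hy : α y = y) (hxy : x ≠ y) :
    numCycles α = numCycles (swap x y * α) + 1 := by
  have hz : ∀ z, z ≠ y → α z ≠ y := fun z hz h => hz (α.injective (h.trans hy.symm))
  have hswap : ∀ f : X → Fin 2, f x = f y → ∀ z, f (swap x y z) = f z := by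
    intro f hf z
    rw [swap_apply_def]
    split_ifs with h1 h2
    · rw [h1, hf]
    · rw [h2, hf]
    · rfl
  have hinv : ∀ f : X → Fin 2, (∀ z, f ((swap x y * α) z) = f z) → f x = f y := by
    intro f hf
    have := hf y
    rwa [Perm.mul_apply, hy, swap_apply_right] at this
  have e : InvFun α Set.univ (Fin 2) ≃ InvFun (swap x y * α) Set.univ (Fin 2) × Fin 2 :=
    { toFun := fun f => (⟨Function.update f.1 y (f.1 x), fun z => by
          rw [Perm.mul_apply, hswap (Function.update f.1 y (f.1 x)) (by simp [hxy])]
          by_cases h : z = y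
          · rw [h, hy]
          · rw [Function.update_of_ne h, Function.update_of_ne (hz z h), f.2.1], by simp⟩, f.1 y)
      invFun := fun g => ⟨Function.update g.1.1 y g.2, fun z => by
          by_cases h : z = y
          · rw [h, hy]
          · rw [Function.update_of_ne h, Function.update_of_ne (hz z h), ← g.1.2.1 z,
              Perm.mul_apply, hswap _ (hinv _ g.1.2.1)], by simp⟩
      left_inv := fun f => by ext; simp
      right_inv := fun g => by
        refine Prod.ext (Subtype.ext ?_) (by simp)
        simp [hxy, hinv _ g.1.2.1] }
  have h := Nat.card_congr e
  rw [Nat.card_prod, card_invFun, card_invFun, Nat.card_fin, ← pow_succ,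
    ← numCycles_eq_numCyclesIn_univ, ← numCycles_eq_numCyclesIn_univ] at h
  exact Nat.pow_right_injective le_rfl h

theorem numCycles_one : numCycles (1 : Perm X) = Nat.card X := by
  refine Nat.card_congr (Equiv.ofBijective (Quotient.mk _) ⟨fun x y h => ?_,
    Quotient.mk_surjective⟩).symm
  exact Perm.sameCycle_one.mp (Quotient.exact h)

theorem exists_numCycles_add [Fintype X] [DecidableEq X] (α : Perm X) :
    ∃ m, numCycles α + m = Nat.card X ∧ (Perm.sign α : ℤ) = (-1) ^ m ∧ (m = 0 → α = 1) := by
  induction hs : α.support.card using Nat.strong_induction_on generalizing α with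
  | _ s ih =>
    by_cases h1 : α = 1
    · exact ⟨0, by simp [h1, numCycles_one], by simp [h1], fun _ => h1⟩
    obtain ⟨x, hx⟩ : ∃ x, α x ≠ x := by
      by_contra! h
      exact h1 (Perm.ext h)
    -- This transposition turns `x` into a fixed point, so it shrinks the support, adds one cycle
    -- and changes the sign.
    obtain ⟨m, hm, hsign, -⟩ := ih _ (hs ▸ Perm.card_support_swap_mul hx) (swap x (α x) * α) rfl
    have hn : numCycles (swap x (α x) * α) = numCycles α + 1 := by
      rw [numCycles_swap_mul (x := α x) (y := x) (by simp) hx, swap_comm, swap_mul_self_mul]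
    refine ⟨m + 1, by omega, ?_, by simp⟩
    rw [Perm.sign_mul, Perm.sign_swap hx.symm] at hsign
    push_cast at hsign
    rw [pow_succ, ← hsign]
    ring

theorem eq_one_of_numCycles {α : Perm X} (h : numCycles α = Nat.card X) : α = 1 := by
  classical
  have := Fintype.ofFinite X
  obtain ⟨m, hm, -, h1⟩ := exists_numCycles_add α
  exact h1 (by omega)

theorem neg_one_pow_card_sub_numCycles [Fintype X] [DecidableEq X] (α : Perm X) :
    (-1 : ℝ) ^ (Nat.card X - numCycles α) = ((Perm.sign α : ℤ) : ℝ) := by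
  obtain ⟨m, hm, hs, -⟩ := exists_numCycles_add α
  rw [hs, ← hm, Nat.add_sub_cancel_left]
  push_cast
  rfl

end Sign

/-! ### Gram kernels -/

section Gram

variable {P P' : Type*}

/-- Kernels that are Gram matrices of families of vectors in a finite-dimensional space. -/
def IsGram (K : P → P → ℝ) : Prop :=
  ∃ (κ : Type) (_ : Fintype κ) (B : κ → P → ℝ), ∀ p p', K p p' = ∑ k, B k p * B k p'

theorem IsGram.comp {K : P → P → ℝ} (hK : IsGram K) (f : P' → P) :
    IsGram fun p p' => K (f p) (f p') := by
  obtain ⟨κ, _, B, hB⟩ := hK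
  exact ⟨κ, _, fun k p => B k (f p), fun _ _ => hB _ _⟩

/-- The Schur product theorem: tensor the two families of vectors. -/
theorem IsGram.mul {K L : P → P → ℝ} (hK : IsGram K) (hL : IsGram L) :
    IsGram fun p p' => K p p' * L p p' := by
  obtain ⟨κ, _, B, hB⟩ := hK
  obtain ⟨μ, _, C, hC⟩ := hL
  refine ⟨κ × μ, inferInstance, fun k p => B k.1 p * C k.2 p, fun p p' => ?_⟩
  beta_reduce
  rw [hB, hC, Finset.sum_mul_sum, Fintype.sum_prod_type]
  exact Finset.sum_congr rfl fun _ _ => Finset.sum_congr rfl fun _ _ => by ring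

theorem isGram_mul_self (f : P → ℝ) : IsGram fun p p' => f p * f p' :=
  ⟨Unit, inferInstance, fun _ => f, fun _ _ => by simp⟩

theorem isGram_const {c : ℝ} (hc : 0 ≤ c) : IsGram fun _ _ : P => c := by
  have := isGram_mul_self fun _ : P => √c
  simpa [Real.mul_self_sqrt hc] using this

theorem IsGram.prod {ι : Type*} {K : ι → P → P → ℝ} (s : Finset ι) (hK : ∀ i, IsGram (K i)) :
    IsGram fun p p' => ∏ i ∈ s, K i p p' := by
  classical
  induction s using Finset.induction_on with
  | empty => simpa using isGram_const zero_le_one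
  | insert i s hi ih =>
    simp only [Finset.prod_insert hi]
    exact (hK i).mul ih

theorem isGram_inner {H : Type*} [NormedAddCommGroup H] [InnerProductSpace ℝ H] [Finite P]
    (v : P → H) : IsGram fun p p' => (inner ℝ (v p) (v p') : ℝ) := by
  have hv : ∀ p, v p ∈ Submodule.span ℝ (Set.range v) :=
    fun p => Submodule.subset_span ⟨p, rfl⟩
  have : FiniteDimensional ℝ (Submodule.span ℝ (Set.range v)) :=
    FiniteDimensional.span_of_finite ℝ (Set.finite_range v)
  let b := stdOrthonormalBasis ℝ (Submodule.span ℝ (Set.range v))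
  refine ⟨_, inferInstance, fun k p => inner ℝ (b k) ⟨v p, hv p⟩, fun p p' => ?_⟩
  have := b.sum_inner_mul_inner ⟨v p, hv p⟩ ⟨v p', hv p'⟩
  rw [Submodule.coe_inner] at this
  beta_reduce
  rw [← this]
  exact Finset.sum_congr rfl fun k _ => by rw [real_inner_comm]

theorem IsGram.nonneg [Fintype P] {K : P → P → ℝ} (hK : IsGram K) (c : P → ℂ) :
    0 ≤ ∑ p, ∑ p', c p * starRingEnd ℂ (c p') * (K p p' : ℂ) := by
  obtain ⟨κ, _, B, hB⟩ := hK
  have : ∑ p, ∑ p', c p * starRingEnd ℂ (c p') * (K p p' : ℂ) =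
      ∑ k, (∑ p, B k p * c p) * starRingEnd ℂ (∑ p, B k p * c p) := by
    have h1 : ∀ k, (∑ p, (B k p : ℂ) * c p) * starRingEnd ℂ (∑ p, B k p * c p) =
        ∑ p, ∑ p', c p * starRingEnd ℂ (c p') * (B k p * B k p' : ℂ) := fun k => by
      rw [map_sum, Finset.sum_mul_sum]
      refine Finset.sum_congr rfl fun p _ => Finset.sum_congr rfl fun p' _ => ?_
      rw [map_mul, Complex.conj_ofReal]
      ring
    simp only [h1, hB, Complex.ofReal_sum, Complex.ofReal_mul, Finset.mul_sum]
    rw [Finset.sum_comm]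
    refine (Finset.sum_congr rfl fun p' _ => Finset.sum_comm).trans ?_
    rw [Finset.sum_comm]
    exact Finset.sum_congr rfl fun k _ => Finset.sum_comm
  rw [this]
  refine Finset.sum_nonneg fun k _ => ?_
  rw [Complex.mul_conj]
  exact_mod_cast Complex.normSq_nonneg _

/-- The kernel counts the colourings invariant under `a b⁻¹`, equivalently those with `f ∘ a = f ∘
b`. The vector of `a` is the graph of `f ↦ f ∘ a`, that is, its permutation matrix on colourings. -/
theorem isGram_pow_numCycles {X : Type} [Finite X] {N : ℕ} (hN : 1 ≤ N) :
    IsGram fun a b : Perm X => (N : ℝ) ^ numCycles (a * b⁻¹) := by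
  classical
  have := Fintype.ofFinite X
  have : NeZero N := ⟨by omega⟩
  refine ⟨(X → Fin N) × (X → Fin N), inferInstance,
    fun k a => if k.1 ∘ a = k.2 then 1 else 0, fun a b => ?_⟩
  have h := card_invFun (a * b⁻¹) Set.univ (Fin N)
  rw [Nat.card_fin, ← numCycles_eq_numCyclesIn_univ] at h
  beta_reduce
  rw [← Nat.cast_pow, ← h, Fintype.sum_prod_type]
  have h2 : ∀ f : X → Fin N, ∑ g : X → Fin N,
      ((if f ∘ a = g then 1 else 0) * (if f ∘ b = g then 1 else 0) : ℝ) =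
        if f ∘ a = f ∘ b then 1 else 0 := fun f => by
    simp [eq_comm]
  simp only [h2, Finset.sum_boole]
  rw [Nat.card_eq_fintype_card, Fintype.card_subtype]
  congr 2
  ext f
  simp only [Finset.mem_filter, Finset.mem_univ, true_and, Set.mem_univ, not_true_eq_false,
    false_imp_iff, imp_true_iff, and_true, funext_iff, Function.comp_apply, Perm.mul_apply]
  exact ⟨fun h x => by simpa using h (b x), fun h x => by simpa using h (b⁻¹ x)⟩

theorem numCycles_le_card {X : Type} [Finite X] (α : Perm X) : numCycles α ≤ Nat.card X := by
  classical
  have := Fintype.ofFinite X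
  obtain ⟨m, hm, -⟩ := exists_numCycles_add α
  omega

/-- The positivity of `χ_q` for `q ∈ Z`. -/
theorem isGram_chi {q : ℝ} (hq : q ∈ Z) (X : Type) [Finite X] :
    IsGram fun a b : Perm X => q ^ (Nat.card X - numCycles (a * b⁻¹)) := by
  classical
  have := Fintype.ofFinite X
  have hpos : ∀ N : ℕ, 1 ≤ N →
      IsGram fun a b : Perm X => (1 / (N : ℝ)) ^ (Nat.card X - numCycles (a * b⁻¹)) := by
    intro N hN
    have hN0 : (N : ℝ) ≠ 0 := by positivity
    have := (isGram_const (P := Perm X) (c := (1 / (N : ℝ)) ^ Nat.card X) (by positivity)).mul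
      (isGram_pow_numCycles hN)
    convert this using 3 with a b
    have h := numCycles_le_card (a * b⁻¹)
    obtain ⟨d, hd⟩ := Nat.exists_eq_add_of_le h
    rw [hd, Nat.add_sub_cancel_left, pow_add, mul_right_comm, ← mul_pow, one_div_mul_cancel hN0,
      one_pow, one_mul]
  rcases hq with rfl | ⟨N, hN, rfl | rfl⟩
  -- At `q = 0` the kernel is the identity matrix: `0 ^ 0 = 1` on the diagonal, and off it the
  -- exponent is positive because only the identity has the maximal number of cycles.
  · refine ⟨Perm X, inferInstance, fun c a => if c = a then 1 else 0, fun a b => ?_⟩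
    simp only [mul_ite, mul_one, mul_zero, Finset.sum_ite_eq', Finset.mem_univ, if_true]
    have h := numCycles_le_card (a * b⁻¹)
    by_cases hab : a = b
    · simp [hab, numCycles_one]
    · rw [zero_pow, if_neg (Ne.symm hab)]
      · intro h0
        exact hab (mul_inv_eq_one.mp (eq_one_of_numCycles (by omega)))
  · exact hpos N hN
  -- The factor `(-1)^{|a b⁻¹|}` is `sign a * sign b`, a kernel of rank one.
  · have := (isGram_mul_self fun a : Perm X => ((Perm.sign a : ℤ) : ℝ)).mul (hpos N hN)
    convert this using 3 with a b
    rw [neg_pow, neg_one_pow_card_sub_numCycles]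
    simp

end Gram

/-! ### Positivity and the null space -/

section Positivity

variable {H : Type*} [NormedAddCommGroup H] [InnerProductSpace ℝ H]
variable {ι κ μ : Type} [Fintype ι] [DecidableEq ι] [Fintype κ] [DecidableEq κ] [Fintype μ]
  [DecidableEq μ]

/-- The labelling `u` of the first argument is arbitrary, so one may average over it. The expression
then treats both arguments alike. -/
theorem pairing_eq_sum (q : ℝ) (u : ι ≃ μ) (α : Perm (Option ι)) (h : ι → H) (β : Perm (Option κ))
    (g : κ → H) :
    pairing q α h β g = ∑ v : κ ≃ μ,
      q ^ (Nat.card μ + 1 -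
        numCycles ((optionCongr u).permCongr α * (optionCongr v).permCongr β)) *
      ∏ i, inner ℝ (h (u.symm i)) (g (v.symm i)) :=
  pairing_iso q u (Equiv.refl κ) (fun x => by rw [permCongr_apply, symm_apply_apply])
    (fun x => by simp)
    (fun i => by simp) fun i => by simp

theorem exists_eq_sum_J (A : TP H) :
    ∃ (S : Finset (Σ n, S0 n × (Fin n → H))) (c : (Σ n, S0 n × (Fin n → H)) → ℂ),
      A = ∑ s : S, c s • J s.1.2.1 s.1.2.2 := by
  have : A ∈ Submodule.span ℂ
      (Set.range fun s : Σ n, S0 n × (Fin n → H) => J s.2.1 s.2.2) := by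
    induction A using TP_induction with
    | pure n α h => exact Submodule.subset_span ⟨⟨n, α, h⟩, rfl⟩
    | add A B hA hB => exact Submodule.add_mem _ hA hB
    | smul c A hA => exact Submodule.smul_mem _ c hA
  obtain ⟨c, rfl⟩ := (Finsupp.mem_span_range_iff_exists_finsupp).mp this
  exact ⟨c.support, c, (Finset.sum_coe_sort c.support fun s => c s • J s.2.1 s.2.2).symm⟩

theorem formT_self_nonneg {q : ℝ} (hq : q ∈ Z) (A : TP H) : 0 ≤ formT q A (starT A) := by
  obtain ⟨S, c, rfl⟩ := exists_eq_sum_J A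
  let K : S → S → ℂ := fun s t => ((pairing q s.1.2.1 s.1.2.2 t.1.2.1⁻¹ t.1.2.2 : ℝ) : ℂ)
  have h1 : formT q (∑ s : S, c s • J s.1.2.1 s.1.2.2)
      (starT (∑ s : S, c s • J s.1.2.1 s.1.2.2)) =
      ∑ s : S, ∑ t : S, c s * starRingEnd ℂ (c t) * K s t := by
    simp only [map_sum, LinearMap.map_smulₛₗ, LinearMap.sum_apply, LinearMap.smul_apply,
      starT_J, formT_J, smul_eq_mul, K, RingHom.id_apply, Finset.mul_sum]
    rw [Finset.sum_comm]
    exact Finset.sum_congr rfl fun _ _ => Finset.sum_congr rfl fun _ _ => by ring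
  have h2 : ∀ d : ℕ, 0 ≤ ∑ s : S, ∑ t : S,
      c s * starRingEnd ℂ (c t) * (if s.1.1 = d then K s t else 0) := by
    intro d
    -- A point is a summand of degree `d` with a labelling of its indices by `Fin d`. On labelled
    -- points the kernel is `χ_q` times inner products, a Gram kernel; summing over both labellings
    -- gives `d!` times the degree `d` part of the form.
    let P := Σ s : S, Fin s.1.1 ≃ Fin d
    let a : P → Perm (Option (Fin d)) := fun p => (optionCongr p.2).permCongr p.1.1.2.1
    let f : P → Fin d → H := fun p i => p.1.1.2.2 (p.2.symm i)
    have hG := ((isGram_chi hq (Option (Fin d))).comp a).mul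
      (IsGram.prod Finset.univ fun i => isGram_inner fun p => f p i)
    have h3 := hG.nonneg fun p => c p.1
    have h4 : ∀ s t : S, ∑ u : Fin s.1.1 ≃ Fin d, ∑ v : Fin t.1.1 ≃ Fin d,
        ((q ^ (Nat.card (Option (Fin d)) - numCycles (a ⟨s, u⟩ * (a ⟨t, v⟩)⁻¹)) *
          ∏ i, inner ℝ (f ⟨s, u⟩ i) (f ⟨t, v⟩ i) : ℝ) : ℂ) =
        d.factorial * (if s.1.1 = d then K s t else 0) := by
      intro s t
      have h5 : ∀ u : Fin s.1.1 ≃ Fin d, ∑ v : Fin t.1.1 ≃ Fin d,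
          ((q ^ (Nat.card (Option (Fin d)) - numCycles (a ⟨s, u⟩ * (a ⟨t, v⟩)⁻¹)) *
            ∏ i, inner ℝ (f ⟨s, u⟩ i) (f ⟨t, v⟩ i) : ℝ) : ℂ) = K s t := by
        intro u
        rw [← Complex.ofReal_sum]
        simp only [K]
        rw [pairing_eq_sum q u, Finite.card_option]
        rfl
      rw [Finset.sum_congr rfl fun u _ => h5 u, Finset.sum_const, Finset.card_univ, nsmul_eq_mul]
      split_ifs with hd
      · rw [Fintype.card_equiv (finCongr hd), Fintype.card_fin, hd]
      · have : IsEmpty (Fin s.1.1 ≃ Fin d) := ⟨fun u => hd (by simpa using Fintype.card_congr u)⟩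
        simp
    have h6 : ∑ s : S, ∑ t : S, c s * starRingEnd ℂ (c t) * (if s.1.1 = d then K s t else 0) =
        ((d.factorial : ℝ)⁻¹ : ℝ) * ∑ p : P, ∑ p' : P, c p.1 * starRingEnd ℂ (c p'.1) *
        ((q ^ (Nat.card (Option (Fin d)) - numCycles (a p * (a p')⁻¹)) *
          ∏ i, inner ℝ (f p i) (f p' i) : ℝ) : ℂ) := by
      have hd : (d.factorial : ℂ) ≠ 0 := by exact_mod_cast d.factorial_ne_zero
      simp only [P, Fintype.sum_sigma]
      have h7 : ∀ s : S, ∑ u : Fin s.1.1 ≃ Fin d, ∑ t : S, ∑ v : Fin t.1.1 ≃ Fin d,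
          c s * starRingEnd ℂ (c t) *
          ((q ^ (Nat.card (Option (Fin d)) - numCycles (a ⟨s, u⟩ * (a ⟨t, v⟩)⁻¹)) *
            ∏ i, inner ℝ (f ⟨s, u⟩ i) (f ⟨t, v⟩ i) : ℝ) : ℂ) =
          ∑ t : S, c s * starRingEnd ℂ (c t) *
            (d.factorial * (if s.1.1 = d then K s t else 0)) := by
        intro s
        rw [Finset.sum_comm]
        refine Finset.sum_congr rfl fun t _ => ?_
        rw [← h4]
        simp only [Finset.mul_sum]
      rw [Finset.sum_congr rfl fun s _ => h7 s]
      simp only [Finset.mul_sum]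
      refine Finset.sum_congr rfl fun s _ => Finset.sum_congr rfl fun t _ => ?_
      push_cast
      field_simp
    rw [h6]
    refine mul_nonneg ?_ h3
    rw [Complex.zero_le_real]
    positivity
  have h8 : ∑ s : S, ∑ t : S, c s * starRingEnd ℂ (c t) * K s t =
      ∑ d ∈ Finset.univ.image fun s : S => s.1.1, ∑ s : S, ∑ t : S,
        c s * starRingEnd ℂ (c t) * (if s.1.1 = d then K s t else 0) := by
    -- Each pair `(s, t)` is counted for exactly one `d`, the degree of `s`.
    refine Eq.symm (Finset.sum_comm.trans (Finset.sum_congr rfl fun s _ => ?_))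
    refine Finset.sum_comm.trans (Finset.sum_congr rfl fun t _ => ?_)
    rw [← Finset.mul_sum, Finset.sum_ite_eq, if_pos (Finset.mem_image_of_mem _ (Finset.mem_univ s))]
  rw [h1, h8]
  exact Finset.sum_nonneg fun d _ => h2 d

theorem conj_formT (q : ℝ) (A B : TP H) :
    starRingEnd ℂ (formT q A (starT B)) = formT q B (starT A) := by
  rw [← formT_star, starT_starT, formT_comm]

/-- The semi-inner product of `𝒯𝒫(H)` for `q ∈ Z`. -/
abbrev innerCore {q : ℝ} (hq : q ∈ Z) : PreInnerProductSpace.Core ℂ (TP H) where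
  inner A B := formT q B (starT A)
  conj_inner_symm A B := conj_formT q A B
  re_inner_nonneg A := (Complex.nonneg_iff.mp (formT_self_nonneg hq A)).1
  add_left A B D := by simp
  smul_left A B c := by simp

/-- Cauchy-Schwarz for the semi-inner product. -/
theorem formT_eq_zero {q : ℝ} (hq : q ∈ Z) {A : TP H} (hA : formT q A (starT A) = 0) (B : TP H) :
    formT q A B = 0 := by
  let _ := innerCore (H := H) hq
  have h : ‖formT q A (starT (starT B))‖ * ‖formT q (starT B) (starT A)‖ ≤
      (formT q (starT B) (starT (starT B))).re * (formT q A (starT A)).re :=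
    InnerProductSpace.Core.inner_mul_inner_self_le (𝕜 := ℂ) (starT B) A
  rw [hA, Complex.zero_re, mul_zero, ← conj_formT q A (starT B), RCLike.norm_conj,
    starT_starT] at h
  exact norm_eq_zero.mp (mul_self_eq_zero.mp (le_antisymm h (mul_self_nonneg _)))

/-- Null vectors are orthogonal to everything, hence lie in the kernel of `formT`. Being a subspace,
the kernel also contains their span. -/
theorem mem_Nvs_iff {q : ℝ} (hq : q ∈ Z) (A : TP H) : A ∈ Nvs H q ↔ ∀ B, formT q A B = 0 := by
  refine ⟨fun h => ?_, fun h => Submodule.subset_span ?_⟩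
  · have : Nvs H q ≤ LinearMap.ker (formT (H := H) q) := by
      refine Submodule.span_le.mpr fun A hA => ?_
      rw [Set.mem_ofPred_eq, innerTP_eq] at hA
      exact LinearMap.ext fun B => formT_eq_zero hq hA B
    exact LinearMap.congr_fun (LinearMap.mem_ker.mp (this h))
  · rw [Set.mem_ofPred_eq, innerTP_eq]
    exact h _

end Positivity

/-! ### The quotient by the null space -/

section NullSpace

variable {H : Type*} [NormedAddCommGroup H] [InnerProductSpace ℝ H]

theorem hprod_mem_Nvs {q : ℝ} (hq : q ∈ Z) {A : TP H} (hA : A ∈ Nvs H q) (B : TP H) :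
    hprod q A B ∈ Nvs H q := by
  rw [mem_Nvs_iff hq] at hA ⊢
  intro D
  rw [formT_hprod, hA]

/-- Cyclicity brings `A` to the first slot, so the radical is an ideal on this side as well. -/
theorem hprod_mem_Nvs_right {q : ℝ} (hq : q ∈ Z) {A : TP H} (hA : A ∈ Nvs H q) (B : TP H) :
    hprod q B A ∈ Nvs H q := by
  rw [mem_Nvs_iff hq] at hA ⊢
  intro D
  rw [formT_hprod, formT_comm, formT_hprod, hA]

theorem starT_mem_Nvs {q : ℝ} (hq : q ∈ Z) {A : TP H} (hA : A ∈ Nvs H q) :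
    starT A ∈ Nvs H q := by
  rw [mem_Nvs_iff hq] at hA ⊢
  intro D
  rw [formT_starT_left, hA, map_zero]

/-- `φ` is the pairing with the unit, and this makes it vanish on the radical. -/
theorem formT_unit (q : ℝ) (A : TP H) : formT q A (J (1 : S0 0) Fin.elim0) = phi H A := by
  induction A using TP_induction with
  | pure n α h =>
    rw [formT_J, phi_J, Nat.card_fin, pairing]
    cases n with
    | zero =>
      have : ∀ β : Perm (Option (Fin 0)), numCycles β = 1 := fun β => by
        rw [Subsingleton.elim β 1, numCycles_one, Finite.card_option, Nat.card_fin]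
      simp [this]
    | succ n =>
      have : IsEmpty (Fin 0 ≃ Fin (n + 1)) := ⟨fun e => (e.symm 0).elim0⟩
      simp
  | add A B hA hB => rw [map_add, map_add, LinearMap.add_apply, hA, hB]
  | smul c A hA => rw [map_smul, map_smul, LinearMap.smul_apply, hA]

theorem phi_eq_zero_of_mem_Nvs {q : ℝ} (hq : q ∈ Z) {A : TP H} (hA : A ∈ Nvs H q) :
    phi H A = 0 := by
  rw [← formT_unit q, (mem_Nvs_iff hq A).mp hA]

/-- The product of the quotient. -/
def mulQ {q : ℝ} (hq : q ∈ Z) : TPq H q →ₗ[ℂ] TPq H q →ₗ[ℂ] TPq H q :=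
  (Nvs H q).liftQ
    (((Nvs H q).liftQ ((hprod q).compr₂ (Nvs H q).mkQ).flip fun B hB =>
      LinearMap.mem_ker.mpr (LinearMap.ext fun A =>
        (Submodule.Quotient.mk_eq_zero _).mpr (hprod_mem_Nvs_right hq hB A))).flip)
    fun A hA => LinearMap.mem_ker.mpr <| LinearMap.ext fun b => by
      obtain ⟨B, rfl⟩ := (Nvs H q).mkQ_surjective b
      exact (Submodule.Quotient.mk_eq_zero _).mpr (hprod_mem_Nvs hq hA B)

/-- The involution of the quotient. -/
def starQ {q : ℝ} (hq : q ∈ Z) : TPq H q →ₗ⋆[ℂ] TPq H q :=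
  (Nvs H q).mapQ (Nvs H q) starT fun _ hA => starT_mem_Nvs hq hA

/-- The functional `φ` on the quotient. -/
def phiQ {q : ℝ} (hq : q ∈ Z) : TPq H q →ₗ[ℂ] ℂ :=
  (Nvs H q).liftQ (phi H) fun _ hA => phi_eq_zero_of_mem_Nvs hq hA

theorem formT_self_eq_zero_iff {q : ℝ} (hq : q ∈ Z) (A : TP H) :
    formT q (starT A) A = 0 ↔ A ∈ Nvs H q := by
  rw [formT_comm, mem_Nvs_iff hq]
  exact ⟨fun h => formT_eq_zero hq h, fun h => h _⟩

end NullSpace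

/-! ### Moments -/

section Moments

variable {H : Type*} [NormedAddCommGroup H] [InnerProductSpace ℝ H]

/-- `π` exchanges the smaller and the larger elements of its pairs. -/
theorem two_mul_numPairs_add_numSing {n : ℕ} (π : P12 n) : 2 * numPairs π + numSing π = n := by
  have h1 : numPairs π = (Finset.univ.filter fun i => π.1 i < i).card := by
    refine Finset.card_equiv π.1 fun i => ?_
    simp [openers, apply_apply]
  have h2 : numPairs π + (Finset.univ.filter fun i => π.1 i < i).card + numSing π =
      (Finset.univ : Finset (Fin n)).card := by
    rw [numPairs, numSing, openers, sing, Finset.card_filter, Finset.card_filter,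
      Finset.card_filter, Finset.card_eq_sum_ones, ← Finset.sum_add_distrib,
      ← Finset.sum_add_distrib]
    refine Finset.sum_congr rfl fun i _ => ?_
    rcases lt_trichotomy i (π.1 i) with h | h | h
    · simp [h, h.ne', h.le]
    · simp [← h]
    · simp [h, h.ne, h.le]
  rw [Finset.card_univ, Fintype.card_fin] at h2
  omega

theorem phiV_elt {n : ℕ} (α : S0 n) (F : ⨂[ℝ]^n H) :
    phiV H (elt α F) = (scalarPart H n F : ℂ) := by
  simp [phiV, elt]

theorem scalarPart_of_ne {n : ℕ} (hn : n ≠ 0) (F : ⨂[ℝ]^n H) : scalarPart H n F = 0 := by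
  cases n with
  | zero => exact absurd rfl hn
  | succ n => rfl

theorem phi_T_elt (q : ℝ) {n : ℕ} (α : S0 n) (F : ⨂[ℝ]^n H) :
    phi H (T H q (elt α F)) = ∑ π : P12 n,
      ((contrWeight q π α * scalarPart H _ (contrTensor H π F) : ℝ) : ℂ) := by
  rw [T, LinearMap.comp_apply, phi_I, expL, elt, DirectSum.toModule_lof, LinearMap.sum_apply,
    map_sum]
  refine Finset.sum_congr rfl fun π _ => ?_
  have : contr H q π (Finsupp.single α 1 ⊗ₜ[ℝ] F) =
      (contrWeight q π α : ℂ) • elt (contrPerm π α) (contrTensor H π F) := by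
    simp only [contr, contrGA, LinearMap.comp_apply, TensorProduct.AlgebraTensorModule.map_tmul,
      Finsupp.linearCombination_single, one_smul, elt]
    rw [← map_smul, TensorProduct.smul_tmul', Finsupp.smul_single, smul_eq_mul, mul_one]
  rw [one_pow, one_smul, this, map_smul, phiV_elt, smul_eq_mul, Complex.ofReal_mul]

theorem cyc0_of_eq_zero {n : ℕ} (hn : n = 0) (α : S0 n) : cyc0 α = 0 := by
  subst hn
  rw [cyc0, cyc_eq_numCycles, Subsingleton.elim α 1, numCycles_one, Finite.card_option,
    Nat.card_fin]

theorem numSing_eq_zero_iff {n : ℕ} (π : P12 n) : numSing π = 0 ↔ ∀ i, π.1 i ≠ i := by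
  simp [numSing, sing, Finset.filter_eq_empty_iff]

/-- Only partitions without singletons reach degree `0`. They have `n` pairs, and the contracted
permutation has no cycle other than that of `0`. -/
theorem phi_T_even (q : ℝ) (n : ℕ) (α : S0 (2 * n)) (F : ⨂[ℝ]^(2 * n) H) :
    phi H (T H q (elt α F)) = ∑ π : {π : P12 (2 * n) // ∀ i, π.1 i ≠ i},
      ((q ^ ((n : ℤ) - (cyc0 (fixZero π.1.1 * α) : ℤ)) *
        scalarPart H _ (contrTensor H π.1 F) : ℝ) : ℂ) := by
  rw [phi_T_elt]
  rw [← Finset.sum_filter_of_ne (p := fun π : P12 (2 * n) => ∀ i, π.1 i ≠ i)]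
  · rw [Finset.sum_subtype (p := fun π : P12 (2 * n) => ∀ i, π.1 i ≠ i) _ (by simp)]
    refine Finset.sum_congr rfl fun π _ => ?_
    have h0 := (numSing_eq_zero_iff π.1).mpr π.2
    have h1 := two_mul_numPairs_add_numSing π.1
    have h2 : numPairs π.1 = n := by omega
    rw [contrWeight, cyc0_of_eq_zero h0, h2]
    congr 3
    ring
  · intro π _ h
    rw [← numSing_eq_zero_iff]
    by_contra h0
    rw [scalarPart_of_ne h0, mul_zero] at h
    exact h rfl

theorem phi_T_odd (q : ℝ) (n : ℕ) (α : S0 (2 * n + 1)) (F : ⨂[ℝ]^(2 * n + 1) H) :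
    phi H (T H q (elt α F)) = 0 := by
  rw [phi_T_elt]
  refine Finset.sum_eq_zero fun π _ => ?_
  have h1 := two_mul_numPairs_add_numSing π
  rw [scalarPart_of_ne (by omega), mul_zero, Complex.ofReal_zero]

end Moments

/-! ### Uniqueness of the functional. -/

section Uniqueness

variable {H : Type*} [NormedAddCommGroup H] [InnerProductSpace ℝ H]

theorem phi_I_elt_of_pos {n : ℕ} (hn : 0 < n) (α : S0 n) (F : ⨂[ℝ]^n H) :
    phi H (I H (elt α F)) = 0 := by
  rw [phi_I, phiV_elt, scalarPart_of_ne hn.ne', Complex.ofReal_zero]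

theorem phi_unit : phi H (I H (unit H)) = 1 := by
  rw [unit, ← J_fin, phi_J, Nat.card_fin, if_pos rfl]

theorem eq_phi {ψ : TP H →ₗ[ℂ] ℂ}
    (h : ∀ (n : ℕ) (α : S0 n) (F : ⨂[ℝ]^n H), 0 < n → ψ (I H (elt α F)) = 0)
    (h1 : ψ (I H (unit H)) = 1) : ψ = phi H := by
  refine LinearMap.ext fun A => ?_
  induction A using TP_induction with
  | pure n α f =>
    rw [J_fin]
    rcases Nat.eq_zero_or_pos n with rfl | hn
    · rw [Subsingleton.elim α 1, Subsingleton.elim f Fin.elim0]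
      exact h1.trans phi_unit.symm
    · rw [h n _ _ hn, phi_I_elt_of_pos hn]
  | add A B hA hB => rw [map_add, map_add, hA, hB]
  | smul c A hA => rw [map_smul, map_smul, hA]

end Uniqueness

end HermiteTrace

end

/-! ### The theorem. -/

open HermiteTrace in
theorem mainTheorem1 (H : Type*) [NormedAddCommGroup H] [InnerProductSpace ℝ H] [CompleteSpace H]
    (q : ℝ) :
    -- `φ` is the unique linear functional with the defining properties
    (∀ ψ : TP H →ₗ[ℂ] ℂ,
      ((∀ (n : ℕ) (α : S0 n) (F : ⨂[ℝ]^n H), 0 < n → ψ (I H (elt α F)) = 0) ∧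
        ψ (I H (unit H)) = 1) ↔ ψ = phi H) ∧
    -- the pairing given by `φ` is the `q`-inner product, and the involution is the adjoint for it
    (∀ (n k : ℕ) (α : S0 n) (β : S0 k) (F : ⨂[ℝ]^n H) (G : ⨂[ℝ]^k H), n ≠ k →
      phi H (mul H q (adj H q (I H (elt β G))) (I H (elt α F))) = 0) ∧
    (∀ (n : ℕ) (α β : S0 n) (F G : ⨂[ℝ]^n H),
      phi H (mul H q (adj H q (I H (elt β G))) (I H (elt α F))) =
        ∑ σ : Equiv.Perm (Fin n),
          ((chi q (α * fixZero σ * β⁻¹ * (fixZero σ)⁻¹) * tensorInner H n F (U H σ G) : ℝ) : ℂ)) ∧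
    (∀ A B : TP H, phi H (mul H q (adj H q B) A) = innerTP H q A B) ∧
    (∀ A B C : TP H, innerTP H q (mul H q A B) C = innerTP H q B (mul H q (adj H q A) C)) ∧
    (∀ A B C : TP H, innerTP H q (mul H q B A) C = innerTP H q B (mul H q C (adj H q A))) ∧
    -- `φ` is tracial
    (∀ A B : TP H, phi H (mul H q A B) = phi H (mul H q B A)) ∧
    -- `φ` is positive
    (q ∈ Z → ∀ A : TP H, 0 ≤ phi H (mul H q (adj H q A) A)) ∧
    -- the null space of `φ`
    (q ∈ Z → {A : TP H | phi H (mul H q (adj H q A) A) = 0} = (Nvs H q : Set (TP H))) ∧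
    -- product, involution and `φ` descend to the quotient, and `φ` is faithful there
    (q ∈ Z → ∃ (mulq : TPq H q →ₗ[ℂ] TPq H q →ₗ[ℂ] TPq H q) (adjq : TPq H q → TPq H q)
        (phiq : TPq H q →ₗ[ℂ] ℂ),
      (∀ A B : TP H, mulq ((Nvs H q).mkQ A) ((Nvs H q).mkQ B) = (Nvs H q).mkQ (mul H q A B)) ∧
      (∀ A : TP H, adjq ((Nvs H q).mkQ A) = (Nvs H q).mkQ (adj H q A)) ∧
      (∀ A : TP H, phiq ((Nvs H q).mkQ A) = phi H A) ∧
      (∀ a : TPq H q, phiq (mulq (adjq a) a) = 0 → a = 0)) ∧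
    -- the moment formula
    (q ≠ 0 → ∀ (n : ℕ) (α : S0 (2 * n)) (F : ⨂[ℝ]^(2 * n) H),
      phi H (T H q (elt α F)) =
        ∑ π : {π : P12 (2 * n) // ∀ i, π.1 i ≠ i},
          ((q ^ ((n : ℤ) - (cyc0 (fixZero π.1.1 * α) : ℤ)) *
            scalarPart H _ (contrTensor H π.1 F) : ℝ) : ℂ)) ∧
    (q ≠ 0 → ∀ (n : ℕ) (α : S0 (2 * n + 1)) (F : ⨂[ℝ]^(2 * n + 1) H),
      phi H (T H q (elt α F)) = 0) := by

  have hadj : ∀ A B : TP H, phi H (mul H q (adj H q B) A) = formT q A (starT B) := fun A B => by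
    rw [mul_eq_hprod, adj_eq_starT, phi_hprod, formT_comm]
  refine ⟨fun ψ => ⟨fun h => eq_phi h.1 h.2, ?_⟩, ?_, ?_, ?_, ?_, ?_, ?_, ?_, ?_, ?_,
    fun _ => phi_T_even q, fun _ => phi_T_odd q⟩
  · rintro rfl
    exact ⟨fun n α F hn => phi_I_elt_of_pos hn α F, phi_unit⟩
  · intro n k α β F G hnk
    rw [hadj, starT_I, starV_elt, formT_I, formV_elt_of_ne q hnk]
  · intro n α β F G
    rw [hadj, starT_I, starV_elt, formT_I, formV_elt]
  · intro A B
    rw [hadj, innerTP_eq]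
  · intro A B C
    -- Since `(A^* C)^*` may be replaced by `C^* A` inside the form, both sides are `φ[A B C^*]` up
    -- to cyclic rotation; the next item is the same with `φ[B A C^*]`.
    rw [innerTP_eq, innerTP_eq, mul_eq_hprod, adj_eq_starT, formT_comm q B, formT_starT_hprod,
      starT_starT, formT_hprod, formT_comm q A, formT_hprod, formT_comm]
  · intro A B C
    rw [innerTP_eq, innerTP_eq, mul_eq_hprod, adj_eq_starT, formT_comm q B, formT_starT_hprod,
      starT_starT, formT_hprod, formT_hprod, formT_comm, formT_hprod]
  · intro A B
    rw [mul_eq_hprod, phi_hprod, phi_hprod, formT_comm]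
  · intro hq A
    rw [hadj]
    exact formT_self_nonneg hq A
  · intro hq
    ext A
    rw [Set.mem_ofPred_eq, hadj, formT_comm, formT_self_eq_zero_iff hq]
    rfl
  · intro hq
    refine ⟨mulQ hq, starQ hq, phiQ hq, fun A B => ?_, fun A => ?_, fun A => rfl, fun a ha => ?_⟩
    · rw [mul_eq_hprod]
      rfl
    · rw [adj_eq_starT]
      rfl
    · obtain ⟨A, rfl⟩ := (Nvs H q).mkQ_surjective a
      have h : phi H (hprod q (starT A) A) = 0 := ha
      rw [phi_hprod, formT_self_eq_zero_iff hq] at h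
      exact (Submodule.Quotient.mk_eq_zero _).mpr h
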